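/- An overpartition of an integer $n\ge 0$ is a partition of $n$ in which the first occurrence of each distinct part size may be overlined. For an overpartition $\lambda$ let $\ell(\lambda)$ be its largest part ($0$ if $\lambda$ is empty), $n(\lambda)$ its number of parts, $\lambda_o$ the subpartition of its odd non-overlined parts, and let $\chi(\lambda)=1$ if the largest part is odd and its first occurrence is not overlined, $\chi(\lambda)=0$ otherwise. The rank of $\lambda$ is $\ell(\lambda)-n(\lambda)$ and its $M2$-rank is $\lceil \ell(\lambda)/2\rceil-n(\lambda)+n(\lambda_o)-\chi(\lambda)$. Let $\overline{N}(m,n)$ (resp. $\overline{N2}(m,n)$) be the number of overpartitions of $n$ with rank (resp. $M2$-rank) $m$. The crank of a partition is its largest part if $1$ is not a part ($0$ for the empty partition), and otherwise the number of parts larger than the number of $1$'s minus the number of $1$'s. The first residual crank of an overpartition is the crank of the partition formed by its non-overlined parts; the second residual crank is the crank of the partition formed by its even non-overlined parts divided by two. Let $\overline{M}(m,n)$ (resp. $\overline{M2}(m,n)$) be the number of overpartitions of $n$ with first (resp. second) residual crank $m$, with the convention that an overpartition for which the partition in question is the one-part partition $1$ is counted with weight $-1$ for $m=0$, weight $+1$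 for each of $m=\pm1$, and weight $0$ for all other $m$. Put $$\overline{N}_k(n)=\sum_{m\in\mathbb{Z}}m^k\overline{N}(m,n),\quad \overline{N2}_k(n)=\sum_{m\in\mathbb{Z}}m^k\overline{N2}(m,n),\quad \overline{M}_k(n)=\sum_{m\in\mathbb{Z}}m^k\overline{M}(m,n),\quad \overline{M2}_k(n)=\sum_{m\in\mathbb{Z}}m^k\overline{M2}(m,n).$$ Then for every integer $n\ge 0$, $$\overline{N}_4(n)=(-8n-1)\overline{N}_2(n)+\frac{-216+24n}{77}\,\overline{M}_2(n)+\frac{192}{77}\,\overline{M}_4(n)+\frac{260+184n}{77}\,\overline{M2}_2(n)-\frac{40}{11}\,\overline{M2}_4(n)$$ and $$\overline{N2}_4(n)=(-2n-1)\overline{N2}_2(n)+\frac{-27+3n}{77}\,\overline{M}_2(n)+\frac{24}{77}\,\overline{M}_4(n)+\frac{71-131n}{77}\,\overline{M2}_2(n)-\frac{16}{11}\,\overline{M2}_4(n).$$ -/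

import Mathlib

/-- An overpartition of `n`: a partition of `n` in which the first occurrence of each distinct
part may be overlined.  It is given by the underlying partition together with the set of those
part sizes whose first occurrence is overlined. -/
@[ext]
structure Overpartition (n : ℕ) where
  toPartition : n.Partition
  overlined : Finset ℕ
  overlined_subset : overlined ⊆ toPartition.parts.toFinset

namespace Overpartition

/-- An overpartition is a partition together with a subset of its set of part sizes. -/
def equivSigma (n : ℕ) :
    Overpartition n ≃ (p : n.Partition) × {s : Finset ℕ // s ∈ p.parts.toFinset.powerset} where
  toFun l := ⟨l.toPartition, l.overlined, Finset.mem_powerset.2 l.overlined_subset⟩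
  invFun x := ⟨x.1, x.2.1, Finset.mem_powerset.1 x.2.2⟩
  left_inv _ := rfl
  right_inv _ := rfl

instance (n : ℕ) : Fintype (Overpartition n) :=
  Fintype.ofEquiv _ (equivSigma n).symm

variable {n : ℕ}

/-- All parts, overlined or not. -/
def parts (l : Overpartition n) : Multiset ℕ := l.toPartition.parts

/-- The non-overlined parts: one copy of each overlined size is removed. -/
def nonOverlined (l : Overpartition n) : Multiset ℕ := l.parts - l.overlined.val

/-- The largest part (`0` for the empty overpartition). -/
def largestPart (l : Overpartition n) : ℕ := l.parts.sup

/-- Dyson's rank: the largest part minus the number of parts. -/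
def rank (l : Overpartition n) : ℤ := (l.largestPart : ℤ) - (l.parts.card : ℤ)

/-- `χ(λ) = 1` if the largest part is odd and non-overlined (i.e. its size does not occur
overlined), and `0` otherwise. -/
def chi (l : Overpartition n) : ℤ :=
  if Odd l.largestPart ∧ l.largestPart ∉ l.overlined then 1 else 0

/-- The `M2`-rank `⌈ℓ(λ)/2⌉ - n(λ) + n(λ_o) - χ(λ)`, where `λ_o` consists of the odd
non-overlined parts; `⌈ℓ/2⌉` is written as the natural number quotient `(ℓ + 1) / 2`. -/
def m2Rank (l : Overpartition n) : ℤ :=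
  (((l.largestPart + 1) / 2 : ℕ) : ℤ) - (l.parts.card : ℤ)
    + ((l.nonOverlined.filter (fun x => Odd x)).card : ℤ) - l.chi

end Overpartition

/-- The Andrews-Garvan crank of the partition with the given multiset of (positive) parts: the
largest part if `1` does not occur, and otherwise the number of parts larger than the number of
`1`'s minus the number of `1`'s.  The empty partition has crank `0`. -/
def partitionCrank (μ : Multiset ℕ) : ℤ :=
  if 1 ∈ μ then
    ((μ.filter (fun x => μ.count 1 < x)).card : ℤ) - (μ.count 1 : ℤ)
  else (μ.sup : ℤ)

/-- The contribution of a partition to the number of partitions with crank `m`: `1` if its crank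
is `m` and `0` otherwise, except that the partition `1` of `1` contributes `-1` for `m = 0` and
`1` for `m = 1` and `m = -1`. -/
def crankContribution (μ : Multiset ℕ) (m : ℤ) : ℤ :=
  if μ = {1} then
    if m = 0 then -1 else if m = 1 ∨ m = -1 then 1 else 0
  else if partitionCrank μ = m then 1 else 0

/-- The number of overpartitions of `n` with rank `m`. -/
def rankCount (m : ℤ) (n : ℕ) : ℕ :=
  (Finset.univ.filter (fun l : Overpartition n => l.rank = m)).card

/-- The number of overpartitions of `n` with `M2`-rank `m`. -/
def m2RankCount (m : ℤ) (n : ℕ) : ℕ :=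
  (Finset.univ.filter (fun l : Overpartition n => l.m2Rank = m)).card

/-- The (modified) number of overpartitions of `n` with first residual crank `m`, the crank of
the partition formed by the non-overlined parts. -/
def crankCount (m : ℤ) (n : ℕ) : ℤ :=
  ∑ l : Overpartition n, crankContribution l.nonOverlined m

/-- The (modified) number of overpartitions of `n` with second residual crank `m`, the crank of
the partition formed by the even non-overlined parts divided by two. -/
def crank2Count (m : ℤ) (n : ℕ) : ℤ :=
  ∑ l : Overpartition n,
    crankContribution ((l.nonOverlined.filter (fun x => Even x)).map (fun x => x / 2)) m

/-- The `k`th rank moment `∑ m ∈ ℤ, m ^ k * N(m, n)`.  Here and below only finitely many terms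
of the sum are nonzero, because there are finitely many overpartitions of `n`. -/
noncomputable def rankMoment (k n : ℕ) : ℤ := ∑ᶠ m : ℤ, m ^ k * (rankCount m n : ℤ)

/-- The `k`th `M2`-rank moment. -/
noncomputable def m2RankMoment (k n : ℕ) : ℤ := ∑ᶠ m : ℤ, m ^ k * (m2RankCount m n : ℤ)

/-- The `k`th first residual crank moment. -/
noncomputable def crankMoment (k n : ℕ) : ℤ := ∑ᶠ m : ℤ, m ^ k * crankCount m n

/-- The `k`th second residual crank moment. -/
noncomputable def crank2Moment (k n : ℕ) : ℤ := ∑ᶠ m : ℤ, m ^ k * crank2Count m n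

/-!
Let `Φ = ∑ (-1)^n q^(n^2)`, the reciprocal of the generating function of overpartitions. Abel
summation turns the second and fourth moments of both ranks into moments of the partial theta series
`∑_{n ≥ 1} (-1)^n q^(n^2 + n m)`, weighted by powers of `m`. Completing the square in the exponents,
these moments satisfy linear relations with the logarithmic derivative `L` of `Φ` under `q d/dq` and
with Lambert series. The residual crank moments are, after division by the generating function of
overpartitions, polynomials in the Lambert series `∑ k^r q^k / (1 - q^k)` and their images under
`q ↦ q^2`: dividing the crank generating function by Jacobi's triple product, one reads them off
from the logarithmic derivative in `z` of that product. What remains are polynomial relations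
between Lambert series, namely Ramanujan's differential equation for the Eisenstein series of
weight two and an expression for `L^2`, which come from the same logarithmic derivatives, applied to
`∑ (-1)^n q^(n (n - 1) / 2) z^n` and `∑ (-1)^n q^(n^2) z^n`.
-/

open PowerSeries
open scoped PowerSeries.WithPiTopology

/-! ### Families of power series tending to zero -/

/-- A family of power series decays if it tends to `0` in the `X`-adic topology along the cofinite
filter. Decaying families are summable, and formal manipulations of their sums are legitimate. -/
def Decay {R ι : Type*} [CommRing R] (f : ι → R⟦X⟧) : Prop := ∀ d : ℕ, {i | ¬ X ^ d ∣ f i}.Finite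

namespace Decay

section Algebra

variable {R ι κ : Type*} [CommRing R] {f g : ι → R⟦X⟧}

theorem hasFiniteSupport_coeff (hf : Decay f) (d : ℕ) :
    (Function.support fun i => coeff d (f i)).Finite :=
  (hf (d + 1)).subset fun _ hi h => hi (X_pow_dvd_iff.1 h d (Nat.lt_succ_self d))

theorem of_dvd (e : ι → ℕ) (he : ∀ d, {i | e i < d}.Finite) (h : ∀ i, X ^ e i ∣ f i) : Decay f :=
  fun d => (he d).subset fun i hi => by
    by_contra h'
    exact hi ((pow_dvd_pow X (not_lt.1 h')).trans (h i))

theorem of_natAbs {c : ℤ → R⟦X⟧} (h : ∀ k, X ^ k.natAbs ∣ c k) : Decay c :=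
  of_dvd Int.natAbs (fun d => (Set.finite_Icc (-d : ℤ) d).subset fun k (hk : k.natAbs < d) =>
    Set.mem_Icc.2 (by omega)) h

theorem imp {g : ι → R⟦X⟧} (hf : Decay f) (h : ∀ d i, X ^ d ∣ f i → X ^ d ∣ g i) : Decay g :=
  fun d => (hf d).subset fun i hi h' => hi (h d i h')

theorem mono (hf : Decay f) (h : ∀ i, f i ∣ g i) : Decay g :=
  hf.imp fun _ i h' => h'.trans (h i)

theorem mul_left (hf : Decay f) (g : ι → R⟦X⟧) : Decay fun i => g i * f i :=
  hf.mono fun _ => dvd_mul_left _ _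

theorem mul_right (hf : Decay f) (g : ι → R⟦X⟧) : Decay fun i => f i * g i :=
  hf.mono fun _ => dvd_mul_right _ _

theorem neg (hf : Decay f) : Decay fun i => -f i :=
  hf.mono fun _ => dvd_neg.2 dvd_rfl

theorem add (hf : Decay f) (hg : Decay g) : Decay fun i => f i + g i := fun d =>
  ((hf d).union (hg d)).subset fun i hi => by
    by_contra h
    simp only [Set.mem_union, Set.mem_ofPred_eq, not_or, not_not] at h
    exact hi (dvd_add h.1 h.2)

theorem sub (hf : Decay f) (hg : Decay g) : Decay fun i => f i - g i := by
  simpa only [sub_eq_add_neg] using hf.add hg.neg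

theorem comp (hf : Decay f) {e : κ → ι} (he : Function.Injective e) : Decay fun k => f (e k) :=
  fun d => (hf d).preimage he.injOn

theorem comp_sub_left {c : ℤ → R⟦X⟧} (hc : Decay c) (n : ℤ) : Decay fun j => c (n - j) :=
  hc.comp (sub_right_injective (b := n))

theorem prod {h : κ → R⟦X⟧} (hf : Decay f) (hh : Decay h) :
    Decay fun x : ι × κ => f x.1 * h x.2 := fun d =>
  ((hf d).prod (hh d)).subset fun _ hx =>
    ⟨fun h' => hx (h'.mul_right _), fun h' => hx (h'.mul_left _)⟩

theorem slice {f : ι × κ → R⟦X⟧} (hf : Decay f) (i : ι) : Decay fun k => f (i, k) :=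
  hf.comp (Prod.mk_right_injective i)

theorem mul_slices {a : ι → R⟦X⟧} (ha : Decay a) {h : κ × ι → R⟦X⟧}
    (hh : ∀ i, Decay fun k => h (k, i)) : Decay fun x : κ × ι => a x.2 * h x := fun d =>
  ((ha d).biUnion fun i _ => (hh i d).image fun k => (k, i)).subset fun x hx =>
    Set.mem_biUnion (x := x.2) (fun h => hx (h.mul_right _))
      ⟨x.1, fun h => hx (h.mul_left _), rfl⟩

theorem ite (hf : Decay f) (p : ι → Prop) [DecidablePred p] :
    Decay fun i => if p i then f i else 0 :=
  hf.mono fun i => by split_ifs <;> simp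

theorem ite_eq [DecidableEq ι] (i : ι) (x : R⟦X⟧) : Decay fun j => if j = i then x else 0 :=
  fun _ => (Set.finite_singleton i).subset fun j hj => by
    by_contra h
    exact hj (by simp [show j ≠ i from h])

end Algebra

section Topology

variable {R ι κ : Type*} [CommRing R] [TopologicalSpace R] {f g : ι → R⟦X⟧}

theorem summable (hf : Decay f) : Summable f :=
  (WithPiTopology.summable_iff_summable_coeff R).2 fun d =>
    summable_of_hasFiniteSupport (hf.hasFiniteSupport_coeff d)

variable [T2Space R]

theorem coeff_tsum (hf : Decay f) (d : ℕ) : coeff d (∑' i, f i) = ∑ᶠ i, coeff d (f i) := by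
  rw [hf.summable.map_tsum _ (WithPiTopology.continuous_coeff R d)]
  exact tsum_eq_finsum (hf.hasFiniteSupport_coeff d)

theorem dvd_tsum {n : ℕ} (hf : Decay f) (h : ∀ i, X ^ n ∣ f i) : X ^ n ∣ ∑' i, f i := by
  refine X_pow_dvd_iff.2 fun m hm => ?_
  rw [hf.coeff_tsum]
  exact finsum_eq_zero_of_forall_eq_zero fun i => X_pow_dvd_iff.1 (h i) m hm

theorem tsum_fst {f : ι × κ → R⟦X⟧} (hf : Decay f) : Decay fun i => ∑' k, f (i, k) := fun d =>
  ((hf d).image Prod.fst).subset fun i hi => by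
    by_contra h
    refine hi ((hf.slice i).dvd_tsum fun k => ?_)
    by_contra h'
    exact h ⟨(i, k), h', rfl⟩

variable [IsTopologicalRing R]

theorem tsum_prod {f : ι × κ → R⟦X⟧} (hf : Decay f) : ∑' x, f x = ∑' i, ∑' k, f (i, k) :=
  hf.summable.tsum_prod' fun i => (hf.slice i).summable

theorem tsum_comm {f : ι → κ → R⟦X⟧} (hf : Decay (Function.uncurry f)) :
    ∑' i, ∑' k, f i k = ∑' k, ∑' i, f i k :=
  calc ∑' i, ∑' k, f i k = ∑' x, Function.uncurry f x := hf.tsum_prod.symm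
    _ = ∑' y, Function.uncurry f (Equiv.prodComm κ ι y) := ((Equiv.prodComm κ ι).tsum_eq _).symm
    _ = _ := (hf.comp (Equiv.prodComm κ ι).injective).tsum_prod

theorem tsum_mul_tsum {g : κ → R⟦X⟧} (hf : Decay f) (hg : Decay g) :
    (∑' i, f i) * ∑' k, g k = ∑' x : ι × κ, f x.1 * g x.2 :=
  hf.summable.tsum_mul_tsum hg.summable (hf.prod hg).summable

theorem tsum_sub (hf : Decay f) (hg : Decay g) : ∑' i, (f i - g i) = ∑' i, f i - ∑' i, g i :=
  hf.summable.tsum_sub hg.summable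

theorem tsum_add (hf : Decay f) (hg : Decay g) : ∑' i, (f i + g i) = ∑' i, f i + ∑' i, g i :=
  hf.summable.tsum_add hg.summable

theorem tsum_mul_left (hf : Decay f) (a : R⟦X⟧) : ∑' i, a * f i = a * ∑' i, f i :=
  hf.summable.tsum_mul_left a

end Topology

end Decay

theorem eq_of_forall_X_pow_dvd_sub {R : Type*} [CommRing R] {f g : R⟦X⟧}
    (h : ∀ d : ℕ, X ^ d ∣ f - g) : f = g := by
  ext d
  have := X_pow_dvd_iff.1 (h (d + 1)) d (Nat.lt_succ_self d)
  rwa [map_sub, sub_eq_zero] at this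

/-! ### The Euler operator and the substitution of `X ^ p` -/

section EulerOp

variable {R : Type*} [CommRing R]

variable (R) in
/-- The Euler operator `X d/dX`, which multiplies the `n`th coefficient by `n`. -/
noncomputable def eulerOp : Derivation R R⟦X⟧ R⟦X⟧ := (X : R⟦X⟧) • derivative R

theorem coeff_eulerOp (f : R⟦X⟧) (n : ℕ) : coeff n (eulerOp R f) = n * coeff n f := by
  simp only [eulerOp, Derivation.coe_smul, Pi.smul_apply, smul_eq_mul]
  cases n with
  | zero => simp
  | succ n => rw [coeff_succ_X_mul, coeff_derivative]; push_cast; ring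

theorem eulerOp_X_pow (n : ℕ) : eulerOp R (X ^ n) = (n : R⟦X⟧) * X ^ n := by
  ext m
  rw [coeff_eulerOp, ← map_natCast (C (R := R)), coeff_C_mul, coeff_X_pow]
  split_ifs with h <;> simp [h]

theorem eulerOp_mul (f g : R⟦X⟧) : eulerOp R (f * g) = f * eulerOp R g + g * eulerOp R f :=
  (eulerOp R).leibniz f g

theorem eulerOp_intCast_mul (m : ℤ) (f : R⟦X⟧) : eulerOp R ((m : R⟦X⟧) * f) = m * eulerOp R f := by
  simp

theorem eulerOp_ofNat_mul (k : ℕ) [k.AtLeastTwo] (f : R⟦X⟧) :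
    eulerOp R (OfNat.ofNat k * f) = OfNat.ofNat k * eulerOp R f := by
  simpa using eulerOp_intCast_mul (OfNat.ofNat k) f

theorem X_pow_dvd_eulerOp {f : R⟦X⟧} {n : ℕ} (h : X ^ n ∣ f) : X ^ n ∣ eulerOp R f := by
  rw [X_pow_dvd_iff] at h ⊢
  intro m hm
  rw [coeff_eulerOp, h m hm, mul_zero]

theorem Decay.eulerOp {ι : Type*} {f : ι → R⟦X⟧} (hf : Decay f) :
    Decay fun i => eulerOp R (f i) :=
  hf.imp fun _ _ => X_pow_dvd_eulerOp

theorem Decay.eulerOp_tsum [TopologicalSpace R] [T2Space R] {ι : Type*} {f : ι → R⟦X⟧}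
    (hf : Decay f) : _root_.eulerOp R (∑' i, f i) = ∑' i, _root_.eulerOp R (f i) := by
  ext n
  rw [coeff_eulerOp, hf.coeff_tsum, hf.eulerOp.coeff_tsum,
    mul_finsum' _ _ (hf.hasFiniteSupport_coeff n)]
  simp only [coeff_eulerOp]

variable {p : ℕ} (hp : p ≠ 0)

theorem eulerOp_expand (f : R⟦X⟧) : eulerOp R (expand p hp f) = p * expand p hp (eulerOp R f) := by
  ext n
  rw [coeff_eulerOp, ← map_natCast (C (R := R)), coeff_C_mul]
  by_cases h : p ∣ n
  · obtain ⟨m, rfl⟩ := h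
    rw [coeff_expand_mul, coeff_expand_mul, coeff_eulerOp]; push_cast; ring
  · simp only [coeff_expand_of_not_dvd _ _ _ h, mul_zero]

theorem X_pow_dvd_expand {f : R⟦X⟧} {n : ℕ} (h : X ^ n ∣ f) : X ^ n ∣ expand p hp f := by
  obtain ⟨g, rfl⟩ := h
  rw [map_mul, map_pow, expand_X, ← pow_mul]
  exact (pow_dvd_pow X (Nat.le_mul_of_pos_left n (Nat.pos_of_ne_zero hp))).mul_right _

theorem Decay.expand {ι : Type*} {f : ι → R⟦X⟧} (hf : Decay f) :
    Decay fun i => expand p hp (f i) :=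
  hf.imp fun _ _ => X_pow_dvd_expand hp

theorem Decay.expand_tsum [TopologicalSpace R] [T2Space R] {ι : Type*} {f : ι → R⟦X⟧}
    (hf : Decay f) :
    PowerSeries.expand p hp (∑' i, f i) = ∑' i, PowerSeries.expand p hp (f i) := by
  ext n
  rw [(hf.expand hp).coeff_tsum]
  by_cases h : p ∣ n
  · obtain ⟨m, rfl⟩ := h
    simp only [coeff_expand_mul, hf.coeff_tsum]
  · simp only [coeff_expand_of_not_dvd _ _ _ h, finsum_zero]

end EulerOp

/-! ### Signs and powers of `X` indexed by integers -/

section IntegerPowers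

variable {R : Type*} [CommRing R]

/-- The power `X ^ k` for an integer exponent `k ≥ 0`; the value is the junk `1` if `k < 0`. -/
noncomputable def xpow (k : ℤ) : R⟦X⟧ := X ^ k.toNat

theorem xpow_natCast (k : ℕ) : xpow k = (X ^ k : R⟦X⟧) := by simp [xpow]

theorem xpow_zero : xpow 0 = (1 : R⟦X⟧) := by simp [xpow]

theorem xpow_mul_xpow {a b : ℤ} (ha : 0 ≤ a) (hb : 0 ≤ b) :
    xpow a * xpow b = (xpow (a + b) : R⟦X⟧) := by
  rw [xpow, xpow, xpow, ← pow_add, Int.toNat_add ha hb]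

theorem xpow_mul_xpow_of_add_eq {a b c : ℤ} (ha : 0 ≤ a) (hb : 0 ≤ b) (h : a + b = c) :
    xpow a * xpow b = (xpow c : R⟦X⟧) := by
  rw [xpow_mul_xpow ha hb, h]

theorem eulerOp_xpow {k : ℤ} (hk : 0 ≤ k) : eulerOp R (xpow k) = (k : R⟦X⟧) * xpow k := by
  lift k to ℕ using hk
  rw [xpow_natCast, eulerOp_X_pow, Int.cast_natCast]

theorem decay_xpow {ι : Type*} {e : ι → ℤ} (he : ∀ d : ℕ, {i | e i < d}.Finite) :
    Decay fun i => (xpow (e i) : R⟦X⟧) :=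
  .of_dvd (fun i => (e i).toNat) (fun d => (he d).subset fun i (hi : (e i).toNat < d) => by
    simp only [Set.mem_ofPred_eq]; omega) fun _ => dvd_rfl

theorem decay_xpow_of_abs_le {e : ℤ → ℤ} (b : ℤ) (he : ∀ n, |n| ≤ e n + b) :
    Decay fun n => (xpow (e n) : R⟦X⟧) :=
  decay_xpow fun d => (Set.finite_Icc (-(d + b)) (d + b)).subset fun n (hn : e n < d) =>
    abs_le.1 ((he n).trans (by linarith))

/-- The sign `(-1) ^ n`. -/
noncomputable def altSign (n : ℤ) : R⟦X⟧ := (n.negOnePow : ℤ)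

theorem altSign_zero : altSign 0 = (1 : R⟦X⟧) := by simp [altSign]

theorem altSign_succ (n : ℤ) : altSign (n + 1) = (-altSign n : R⟦X⟧) := by
  simp [altSign, Int.negOnePow_succ]

theorem altSign_neg (n : ℤ) : altSign (-n) = (altSign n : R⟦X⟧) := by simp [altSign]

theorem eulerOp_altSign (n : ℤ) : eulerOp R (altSign n) = 0 := by simp [altSign]

end IntegerPowers

theorem one_sub_X_pow_ne_zero {R : Type*} [CommRing R] [Nontrivial R] {k : ℕ} (hk : k ≠ 0) :
    (1 - X ^ k : R⟦X⟧) ≠ 0 := fun h => by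
  simpa [hk] using congrArg constantCoeff h

theorem one_sub_X_pow_mul_inv {K : Type*} [Field K] {k : ℕ} (hk : k ≠ 0) :
    (1 - X ^ k : K⟦X⟧) * (1 - X ^ k)⁻¹ = 1 :=
  PowerSeries.mul_inv_cancel _ (by simp [hk])

/-! ### Moments and convolutions of families indexed by `ℤ` -/

section Moment

variable {R : Type*} [CommRing R] {c o : ℤ → R⟦X⟧}

theorem Decay.conv_term (hc : Decay c) (n : ℤ) : Decay fun j => c (n - j) * o j :=
  (hc.comp_sub_left n).mul_right _

variable [TopologicalSpace R]

/-- The moment `∑ w(n) c(n)` of a family of power series with respect to an integral weight. -/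
noncomputable def moment (w : ℤ → ℤ) (c : ℤ → R⟦X⟧) : R⟦X⟧ := ∑' n, (w n : R⟦X⟧) * c n

/-- The convolution of two families of power series, that is, the family of coefficients of the
product of the two bilateral generating functions `∑ c(n) z^n` and `∑ o(n) z^n`. -/
noncomputable def conv (c o : ℤ → R⟦X⟧) (n : ℤ) : R⟦X⟧ := ∑' j, c (n - j) * o j

theorem moment_congr {w w' : ℤ → ℤ} (h : ∀ n, w n = w' n) : moment w c = moment w' c := by
  rw [funext h]

theorem moment_mul_family (f w : ℤ → ℤ) :
    moment w (fun n => (f n : R⟦X⟧) * c n) = moment (fun n => w n * f n) c := by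
  simp only [moment, Int.cast_mul, mul_assoc]

theorem moment_comp_sub {w : ℤ → ℤ} (s : ℤ) :
    moment w (fun n => c (n - s)) = moment (fun n => w (n + s)) c := by
  rw [moment, ← (Equiv.addRight s).tsum_eq]
  simp [moment]

theorem moment_expand [T2Space R] {p : ℕ} (hp : p ≠ 0) (hc : Decay c) (w : ℤ → ℤ) :
    moment w (fun n => expand p hp (c n)) = expand p hp (moment w c) := by
  rw [moment, moment, (hc.mul_left _).expand_tsum]
  exact tsum_congr fun n => by rw [map_mul, map_intCast]

variable [IsTopologicalRing R]

theorem tsum_eq_zero_of_reflect [T2Space R] [IsAddTorsionFree R⟦X⟧] {f : ℤ → R⟦X⟧} (s : ℤ)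
    (h : ∀ n, f (s - n) = -f n) : ∑' n, f n = 0 := by
  rw [← self_eq_neg, ← tsum_neg, ← (Equiv.subLeft s).tsum_eq]
  exact tsum_congr h

theorem moment_eq_zero_of_odd [T2Space R] [IsAddTorsionFree R⟦X⟧] {w : ℤ → ℤ}
    (h : ∀ n, (w (-n) : R⟦X⟧) * c (-n) = -(w n * c n)) : moment w c = 0 :=
  tsum_eq_zero_of_reflect 0 fun n => by rw [zero_sub, h]

theorem conv_neg [T2Space R] (hc : ∀ n, c (-n) = c n) (ho : ∀ n, o (-n) = -o n) (n : ℤ) :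
    conv c o (-n) = -conv c o n := by
  rw [conv, ← (Equiv.neg ℤ).tsum_eq, conv, ← tsum_neg]
  refine tsum_congr fun j => ?_
  rw [Equiv.neg_apply, ho, show -n - -j = -(n - j) by ring, hc]
  ring

variable [T2Space R]

theorem moment_sub {c' : ℤ → R⟦X⟧} (hc : Decay c) (hc' : Decay c') (w : ℤ → ℤ) :
    moment w (fun n => c n - c' n) = moment w c - moment w c' := by
  simp only [moment, mul_sub]
  exact (hc.mul_left _).tsum_sub (hc'.mul_left _)

theorem moment_weight_add (hc : Decay c) (v w : ℤ → ℤ) :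
    moment (fun n => v n + w n) c = moment v c + moment w c := by
  simp only [moment, Int.cast_add, add_mul]
  exact (hc.mul_left _).tsum_add (hc.mul_left _)

theorem moment_weight_sub (hc : Decay c) (v w : ℤ → ℤ) :
    moment (fun n => v n - w n) c = moment v c - moment w c := by
  simp only [moment, Int.cast_sub, sub_mul]
  exact (hc.mul_left _).tsum_sub (hc.mul_left _)

theorem moment_weight_const_mul (hc : Decay c) (a : ℤ) (w : ℤ → ℤ) :
    moment (fun n => a * w n) c = a * moment w c := by
  simp only [moment, Int.cast_mul, mul_assoc]
  exact (hc.mul_left _).tsum_mul_left _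

theorem moment_mul_moment (hc : Decay c) (ho : Decay o) (u v : ℤ → ℤ) :
    moment u c * moment v o =
      ∑' x : ℤ × ℤ, ((u x.1 * v x.2 : ℤ) : R⟦X⟧) * (c x.1 * o x.2) := by
  rw [moment, moment, (hc.mul_left _).tsum_mul_tsum (ho.mul_left _)]
  exact tsum_congr fun x => by push_cast; ring

/-- The shear `(n, j) ↦ (n - t j, j)`. -/
def shear (t : ℤ) : ℤ × ℤ ≃ ℤ × ℤ where
  toFun x := (x.1 - t * x.2, x.2)
  invFun x := (x.1 + t * x.2, x.2)
  left_inv x := by simp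
  right_inv x := by simp

theorem moment_conv_eq_tsum (hc : Decay c) (ho : Decay o) (w : ℤ → ℤ) :
    moment w (conv c o) = ∑' x : ℤ × ℤ, (w (x.1 + x.2) : R⟦X⟧) * (c x.1 * o x.2) := by
  have h : Decay fun x : ℤ × ℤ => (w x.1 : R⟦X⟧) * (c (x.1 - x.2) * o x.2) :=
    Decay.mul_left (by simpa [shear] using (hc.prod ho).comp (shear 1).injective) _
  calc moment w (conv c o) = ∑' n, ∑' j, (w n : R⟦X⟧) * (c (n - j) * o j) :=
        tsum_congr fun n => ((hc.conv_term n).tsum_mul_left _).symm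
    _ = ∑' x : ℤ × ℤ, (w x.1 : R⟦X⟧) * (c (x.1 - x.2) * o x.2) := h.tsum_prod.symm
    _ = _ := by
        rw [← (shear 1).symm.tsum_eq]
        simp [shear]

theorem moment_conv (hc : Decay c) (ho : Decay o) (r : ℕ) {w u v : ℤ → ℤ}
    (h : ∀ m j, w (m + j) = (u m + v j) ^ r) :
    moment w (conv c o) = ∑ i ∈ Finset.range (r + 1),
      (r.choose i : R⟦X⟧) * (moment (fun n => u n ^ i) c * moment (fun n => v n ^ (r - i)) o) := by
  have hterm (i : ℕ) := ((hc.prod ho).mul_left fun x : ℤ × ℤ =>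
    ((u x.1 ^ i * v x.2 ^ (r - i) : ℤ) : R⟦X⟧))
  simp only [moment_mul_moment hc ho]
  rw [moment_conv_eq_tsum hc ho, ← Finset.sum_congr rfl fun i _ => (hterm i).tsum_mul_left _,
    ← Summable.tsum_finsetSum fun i _ => ((hterm i).mul_left _).summable]
  refine tsum_congr fun x => ?_
  rw [h, add_pow, Int.cast_sum, Finset.sum_mul]
  exact Finset.sum_congr rfl fun i _ => by push_cast; ring

end Moment

instance : CharZero ℚ⟦X⟧ := algebraRat.charZero _

/-! ### Lambert series -/

/-- The terms `sgn(k) X ^ |k| / (1 - X ^ |k|)` of Lambert series, extended to an odd function on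
`ℤ`. -/
noncomputable def lambertTerm (k : ℤ) : ℚ⟦X⟧ :=
  (k.sign : ℚ⟦X⟧) * (X ^ k.natAbs * (1 - X ^ k.natAbs)⁻¹)

theorem lambertTerm_neg (k : ℤ) : lambertTerm (-k) = -lambertTerm k := by simp [lambertTerm]

theorem lambertTerm_zero : lambertTerm 0 = 0 := by simp [lambertTerm]

theorem one_sub_mul_lambertTerm {k : ℕ} (hk : k ≠ 0) : (1 - X ^ k) * lambertTerm k = X ^ k := by
  have h : (k : ℤ).sign = 1 := Int.sign_eq_one_of_pos (by omega)
  simp only [lambertTerm, h, Int.natAbs_natCast, Int.cast_one, one_mul]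
  rw [mul_left_comm, one_sub_X_pow_mul_inv hk, mul_one]

theorem decay_lambertTerm : Decay lambertTerm :=
  .of_natAbs fun _ => (dvd_mul_right _ _).mul_left _

theorem lambertTerm_two_mul (k : ℤ) :
    lambertTerm (2 * k) = expand 2 two_ne_zero (lambertTerm k) := by
  rcases eq_or_ne k 0 with rfl | hk
  · simp [lambertTerm_zero]
  have hinv : expand 2 two_ne_zero (1 - X ^ k.natAbs : ℚ⟦X⟧)⁻¹ = (1 - X ^ (2 * k.natAbs))⁻¹ := by
    rw [PowerSeries.eq_inv_iff_mul_eq_one (by simp [hk])]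
    simpa [← pow_mul, mul_comm] using congrArg (expand 2 two_ne_zero)
      (one_sub_X_pow_mul_inv (K := ℚ) (Int.natAbs_ne_zero.2 hk))
  simp [lambertTerm, Int.natAbs_mul, Int.sign_mul, show Int.sign 2 = 1 from rfl, hinv, ← pow_mul]

/-- The expansion of `1 / (1 - X ^ k)` in nonnegative powers of `X`, for `k` of either sign; the
value at `k = 0` is `0`. -/
noncomputable def geomTerm (k : ℤ) : ℚ⟦X⟧ := lambertTerm k + if 0 < k then 1 else 0

theorem geomTerm_add_geomTerm_neg (k : ℤ) :
    geomTerm k + geomTerm (-k) = 1 - if k = 0 then 1 else 0 := by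
  rw [geomTerm, geomTerm, lambertTerm_neg]
  rcases lt_trichotomy k 0 with h | rfl | h
  · simp [h, h.ne, not_lt.2 h.le]
  · simp
  · simp [h, h.ne', not_lt.2 h.le]

theorem xpow_sub_xpow_mul_geomTerm {a b k : ℤ} (hk : k ≠ 0) (ha : 0 ≤ a) (hb : 0 ≤ b)
    (h : b = a + k) : (xpow a - xpow b) * geomTerm k = xpow a := by
  lift a to ℕ using ha
  lift b to ℕ using hb
  rw [xpow_natCast, xpow_natCast, geomTerm]
  rcases hk.lt_or_gt with hneg | hpos
  · obtain ⟨l, rfl⟩ : ∃ l : ℕ, k = -l := ⟨k.natAbs, by omega⟩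
    obtain rfl : a = b + l := by omega
    rw [if_neg (by omega), lambertTerm_neg, pow_add]
    linear_combination X ^ b * one_sub_mul_lambertTerm (k := l) (by omega)
  · obtain ⟨l, rfl⟩ : ∃ l : ℕ, k = l := ⟨k.natAbs, by omega⟩
    obtain rfl : b = a + l := by omega
    rw [if_pos hpos, pow_add]
    linear_combination X ^ a * one_sub_mul_lambertTerm (k := l) (by omega)

/-- The expansion of `X ^ j / (1 - X ^ (2 * j))` in nonnegative powers of `X`, an odd function
of `j`. -/
noncomputable def oddLambertTerm (j : ℤ) : ℚ⟦X⟧ := lambertTerm j - lambertTerm (2 * j)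

theorem oddLambertTerm_neg (k : ℤ) : oddLambertTerm (-k) = -oddLambertTerm k := by
  rw [oddLambertTerm, oddLambertTerm, mul_neg, lambertTerm_neg, lambertTerm_neg]; ring

theorem oddLambertTerm_zero : oddLambertTerm 0 = 0 := by simp [oddLambertTerm]

theorem decay_oddLambertTerm : Decay oddLambertTerm :=
  decay_lambertTerm.sub (decay_lambertTerm.comp (mul_right_injective₀ two_ne_zero))

theorem xpow_sub_xpow_mul_oddLambertTerm {a b c j : ℤ} (hj : j ≠ 0) (ha : 0 ≤ a) (hb : 0 ≤ b)
    (hab : b = a + 2 * j) (hc : c = a + j) :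
    (xpow a - xpow b) * oddLambertTerm j = xpow c := by
  have hgeom : oddLambertTerm j = geomTerm j - geomTerm (2 * j) := by
    simp [oddLambertTerm, geomTerm]
  have h1 := xpow_sub_xpow_mul_geomTerm hj ha (by omega) hc
  have h2 := xpow_sub_xpow_mul_geomTerm hj (a := c) (by omega) hb (by omega)
  have h3 := xpow_sub_xpow_mul_geomTerm (k := 2 * j) (by omega) ha hb hab
  rw [hgeom]
  linear_combination h1 + h2 - h3

/-- The Lambert series `∑ k ^ r X ^ k / (1 - X ^ k)` over `k ≥ 1`. -/
noncomputable def lambert (r : ℕ) : ℚ⟦X⟧ :=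
  ∑' k : ℕ, ((k + 1 : ℕ) : ℚ⟦X⟧) ^ r * lambertTerm (k + 1)

/-- The Lambert series `∑ k ^ r X ^ (2 k) / (1 - X ^ (2 k))` over `k ≥ 1`. -/
noncomputable def lambertSq (r : ℕ) : ℚ⟦X⟧ := expand 2 two_ne_zero (lambert r)

theorem Decay.tsum_int_of_even {f : ℤ → ℚ⟦X⟧} (hf : Decay f) (he : ∀ k, f (-k) = f k)
    (h0 : f 0 = 0) : ∑' k, f k = 2 * ∑' k : ℕ, f (k + 1) := by
  have h1 : Summable fun k : ℕ => f k := (hf.comp Nat.cast_injective).summable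
  have h2 : Summable fun k : ℕ => f (-(k + 1 : ℤ)) :=
    (hf.comp (e := fun k : ℕ => (-(k + 1 : ℤ))) fun a b h => by simpa using h).summable
  rw [tsum_of_nat_of_neg_add_one h1 h2, h1.tsum_eq_zero_add]
  simp only [he, Nat.cast_zero, h0, zero_add, Nat.cast_add, Nat.cast_one, two_mul]

theorem moment_lambertTerm {r : ℕ} (hr : Odd r) :
    moment (fun n => n ^ r) lambertTerm = 2 * lambert r := by
  rw [moment, (decay_lambertTerm.mul_left _).tsum_int_of_even _ (by simp [lambertTerm_zero])]
  · simp [lambert]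
  · intro k
    rw [lambertTerm_neg, hr.neg_pow]; push_cast; ring

theorem moment_lambertTerm_even {r : ℕ} (hr : Even r) :
    moment (fun n => n ^ r) lambertTerm = 0 :=
  moment_eq_zero_of_odd fun n => by rw [lambertTerm_neg, hr.neg_pow]; ring

theorem moment_oddLambertTerm {r : ℕ} (hr : Odd r) :
    moment (fun n => n ^ r) oddLambertTerm = 2 * (lambert r - lambertSq r) := by
  have h : oddLambertTerm = fun j => lambertTerm j - expand 2 two_ne_zero (lambertTerm j) :=
    funext fun j => by rw [oddLambertTerm, lambertTerm_two_mul]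
  rw [h, moment_sub decay_lambertTerm (decay_lambertTerm.expand _),
    moment_expand _ decay_lambertTerm, moment_lambertTerm hr, map_mul, map_ofNat, lambertSq]
  ring

/-! ### The theta series `∑ (-1) ^ n X ^ (n ^ 2)` -/

/-- The terms `(-1) ^ n X ^ (n ^ 2)`. -/
noncomputable def thetaTerm (n : ℤ) : ℚ⟦X⟧ := altSign n * xpow (n ^ 2)

theorem thetaTerm_neg (n : ℤ) : thetaTerm (-n) = thetaTerm n := by
  rw [thetaTerm, thetaTerm, altSign_neg, neg_sq]

theorem thetaTerm_zero : thetaTerm 0 = 1 := by simp [thetaTerm, altSign_zero, xpow_zero]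

theorem decay_thetaTerm : Decay thetaTerm :=
  (decay_xpow_of_abs_le 0 fun n => by
    rw [← sq_abs, add_zero]
    exact Int.le_self_sq _).mul_left _

theorem thetaTerm_succ (n : ℕ) : thetaTerm (n + 1) = -(xpow (2 * n + 1) * thetaTerm n) := by
  rw [thetaTerm, thetaTerm, altSign_succ, mul_left_comm,
    xpow_mul_xpow_of_add_eq (c := (n + 1 : ℤ) ^ 2) (by positivity) (by positivity) (by ring)]
  ring

theorem eulerOp_thetaTerm (n : ℤ) :
    eulerOp ℚ (thetaTerm n) = ((n ^ 2 : ℤ) : ℚ⟦X⟧) * thetaTerm n := by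
  rw [thetaTerm, eulerOp_mul, eulerOp_altSign, eulerOp_xpow (sq_nonneg n)]
  ring

theorem thetaTerm_mul_oddLambertTerm (n : ℕ) (j : ℤ) :
    thetaTerm (n + 1 - j) * oddLambertTerm j =
      -(xpow (2 * n + 1) * (thetaTerm (n - j) * oddLambertTerm j))
      - altSign (n - j) * xpow ((n - j) ^ 2 + (n - j) + n + 1)
      - if j = 0 then thetaTerm (n + 1) else 0 := by
  rcases eq_or_ne j 0 with rfl | hj
  · rw [if_pos rfl, oddLambertTerm_zero, sub_zero, sub_zero, thetaTerm, altSign_succ,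
      show ((n : ℤ) + 1) ^ 2 = n ^ 2 + n + n + 1 by ring]
    ring
  · have hkey := xpow_sub_xpow_mul_oddLambertTerm (a := (n - j + 1) ^ 2)
      (b := 2 * n + 1 + (n - j) ^ 2) hj (by positivity) (by positivity) (by ring) rfl
    rw [if_neg hj, show (n : ℤ) + 1 - j = n - j + 1 by ring, thetaTerm, thetaTerm, altSign_succ,
      show ((n : ℤ) - j) ^ 2 + (n - j) + n + 1 = (n - j + 1) ^ 2 + j by ring]
    rw [← xpow_mul_xpow (a := 2 * (n : ℤ) + 1) (by positivity) (by positivity)] at hkey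
    linear_combination -altSign (n - j : ℤ) * hkey

theorem decay_altSign_mul_xpow (n : ℕ) :
    Decay fun j : ℤ => (altSign (n - j) * xpow ((n - j) ^ 2 + (n - j) + n + 1) : ℚ⟦X⟧) :=
  Decay.comp_sub_left (c := fun m => altSign m * xpow (m ^ 2 + m + n + 1))
    ((decay_xpow_of_abs_le 0 fun m => abs_le.2 ⟨by nlinarith, by nlinarith⟩).mul_left _) n

theorem tsum_altSign_mul_xpow (n : ℕ) :
    ∑' j : ℤ, (altSign (n - j) * xpow ((n - j) ^ 2 + (n - j) + n + 1) : ℚ⟦X⟧) = 0 := by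
  refine tsum_eq_zero_of_reflect (2 * n + 1) fun j => ?_
  rw [show (n : ℤ) - (2 * n + 1 - j) = -(n - j + 1) by ring, altSign_neg, altSign_succ,
    show (-((n : ℤ) - j + 1)) ^ 2 + -(n - j + 1) + n + 1 = (n - j) ^ 2 + (n - j) + n + 1 by ring,
    neg_mul]

theorem conv_theta_oddLambert_succ (n : ℕ) :
    conv thetaTerm oddLambertTerm (n + 1) =
      -(xpow (2 * n + 1) * conv thetaTerm oddLambertTerm n) - thetaTerm (n + 1) := by
  have hterm := (decay_thetaTerm.conv_term (o := oddLambertTerm) n).mul_left fun _ =>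
    xpow (2 * n + 1)
  rw [conv, tsum_congr (thetaTerm_mul_oddLambertTerm n),
    (hterm.neg.sub (decay_altSign_mul_xpow n)).tsum_sub (Decay.ite_eq 0 _),
    hterm.neg.tsum_sub (decay_altSign_mul_xpow n), tsum_neg,
    (decay_thetaTerm.conv_term n).tsum_mul_left, tsum_altSign_mul_xpow, tsum_ite_eq, sub_zero, conv]

/-- The logarithmic derivative in `z` of the triple product `∑ (-1) ^ n X ^ (n ^ 2) z ^ n`. -/
theorem conv_theta_oddLambert (n : ℤ) :
    conv thetaTerm oddLambertTerm n = -((n : ℚ⟦X⟧) * thetaTerm n) := by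
  have hodd := conv_neg thetaTerm_neg oddLambertTerm_neg
  have hnat (n : ℕ) : conv thetaTerm oddLambertTerm n = -((n : ℚ⟦X⟧) * thetaTerm n) := by
    induction n with
    | zero => simpa [self_eq_neg] using hodd 0
    | succ n ih =>
      push_cast
      rw [conv_theta_oddLambert_succ, ih, thetaTerm_succ]
      ring
  rcases n.eq_nat_or_neg with ⟨k, rfl | rfl⟩
  · simpa using hnat k
  · rw [hodd, hnat, thetaTerm_neg]; simp

/-- The theta series `∑ (-1) ^ n X ^ (n ^ 2)` over `n ∈ ℤ`. -/
noncomputable def thetaSeries : ℚ⟦X⟧ := ∑' n, thetaTerm n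

theorem constantCoeff_thetaSeries : constantCoeff thetaSeries = 1 := by
  rw [← coeff_zero_eq_constantCoeff_apply, thetaSeries, decay_thetaTerm.coeff_tsum,
    finsum_eq_single _ 0]
  · simp [thetaTerm_zero]
  · intro n hn
    have := sq_pos_of_ne_zero hn
    exact X_pow_dvd_iff.1 (dvd_mul_left _ _ : X ^ (n ^ 2).toNat ∣ thetaTerm n) 0 (by omega)

theorem thetaSeries_ne_zero : thetaSeries ≠ 0 := fun h => by
  simpa [h] using constantCoeff_thetaSeries

theorem moment_thetaTerm_zero : moment (fun n => n ^ 0) thetaTerm = thetaSeries := by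
  simp [moment, thetaSeries]

theorem eulerOp_moment_thetaTerm (r : ℕ) :
    eulerOp ℚ (moment (fun n => n ^ r) thetaTerm) = moment (fun n => n ^ (r + 2)) thetaTerm := by
  rw [moment, (decay_thetaTerm.mul_left _).eulerOp_tsum, moment]
  refine tsum_congr fun n => ?_
  rw [eulerOp_intCast_mul, eulerOp_thetaTerm]; push_cast; ring

theorem moment_thetaTerm_two : moment (fun n => n ^ 2) thetaTerm = eulerOp ℚ thetaSeries := by
  rw [← moment_thetaTerm_zero, eulerOp_moment_thetaTerm]

theorem moment_thetaTerm_four :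
    moment (fun n => n ^ 4) thetaTerm = eulerOp ℚ (eulerOp ℚ thetaSeries) := by
  rw [← moment_thetaTerm_two, eulerOp_moment_thetaTerm]

theorem moment_thetaTerm_odd {r : ℕ} (hr : Odd r) : moment (fun n => n ^ r) thetaTerm = 0 :=
  moment_eq_zero_of_odd fun n => by rw [thetaTerm_neg, hr.neg_pow]; push_cast; ring

theorem moment_conv_theta_oddLambert (r : ℕ) :
    moment (fun n => n ^ r) (conv thetaTerm oddLambertTerm) =
      -moment (fun n => n ^ (r + 1)) thetaTerm := by
  rw [moment, moment, ← tsum_neg]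
  refine tsum_congr fun n => ?_
  rw [conv_theta_oddLambert]; push_cast; ring

/-- The logarithmic derivative of the theta series, see `eulerOp_thetaSeries`. -/
noncomputable def thetaLogDeriv : ℚ⟦X⟧ := 2 * (lambertSq 1 - lambert 1)

theorem eulerOp_thetaSeries : eulerOp ℚ thetaSeries = thetaSeries * thetaLogDeriv := by
  have h := moment_conv decay_thetaTerm decay_oddLambertTerm 1 (w := fun n => n ^ 1) (u := id)
    (v := id) fun m j => rfl
  simp only [moment_conv_theta_oddLambert, id, Finset.sum_range_succ, Finset.sum_range_zero,
    Nat.choose, Nat.reduceSub, Nat.reduceAdd, moment_thetaTerm_zero, moment_thetaTerm_two,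
    moment_thetaTerm_odd odd_one, moment_oddLambertTerm odd_one] at h
  push_cast at h
  rw [thetaLogDeriv]
  linear_combination -h

theorem thetaLogDeriv_sq :
    2 * thetaLogDeriv ^ 2 = eulerOp ℚ thetaLogDeriv + 2 * (lambert 3 - lambertSq 3) := by
  have h3 : Odd 3 := by decide
  have h := moment_conv decay_thetaTerm decay_oddLambertTerm 3 (w := fun n => n ^ 3) (u := id)
    (v := id) fun m j => rfl
  simp only [moment_conv_theta_oddLambert, id, Finset.sum_range_succ, Finset.sum_range_zero,
    Nat.choose, Nat.reduceSub, Nat.reduceAdd, moment_thetaTerm_zero, moment_thetaTerm_two,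
    moment_thetaTerm_four, moment_thetaTerm_odd odd_one, moment_thetaTerm_odd h3,
    moment_oddLambertTerm odd_one, moment_oddLambertTerm h3] at h
  push_cast at h
  have hsecond := congrArg (eulerOp ℚ) eulerOp_thetaSeries
  rw [eulerOp_mul] at hsecond
  have hdef : thetaLogDeriv = 2 * (lambertSq 1 - lambert 1) := rfl
  refine mul_left_cancel₀ thetaSeries_ne_zero ?_
  linear_combination h + hsecond - 2 * thetaLogDeriv * eulerOp_thetaSeries
    + 3 * eulerOp ℚ thetaSeries * hdef

/-! ### The series `∑ (-1) ^ n X ^ (n (n - 1) / 2)` and Ramanujan's differential equation -/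

/-- The triangular number `n (n - 1) / 2`. -/
def triangle (n : ℤ) : ℤ := n * (n - 1) / 2

theorem two_mul_triangle (n : ℤ) : 2 * triangle n = n * (n - 1) :=
  Int.mul_ediv_cancel' (even_iff_two_dvd.1 (Int.even_mul_pred_self n))

theorem triangle_succ (n : ℤ) : triangle (n + 1) = triangle n + n := by
  linarith [two_mul_triangle n, two_mul_triangle (n + 1)]

theorem triangle_nonneg (n : ℤ) : 0 ≤ triangle n := by
  have h := two_mul_triangle n
  rcases le_or_gt n 0 with hn | hn <;> nlinarith

theorem triangle_one_sub (n : ℤ) : triangle (1 - n) = triangle n := by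
  linarith [two_mul_triangle n, two_mul_triangle (1 - n)]

theorem triangle_pos {n : ℤ} (h0 : n ≠ 0) (h1 : n ≠ 1) : 0 < triangle n := by
  have h := two_mul_triangle n
  rcases lt_or_gt_of_ne h0 with hn | hn
  · nlinarith
  · nlinarith [show (2 : ℤ) ≤ n by omega]

/-- The terms `(-1) ^ n X ^ (n (n - 1) / 2)`, the coefficients in `z` of Jacobi's triple product
`∏ (1 - z X ^ (i - 1)) (1 - z⁻¹ X ^ i) (1 - X ^ i)`. -/
noncomputable def jacobiTerm (n : ℤ) : ℚ⟦X⟧ := altSign n * xpow (triangle n)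

theorem jacobiTerm_zero : jacobiTerm 0 = 1 := by
  simp [jacobiTerm, altSign_zero, triangle, xpow_zero]

theorem jacobiTerm_one_sub (n : ℤ) : jacobiTerm (1 - n) = -jacobiTerm n := by
  rw [jacobiTerm, jacobiTerm, triangle_one_sub, sub_eq_neg_add, altSign_succ, altSign_neg, neg_mul]

theorem jacobiTerm_one : jacobiTerm 1 = -1 := by
  simpa [jacobiTerm_zero] using jacobiTerm_one_sub 0

theorem decay_jacobiTerm : Decay jacobiTerm :=
  (decay_xpow_of_abs_le 2 fun n => by
    have := two_mul_triangle n
    exact abs_le.2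
      ⟨by nlinarith [sq_nonneg (2 * n + 1)], by nlinarith [sq_nonneg (2 * n - 3)]⟩).mul_left _

theorem tsum_jacobiTerm : ∑' n, jacobiTerm n = 0 := tsum_eq_zero_of_reflect 1 jacobiTerm_one_sub

theorem tsum_jacobiTerm_sub (n : ℤ) : ∑' j, jacobiTerm (n - j) = 0 :=
  ((Equiv.subLeft n).tsum_eq jacobiTerm).trans tsum_jacobiTerm

theorem xpow_mul_jacobiTerm {n k m : ℤ} (hn : 0 ≤ n) (hk : 0 ≤ k) (h : n = m + k) :
    xpow n * jacobiTerm m = -(xpow k * jacobiTerm (m + 1)) := by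
  have he : xpow n * xpow (triangle m) = (xpow k * xpow (triangle (m + 1)) : ℚ⟦X⟧) := by
    rw [xpow_mul_xpow hn (triangle_nonneg m), xpow_mul_xpow hk (triangle_nonneg _), triangle_succ,
      h, show m + k + triangle m = k + (triangle m + m) by ring]
  rw [jacobiTerm, jacobiTerm, altSign_succ]
  linear_combination altSign m * he

theorem jacobiTerm_mul_geomTerm (n : ℕ) (k : ℤ) : jacobiTerm (n + 1 - k) * geomTerm k =
    -(xpow n * (jacobiTerm (n - k) * geomTerm k)) + jacobiTerm (n + 1 - k)
      - if k = 0 then jacobiTerm (n + 1) else 0 := by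
  rcases eq_or_ne k 0 with rfl | hk
  · simp [geomTerm, lambertTerm_zero]
  · have hkey := xpow_sub_xpow_mul_geomTerm (a := triangle (n - k + 1))
      (b := n + triangle (n - k)) hk (triangle_nonneg _)
      (add_nonneg n.cast_nonneg (triangle_nonneg _)) (by rw [triangle_succ]; ring)
    rw [← xpow_mul_xpow n.cast_nonneg (triangle_nonneg _)] at hkey
    rw [if_neg hk, show (n : ℤ) + 1 - k = n - k + 1 by ring, jacobiTerm, jacobiTerm, altSign_succ]
    linear_combination -altSign (n - k : ℤ) * hkey

theorem conv_jacobi_geom_succ (n : ℕ) :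
    conv jacobiTerm geomTerm (n + 1) =
      -(xpow n * conv jacobiTerm geomTerm n) - jacobiTerm (n + 1) := by
  have hterm := (decay_jacobiTerm.conv_term (o := geomTerm) n).mul_left fun _ => xpow n
  have hshift := decay_jacobiTerm.comp_sub_left (n + 1)
  rw [conv, tsum_congr (jacobiTerm_mul_geomTerm n),
    (hterm.neg.add hshift).tsum_sub (Decay.ite_eq 0 _), hterm.neg.tsum_add hshift, tsum_neg,
    (decay_jacobiTerm.conv_term n).tsum_mul_left, tsum_ite_eq, tsum_jacobiTerm_sub, add_zero, conv]

theorem conv_jacobi_geom_one_sub (n : ℤ) :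
    conv jacobiTerm geomTerm (1 - n) = conv jacobiTerm geomTerm n + jacobiTerm n := by
  have hterm (k : ℤ) : jacobiTerm (1 - n - -k) * geomTerm (-k) = jacobiTerm (n - k) * geomTerm k
      - jacobiTerm (n - k) + if k = 0 then jacobiTerm n else 0 := by
    rw [show 1 - n - -k = 1 - (n - k) by ring, jacobiTerm_one_sub]
    have h := geomTerm_add_geomTerm_neg k
    split_ifs at h ⊢ with hk
    · subst hk; rw [sub_zero]; linear_combination -jacobiTerm n * h
    · linear_combination -jacobiTerm (n - k) * h
  have hconv := decay_jacobiTerm.conv_term (o := geomTerm) n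
  have hshift := decay_jacobiTerm.comp_sub_left n
  rw [conv, ← (Equiv.neg ℤ).tsum_eq]
  simp only [Equiv.neg_apply]
  rw [tsum_congr hterm, (hconv.sub hshift).tsum_add (Decay.ite_eq 0 _), hconv.tsum_sub hshift,
    tsum_jacobiTerm_sub, tsum_ite_eq, sub_zero, conv]

/-- The logarithmic derivative in `z` of Jacobi's triple product. -/
theorem conv_jacobi_geom (n : ℤ) :
    conv jacobiTerm geomTerm n = -((n : ℚ⟦X⟧) * jacobiTerm n) := by
  have hnat (n : ℕ) : conv jacobiTerm geomTerm n = -((n : ℚ⟦X⟧) * jacobiTerm n) := by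
    induction n with
    | zero =>
      have hsucc := conv_jacobi_geom_succ 0
      have hrefl := conv_jacobi_geom_one_sub 0
      simp only [Nat.cast_zero, zero_add, xpow_zero, jacobiTerm_one] at hsucc
      simp only [sub_zero, jacobiTerm_zero] at hrefl
      have : 2 * conv jacobiTerm geomTerm 0 = 0 := by linear_combination hsucc - hrefl
      simpa using this
    | succ n ih =>
      have h := xpow_mul_jacobiTerm (n := n) (m := n) n.cast_nonneg le_rfl (by ring)
      rw [xpow_zero] at h
      push_cast
      rw [conv_jacobi_geom_succ, ih]
      linear_combination (n : ℚ⟦X⟧) * h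
  rcases le_or_gt 0 n with h | h
  · lift n to ℕ using h
    simpa using hnat n
  · obtain ⟨k, rfl⟩ : ∃ k : ℕ, n = 1 - k := ⟨(1 - n).natAbs, by omega⟩
    rw [conv_jacobi_geom_one_sub, hnat, jacobiTerm_one_sub]
    push_cast; ring

/-- The first differences of `jacobiTerm`, that is, the coefficients of `1 - z` times Jacobi's
triple product. -/
noncomputable def jacobiDiff (n : ℤ) : ℚ⟦X⟧ := jacobiTerm n - jacobiTerm (n - 1)

theorem decay_jacobiTerm_sub_one : Decay fun n => jacobiTerm (n - 1) :=
  decay_jacobiTerm.comp (sub_left_injective (b := 1))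

theorem decay_jacobiDiff : Decay jacobiDiff := decay_jacobiTerm.sub decay_jacobiTerm_sub_one

theorem conv_jacobiDiff (o : ℤ → ℚ⟦X⟧) (n : ℤ) :
    conv jacobiDiff o n = conv jacobiTerm o n - conv jacobiTerm o (n - 1) := by
  rw [conv, conv, conv, ← (decay_jacobiTerm.conv_term n).tsum_sub
    (decay_jacobiTerm.conv_term (n - 1))]
  exact tsum_congr fun j => by rw [jacobiDiff, sub_mul, sub_right_comm]

theorem conv_jacobiDiff_heaviside (n : ℤ) :
    conv jacobiDiff (fun k => if 0 < k then 1 else 0) n = jacobiTerm (n - 1) := by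
  have hterm (k : ℤ) : jacobiTerm (n - 1 - (k - 1)) = jacobiTerm (n - k) := by congr 1; ring
  rw [conv_jacobiDiff, conv, conv, ← (Equiv.subRight (1 : ℤ)).tsum_eq fun j : ℤ =>
    jacobiTerm (n - 1 - j) * if 0 < j then 1 else 0]
  simp only [Equiv.subRight_apply, hterm]
  rw [← (decay_jacobiTerm.conv_term n).tsum_sub (decay_jacobiTerm.conv_term n),
    tsum_eq_single 1]
  · simp
  · intro k hk
    rcases hk.lt_or_gt with h | h
    · rw [if_neg (by omega), if_neg (by omega), sub_self]
    · rw [if_pos (by omega), if_pos (by omega), sub_self]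

theorem conv_jacobiDiff_lambertTerm (n : ℤ) :
    conv jacobiDiff lambertTerm n =
      -((n : ℚ⟦X⟧) * jacobiTerm n - ((n - 2 : ℤ) : ℚ⟦X⟧) * jacobiTerm (n - 1)) := by
  have hsplit : conv jacobiDiff lambertTerm n = conv jacobiDiff geomTerm n
      - conv jacobiDiff (fun k => if 0 < k then 1 else 0) n := by
    rw [conv, conv, conv, ← (decay_jacobiDiff.conv_term n).tsum_sub (decay_jacobiDiff.conv_term n)]
    exact tsum_congr fun k => by rw [geomTerm]; ring
  rw [hsplit, conv_jacobiDiff_heaviside, conv_jacobiDiff, conv_jacobi_geom, conv_jacobi_geom]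
  push_cast; ring

/-- The moments `∑ (2 n - 1) ^ r (-1) ^ n X ^ (n (n - 1) / 2)`, centred at the point of reflection
of `jacobiTerm`. -/
noncomputable def jacobiMoment (r : ℕ) : ℚ⟦X⟧ := moment (fun n => (2 * n - 1) ^ r) jacobiTerm

theorem eulerOp_jacobiTerm (n : ℤ) :
    8 * eulerOp ℚ (jacobiTerm n) = (((2 * n - 1) ^ 2 - 1 : ℤ) : ℚ⟦X⟧) * jacobiTerm n := by
  rw [jacobiTerm, eulerOp_mul, eulerOp_altSign, eulerOp_xpow (triangle_nonneg n),
    show ((2 * n - 1) ^ 2 - 1 : ℤ) = 8 * triangle n by linarith [two_mul_triangle n]]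
  push_cast; ring

theorem eulerOp_jacobiMoment (r : ℕ) :
    8 * eulerOp ℚ (jacobiMoment r) = jacobiMoment (r + 2) - jacobiMoment r := by
  have hdecay (s : ℕ) := decay_jacobiTerm.mul_left fun n : ℤ => (((2 * n - 1) ^ s : ℤ) : ℚ⟦X⟧)
  rw [jacobiMoment, jacobiMoment, moment, moment, (hdecay r).eulerOp_tsum,
    ← (hdecay _).tsum_sub (hdecay _), ← (hdecay r).eulerOp.tsum_mul_left]
  refine tsum_congr fun n => ?_
  rw [eulerOp_intCast_mul, mul_left_comm, eulerOp_jacobiTerm]; push_cast; ring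

theorem moment_jacobiDiff (w : ℤ → ℤ) :
    moment w jacobiDiff = moment (fun n => w n - w (n + 1)) jacobiTerm := by
  rw [show jacobiDiff = fun n => jacobiTerm n - jacobiTerm (n - 1) from rfl,
    moment_sub decay_jacobiTerm decay_jacobiTerm_sub_one, moment_comp_sub,
    moment_weight_sub decay_jacobiTerm]

theorem moment_conv_jacobiDiff_lambertTerm (w : ℤ → ℤ) :
    moment w (conv jacobiDiff lambertTerm) =
      -moment (fun n => w n * n - w (n + 1) * (n - 1)) jacobiTerm := by
  have h1 := decay_jacobiTerm.mul_left fun n : ℤ => (n : ℚ⟦X⟧)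
  have h2 := decay_jacobiTerm_sub_one.mul_left fun n : ℤ => ((n - 2 : ℤ) : ℚ⟦X⟧)
  calc moment w (conv jacobiDiff lambertTerm)
      = -moment w (fun n => (n : ℚ⟦X⟧) * jacobiTerm n
          - ((n - 2 : ℤ) : ℚ⟦X⟧) * jacobiTerm (n - 1)) := by
        rw [moment, moment, ← tsum_neg]
        exact tsum_congr fun n => by rw [conv_jacobiDiff_lambertTerm, mul_neg]
    _ = -(moment (fun n => w n * n) jacobiTerm
          - moment (fun n => w (n + 1) * (n + 1 - 2)) jacobiTerm) := by
        rw [moment_sub h1 h2, moment_mul_family,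
          moment_mul_family (c := fun n => jacobiTerm (n - 1)), moment_comp_sub]
    _ = _ := by
        rw [← moment_weight_sub decay_jacobiTerm]
        exact congrArg Neg.neg (moment_congr fun n => by ring)

theorem mul_moment_jacobiTerm (a b : ℤ) (r s : ℕ) {w : ℤ → ℤ} (k : ℤ)
    (h : ∀ n, k * w n = a * (2 * n - 1) ^ r + b * (2 * n - 1) ^ s) :
    (k : ℚ⟦X⟧) * moment w jacobiTerm = a * jacobiMoment r + b * jacobiMoment s := by
  rw [← moment_weight_const_mul decay_jacobiTerm, moment_congr h,
    moment_weight_add decay_jacobiTerm, moment_weight_const_mul decay_jacobiTerm,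
    moment_weight_const_mul decay_jacobiTerm, jacobiMoment, jacobiMoment]

theorem jacobiMoment_three : jacobiMoment 3 = jacobiMoment 1 * (1 - 24 * lambert 1) := by
  have h := moment_conv decay_jacobiDiff decay_lambertTerm 3 (w := fun n => (n - 1) ^ 3)
    (u := fun n => n - 1) (v := id) fun m j => by simp only [id]; ring
  have hconv := mul_moment_jacobiTerm
    (w := fun n => (n - 1) ^ 3 * n - (n + 1 - 1) ^ 3 * (n - 1)) (-1) 1 3 1 4 fun n => by ring
  have h0 := mul_moment_jacobiTerm (w := fun n => (n - 1) ^ 0 - (n + 1 - 1) ^ 0) 0 0 1 0 1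
    fun n => by ring
  have h2 := mul_moment_jacobiTerm (w := fun n => (n - 1) ^ 2 - (n + 1 - 1) ^ 2) (-1) 0 1 0 1
    fun n => by ring
  simp only [id, Finset.sum_range_succ, Finset.sum_range_zero, Nat.choose, Nat.reduceSub,
    Nat.reduceAdd, moment_lambertTerm odd_one, moment_lambertTerm (show Odd 3 by decide),
    moment_lambertTerm_even even_two, moment_lambertTerm_even Even.zero, moment_jacobiDiff,
    moment_conv_jacobiDiff_lambertTerm] at h
  push_cast at h hconv h0 h2
  linear_combination hconv + 4 * h + 24 * lambert 1 * h2 + 8 * lambert 3 * h0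

theorem jacobiMoment_five : jacobiMoment 5 = jacobiMoment 1 - 160 * lambert 3 * jacobiMoment 1
    - 40 * lambert 1 * (jacobiMoment 3 + jacobiMoment 1) := by
  have h := moment_conv decay_jacobiDiff decay_lambertTerm 5 (w := fun n => (n - 1) ^ 5)
    (u := fun n => n - 1) (v := id) fun m j => by simp only [id]; ring
  have hconv := mul_moment_jacobiTerm
    (w := fun n => (n - 1) ^ 5 * n - (n + 1 - 1) ^ 5 * (n - 1)) (-1) 1 5 1 8 fun n => by ring
  have h0 := mul_moment_jacobiTerm (w := fun n => (n - 1) ^ 0 - (n + 1 - 1) ^ 0) 0 0 1 0 1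
    fun n => by ring
  have h2 := mul_moment_jacobiTerm (w := fun n => (n - 1) ^ 2 - (n + 1 - 1) ^ 2) (-1) 0 1 0 1
    fun n => by ring
  have h4 := mul_moment_jacobiTerm (w := fun n => (n - 1) ^ 4 - (n + 1 - 1) ^ 4) (-1) (-1) 3 1 2
    fun n => by ring
  simp only [id, Finset.sum_range_succ, Finset.sum_range_zero, Nat.choose, Nat.reduceSub,
    Nat.reduceAdd, moment_lambertTerm odd_one, moment_lambertTerm (show Odd 3 by decide),
    moment_lambertTerm (show Odd 5 by decide), moment_lambertTerm_even even_two,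
    moment_lambertTerm_even (show Even 4 by decide), moment_lambertTerm_even Even.zero,
    moment_jacobiDiff, moment_conv_jacobiDiff_lambertTerm] at h
  push_cast at h hconv h0 h2 h4
  linear_combination hconv + 8 * h + 40 * lambert 1 * h4 + 160 * lambert 3 * h2
    + 16 * lambert 5 * h0

theorem jacobiMoment_one_ne_zero : jacobiMoment 1 ≠ 0 := fun h => by
  have hcoeff := congrArg (coeff 0) h
  rw [jacobiMoment, moment, (decay_jacobiTerm.mul_left _).coeff_tsum,
    finsum_eq_sum_of_support_subset (s := {0, 1})] at hcoeff
  · rw [Finset.sum_pair zero_ne_one, jacobiTerm_zero, jacobiTerm_one] at hcoeff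
    norm_num at hcoeff
  · intro n hn
    by_contra h'
    simp only [Finset.coe_insert, Finset.coe_singleton, Set.mem_insert_iff,
      Set.mem_singleton_iff, not_or] at h'
    have hpos := triangle_pos h'.1 h'.2
    have hdvd : X ^ (triangle n).toNat ∣ jacobiTerm n := dvd_mul_left _ _
    exact hn (X_pow_dvd_iff.1 (hdvd.mul_left _) 0 (by omega))

/-- Ramanujan's differential equation for the Eisenstein series of weight two. -/
theorem six_mul_eulerOp_lambert :
    6 * eulerOp ℚ (lambert 1) = lambert 1 - 12 * lambert 1 ^ 2 + 5 * lambert 3 := by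
  have hderiv := congrArg (eulerOp ℚ) jacobiMoment_three
  rw [eulerOp_mul, map_sub, eulerOp_ofNat_mul, Derivation.map_one_eq_zero] at hderiv
  refine mul_left_cancel₀ jacobiMoment_one_ne_zero
    (mul_left_cancel₀ (a := (32 : ℚ⟦X⟧)) (by norm_num) ?_)
  linear_combination 8 * hderiv - eulerOp_jacobiMoment 3
    + (1 - 24 * lambert 1) * eulerOp_jacobiMoment 1 - jacobiMoment_five
    + (2 + 16 * lambert 1) * jacobiMoment_three

/-! ### Partial theta series -/

/-- The partial theta series `∑_{n ≥ 1} (-1) ^ n X ^ (n ^ 2 + n m)`. -/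
noncomputable def partialTheta (m : ℕ) : ℚ⟦X⟧ :=
  ∑' n : ℕ, altSign (n + 1) * xpow ((n + 1) ^ 2 + (n + 1) * m)

theorem decay_partialTheta_term (m : ℕ) :
    Decay fun n : ℕ => (altSign (n + 1) * xpow ((n + 1) ^ 2 + (n + 1) * m) : ℚ⟦X⟧) := by
  refine (decay_xpow (e := fun n : ℕ => ((n : ℤ) + 1) ^ 2 + (n + 1) * m) fun d =>
    (Set.finite_Iio d).subset fun n hn => ?_).mul_left _
  simp only [Set.mem_ofPred_eq, Set.mem_Iio] at hn ⊢
  zify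
  nlinarith [mul_nonneg (show (0 : ℤ) ≤ n + 1 by positivity) (show (0 : ℤ) ≤ m by positivity)]

theorem partialTheta_eq (m : ℕ) :
    partialTheta m = -(X ^ (m + 1) * (1 + partialTheta (m + 2))) := by
  rw [partialTheta, (decay_partialTheta_term m).summable.tsum_eq_zero_add, partialTheta, mul_add,
    mul_one, neg_add, ← (decay_partialTheta_term (m + 2)).tsum_mul_left, ← tsum_neg]
  congr 1
  · rw [Nat.cast_zero, altSign_succ, altSign_zero, ← xpow_natCast]
    push_cast; ring_nf
  · refine tsum_congr fun n => ?_
    rw [Nat.cast_add, Nat.cast_one, altSign_succ, ← xpow_natCast, mul_left_comm,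
      xpow_mul_xpow (by positivity) (by positivity)]
    push_cast; ring_nf

theorem X_pow_dvd_partialTheta (m : ℕ) : X ^ (m + 1) ∣ partialTheta m := by
  rw [partialTheta_eq]; exact (dvd_mul_right _ _).neg_right

theorem thetaSeries_eq_one_add_two_mul : thetaSeries = 1 + 2 * partialTheta 0 := by
  have hd := decay_thetaTerm.sub (Decay.ite_eq (0 : ℤ) 1)
  have h := hd.tsum_int_of_even (fun k => by simp [thetaTerm_neg]) (by simp [thetaTerm_zero])
  rw [decay_thetaTerm.tsum_sub (.ite_eq 0 1), tsum_ite_eq] at h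
  rw [thetaSeries, sub_eq_iff_eq_add'.1 h, partialTheta]
  congr 2
  refine tsum_congr fun n => ?_
  rw [if_neg (by omega), sub_zero, thetaTerm]
  simp

/-- The weight `x ^ 2 - 4 L`, where `L` is the logarithmic derivative of the theta series. Its
sum against `(-1) ^ n X ^ (n ^ 2)` over `x = k - 2 n` is `k ^ 2` times the theta series. -/
noncomputable def thetaWeight (x : ℤ) : ℚ⟦X⟧ := ((x ^ 2 : ℤ) : ℚ⟦X⟧) - 4 * thetaLogDeriv

theorem thetaWeight_neg (x : ℤ) : thetaWeight (-x) = thetaWeight x := by simp [thetaWeight]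

theorem tsum_thetaTerm_mul_thetaWeight (k : ℤ) :
    ∑' i, thetaTerm i * thetaWeight (k - 2 * i) = (k : ℚ⟦X⟧) ^ 2 * thetaSeries := by
  have hd (r : ℕ) := decay_thetaTerm.mul_left fun i : ℤ => ((i ^ r : ℤ) : ℚ⟦X⟧)
  have hexpand (i : ℤ) : thetaTerm i * thetaWeight (k - 2 * i) =
      ((k : ℚ⟦X⟧) ^ 2 - 4 * thetaLogDeriv) * (((i ^ 0 : ℤ) : ℚ⟦X⟧) * thetaTerm i)
      - 4 * k * (((i ^ 1 : ℤ) : ℚ⟦X⟧) * thetaTerm i)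
      + 4 * (((i ^ 2 : ℤ) : ℚ⟦X⟧) * thetaTerm i) := by
    rw [thetaWeight]; push_cast; ring
  rw [tsum_congr hexpand, Decay.tsum_add (((hd 0).mul_left _).sub ((hd 1).mul_left _))
    ((hd 2).mul_left _), Decay.tsum_sub ((hd 0).mul_left _) ((hd 1).mul_left _),
    (hd 0).tsum_mul_left, (hd 1).tsum_mul_left, (hd 2).tsum_mul_left]
  change _ * moment (fun i => i ^ 0) thetaTerm - _ * moment (fun i => i ^ 1) thetaTerm +
    4 * moment (fun i => i ^ 2) thetaTerm = _
  rw [moment_thetaTerm_zero, moment_thetaTerm_odd odd_one, moment_thetaTerm_two,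
    eulerOp_thetaSeries]
  ring

/-- The weighted partial theta series
`∑_{n ≥ 1} (-1) ^ n X ^ (n ^ 2 + n m) thetaWeight (m + 2 n)`. -/
noncomputable def weightedPartialTheta (m : ℕ) : ℚ⟦X⟧ :=
  thetaWeight m * partialTheta m + 4 * eulerOp ℚ (partialTheta m)

theorem weightedPartialTheta_eq (m : ℕ) : weightedPartialTheta m =
    -(X ^ (m + 1) * (thetaWeight (m + 2) + weightedPartialTheta (m + 2))) := by
  have h := partialTheta_eq m
  have e := congrArg (eulerOp ℚ) h
  rw [map_neg, eulerOp_mul, eulerOp_X_pow, map_add, Derivation.map_one_eq_zero, zero_add] at e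
  simp only [weightedPartialTheta, thetaWeight]
  push_cast at e ⊢
  linear_combination 4 * e + ((m : ℚ⟦X⟧) ^ 2 - 4 * thetaLogDeriv) * h

theorem weightedPartialTheta_zero : weightedPartialTheta 0 = 2 * thetaLogDeriv := by
  have h := thetaSeries_eq_one_add_two_mul
  have e := congrArg (eulerOp ℚ) h
  rw [map_add, Derivation.map_one_eq_zero, eulerOp_ofNat_mul, eulerOp_thetaSeries] at e
  rw [weightedPartialTheta, thetaWeight]
  push_cast
  linear_combination -2 * e + 2 * thetaLogDeriv * h

theorem X_pow_dvd_weightedPartialTheta (m : ℕ) : X ^ (m + 1) ∣ weightedPartialTheta m := by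
  rw [weightedPartialTheta_eq]; exact (dvd_mul_right _ _).neg_right

/-- The odd extension of `weightedPartialTheta` to `ℤ`. -/
noncomputable def oddPartialTheta (m : ℤ) : ℚ⟦X⟧ :=
  (m.sign : ℚ⟦X⟧) * weightedPartialTheta m.natAbs

theorem oddPartialTheta_neg (m : ℤ) : oddPartialTheta (-m) = -oddPartialTheta m := by
  simp [oddPartialTheta]

theorem decay_oddPartialTheta : Decay oddPartialTheta := .of_natAbs fun k =>
  ((pow_dvd_pow X (Nat.le_succ _)).trans (X_pow_dvd_weightedPartialTheta k.natAbs)).mul_left _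

/-- The odd extension of `weightedPartialTheta`, with the term `n = 0` added to the sum at positive
integers. It relates to `oddPartialTheta` as `geomTerm` does to `lambertTerm`, and satisfies the
two-term relation `xpow_mul_stepPartialTheta`. -/
noncomputable def stepPartialTheta (m : ℤ) : ℚ⟦X⟧ :=
  if 0 < m then thetaWeight m + weightedPartialTheta m.natAbs else -weightedPartialTheta m.natAbs

theorem two_mul_oddPartialTheta (m : ℤ) : 2 * oddPartialTheta m =
    2 * stepPartialTheta m - (1 + (m.sign : ℚ⟦X⟧)) * thetaWeight m := by
  rw [oddPartialTheta, stepPartialTheta]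
  rcases lt_trichotomy m 0 with h | rfl | h
  · rw [if_neg (by omega), Int.sign_eq_neg_one_of_neg h]; push_cast; ring
  · simp [weightedPartialTheta_zero, thetaWeight]; ring
  · rw [if_pos h, Int.sign_eq_one_of_pos h]; push_cast; ring

theorem stepPartialTheta_add_neg (m : ℤ) :
    stepPartialTheta m + stepPartialTheta (-m) = thetaWeight m := by
  have h := two_mul_oddPartialTheta m
  have h' := two_mul_oddPartialTheta (-m)
  rw [oddPartialTheta_neg, Int.sign_neg, thetaWeight_neg] at h'
  push_cast at h'
  refine mul_left_cancel₀ (two_ne_zero (α := ℚ⟦X⟧)) ?_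
  linear_combination -h - h'

theorem xpow_mul_stepPartialTheta {m a b : ℤ} (ha : 0 ≤ a) (hb : 0 ≤ b) (h : a = b + m + 1) :
    xpow a * stepPartialTheta (m + 2) = xpow b * stepPartialTheta (-m) := by
  have hnat (j : ℕ) : X ^ (j + 1) * stepPartialTheta (j + 2) = stepPartialTheta (-j) := by
    rw [stepPartialTheta, stepPartialTheta, if_pos (by omega), if_neg (by omega), Int.natAbs_neg,
      Int.natAbs_natCast, weightedPartialTheta_eq j, neg_neg]
    rfl
  obtain ⟨j, rfl⟩ | rfl | ⟨j, rfl⟩ : (∃ j : ℕ, m = j) ∨ m = -1 ∨ ∃ j : ℕ, m = -(j + 2 : ℤ) := by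
    rcases lt_trichotomy m (-1) with hm | hm | hm
    · exact .inr (.inr ⟨(m + 2).natAbs, by omega⟩)
    · exact .inr (.inl hm)
    · exact .inl ⟨m.natAbs, by omega⟩
  · rw [← hnat, ← mul_assoc, ← xpow_natCast,
      xpow_mul_xpow_of_add_eq hb (by positivity) (c := a) (by push_cast; omega)]
  · rw [show a = b by omega]; norm_num
  · rw [show -((j : ℤ) + 2) + 2 = -j by ring, neg_neg, ← hnat, ← mul_assoc, ← xpow_natCast,
      xpow_mul_xpow_of_add_eq ha (by positivity) (c := b) (by push_cast; omega)]

theorem X_pow_mul_tsum_stepPartialTheta (k : ℕ) :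
    X ^ k * ∑' i, thetaTerm i * stepPartialTheta (k - 2 * i) =
      -∑' i, thetaTerm i * stepPartialTheta (-k - 2 * i) := by
  rw [← (decay_thetaTerm.mul_right _).tsum_mul_left, ← tsum_neg, ← (Equiv.subLeft (-1)).tsum_eq]
  refine tsum_congr fun i => ?_
  have h := xpow_mul_stepPartialTheta (m := k + 2 * i) (a := (i + 1) ^ 2 + k) (b := i ^ 2)
    (by positivity) (by positivity) (by ring)
  rw [← xpow_mul_xpow (by positivity) (by positivity), xpow_natCast] at h
  rw [Equiv.subLeft_apply, show (-1 - i : ℤ) = -(i + 1) by ring, thetaTerm_neg,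
    show (k : ℤ) - 2 * -(i + 1) = k + 2 * i + 2 by ring, thetaTerm, thetaTerm, altSign_succ,
    show -(k : ℤ) - 2 * i = -(k + 2 * i) by ring]
  linear_combination -altSign i * h

theorem tsum_stepPartialTheta_add_neg (k : ℤ) :
    ∑' i, thetaTerm i * stepPartialTheta (k - 2 * i) +
      ∑' i, thetaTerm i * stepPartialTheta (-k - 2 * i) = (k : ℚ⟦X⟧) ^ 2 * thetaSeries := by
  rw [← tsum_thetaTerm_mul_thetaWeight, ← (Equiv.neg ℤ).tsum_eq fun i =>
    thetaTerm i * stepPartialTheta (-k - 2 * i)]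
  simp only [Equiv.neg_apply]
  rw [← (decay_thetaTerm.mul_right _).tsum_add
    ((decay_thetaTerm.comp neg_injective).mul_right fun i => stepPartialTheta (-k - 2 * -i))]
  refine tsum_congr fun i => ?_
  rw [thetaTerm_neg, show -k - 2 * -i = -(k - 2 * i) by ring, ← mul_add,
    stepPartialTheta_add_neg]

theorem tsum_thetaTerm_mul_stepPartialTheta (k : ℤ) :
    ∑' i, thetaTerm i * stepPartialTheta (k - 2 * i) =
      (k : ℚ⟦X⟧) ^ 2 * thetaSeries * geomTerm k := by
  have hnat (k : ℕ) (hk : k ≠ 0) : ∑' i, thetaTerm i * stepPartialTheta (k - 2 * i) =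
      (k : ℚ⟦X⟧) ^ 2 * thetaSeries * geomTerm k := by
    have hgeom := xpow_sub_xpow_mul_geomTerm (a := 0) (b := k) (k := k) (by omega) le_rfl
      (by omega) (by omega)
    rw [xpow_zero, xpow_natCast] at hgeom
    have hadd := tsum_stepPartialTheta_add_neg k
    push_cast at hadd
    refine mul_left_cancel₀ (one_sub_X_pow_ne_zero hk) ?_
    linear_combination hadd - X_pow_mul_tsum_stepPartialTheta k
      - (k : ℚ⟦X⟧) ^ 2 * thetaSeries * hgeom
  rcases eq_or_ne k 0 with rfl | hk
  · have h0 := X_pow_mul_tsum_stepPartialTheta 0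
    rw [pow_zero, one_mul, Nat.cast_zero, neg_zero] at h0
    rw [self_eq_neg.1 h0]; simp
  rcases k.eq_nat_or_neg with ⟨j, rfl | rfl⟩
  · exact hnat j (by omega)
  · have hadd := tsum_stepPartialTheta_add_neg j
    have hgeom := geomTerm_add_geomTerm_neg j
    rw [if_neg (by omega)] at hgeom
    have hj := hnat j (by omega)
    push_cast at hadd ⊢
    linear_combination hadd - hj - (j : ℚ⟦X⟧) ^ 2 * thetaSeries * hgeom

theorem two_mul_tsum_thetaTerm_mul_oddPartialTheta (k : ℤ) :
    2 * ∑' i, thetaTerm i * oddPartialTheta (k - 2 * i) =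
      2 * (k : ℚ⟦X⟧) ^ 2 * thetaSeries * lambertTerm k + ∑' i, thetaTerm i *
        (((k.sign - (k - 2 * i).sign : ℤ) : ℚ⟦X⟧) * thetaWeight (k - 2 * i)) := by
  have hd (f : ℤ → ℚ⟦X⟧) := decay_thetaTerm.mul_right f
  have hterm (i : ℤ) : 2 * (thetaTerm i * oddPartialTheta (k - 2 * i)) =
      2 * (thetaTerm i * stepPartialTheta (k - 2 * i))
        - (1 + (k.sign : ℚ⟦X⟧)) * (thetaTerm i * thetaWeight (k - 2 * i))
        + thetaTerm i *
          (((k.sign - (k - 2 * i).sign : ℤ) : ℚ⟦X⟧) * thetaWeight (k - 2 * i)) := by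
    push_cast
    linear_combination thetaTerm i * two_mul_oddPartialTheta (k - 2 * i)
  have hgeom : 2 * (k : ℚ⟦X⟧) ^ 2 * geomTerm k - (1 + (k.sign : ℚ⟦X⟧)) * k ^ 2 =
      2 * (k : ℚ⟦X⟧) ^ 2 * lambertTerm k := by
    rw [geomTerm]
    rcases lt_trichotomy k 0 with h | rfl | h
    · rw [if_neg (by omega), Int.sign_eq_neg_one_of_neg h]; push_cast; ring
    · simp
    · rw [if_pos h, Int.sign_eq_one_of_pos h]; push_cast; ring
  rw [← (hd _).tsum_mul_left, tsum_congr hterm, Decay.tsum_add (((hd _).mul_left _).sub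
    ((hd _).mul_left _)) (hd _), Decay.tsum_sub ((hd _).mul_left _) ((hd _).mul_left _),
    (hd _).tsum_mul_left, (hd _).tsum_mul_left, tsum_thetaTerm_mul_stepPartialTheta,
    tsum_thetaTerm_mul_thetaWeight]
  linear_combination thetaSeries * hgeom

/-! ### The rank-crank type identity for partial theta series -/

theorem decay_sign_sub_sign (N : ℤ) (g : ℤ → ℚ⟦X⟧) :
    Decay fun k : ℤ => ((k.sign - (k - N).sign : ℤ) : ℚ⟦X⟧) * g k := fun d => by
  refine (Set.finite_Icc (-|N|) |N|).subset fun k hk => abs_le.1 (le_of_not_gt fun h => hk ?_)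
  have hsign : k.sign = (k - N).sign := by
    obtain ⟨h1, h2⟩ := abs_lt.1 h
    rcases lt_or_ge k 0 with hk | hk
    · rw [abs_of_neg hk] at h1 h2
      rw [Int.sign_eq_neg_one_of_neg hk, Int.sign_eq_neg_one_of_neg (by omega)]
    · rw [abs_of_nonneg hk] at h1 h2
      rw [Int.sign_eq_one_of_pos (by omega), Int.sign_eq_one_of_pos (by omega)]
  simp [hsign]

/-- Summation by telescoping: the sum on the left is `g 0 + 2 g 1 + ⋯ + 2 g (N - 1) + g N` for
`N > 0`. -/
theorem tsum_sign_sub_sign_mul {g F : ℤ → ℚ⟦X⟧} (h0 : F 0 = 0)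
    (hF : ∀ N, F (N + 1) = F N + (g N + g (N + 1))) (N : ℤ) :
    ∑' k : ℤ, ((k.sign - (k - N).sign : ℤ) : ℚ⟦X⟧) * g k = F N := by
  have hstep (N : ℤ) : ∑' k : ℤ, ((k.sign - (k - (N + 1)).sign : ℤ) : ℚ⟦X⟧) * g k =
      ∑' k : ℤ, ((k.sign - (k - N).sign : ℤ) : ℚ⟦X⟧) * g k + (g N + g (N + 1)) := by
    rw [← tsum_ite_eq N fun _ => g N, ← tsum_ite_eq (N + 1) fun _ => g (N + 1),
      ← (Decay.ite_eq N _).tsum_add (.ite_eq _ _),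
      ← (decay_sign_sub_sign N g).tsum_add (.add (.ite_eq N _) (.ite_eq _ _))]
    refine tsum_congr fun k => ?_
    obtain h | rfl | rfl | h : k < N ∨ k = N ∨ k = N + 1 ∨ N + 1 < k := by omega
    · rw [if_neg (by omega), if_neg (by omega), Int.sign_eq_neg_one_of_neg (a := k - N) (by omega),
        Int.sign_eq_neg_one_of_neg (a := k - (N + 1)) (by omega)]; simp
    · simp; ring
    · simp; ring
    · rw [if_neg (by omega), if_neg (by omega), Int.sign_eq_one_of_pos (a := k - N) (by omega),
        Int.sign_eq_one_of_pos (a := k - (N + 1)) (by omega)]; simp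
  induction N with
  | zero => simp [h0]
  | succ N ih => rw [hstep, ih, hF]
  | pred N ih =>
    have hs := hstep (-N - 1)
    have hr := hF (-N - 1)
    rw [sub_add_cancel] at hs hr
    linear_combination ih - hs + hr

theorem six_mul_tsum_sign_mul_thetaWeight (s : ℕ) (N : ℤ) :
    6 * ∑' k : ℤ, ((k.sign - (k - N).sign : ℤ) : ℚ⟦X⟧) * (k * thetaWeight (s * (k - N))) =
      (s : ℚ⟦X⟧) ^ 2 * ((N : ℚ⟦X⟧) ^ 4 - (N : ℚ⟦X⟧) ^ 2)
        - 24 * thetaLogDeriv * (N : ℚ⟦X⟧) ^ 2 := by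
  have h := tsum_sign_sub_sign_mul (g := fun k => 6 * (k * thetaWeight (s * (k - N))))
    (F := fun M => (s : ℚ⟦X⟧) ^ 2 * (3 * (M : ℚ⟦X⟧) ^ 2 * (M ^ 2 + 1)
      - 4 * N * M * (2 * M ^ 2 + 1) + 6 * N ^ 2 * M ^ 2) - 24 * thetaLogDeriv * (M : ℚ⟦X⟧) ^ 2)
    (by simp) (fun M => by simp only [thetaWeight]; push_cast; ring) N
  simp only [mul_left_comm _ (6 : ℚ⟦X⟧)] at h
  rw [(decay_sign_sub_sign N _).tsum_mul_left] at h
  rw [h]; ring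

theorem decay_thetaTerm_mul_sign (t : ℕ) (f : ℤ → ℤ → ℚ⟦X⟧) : Decay fun x : ℤ × ℤ =>
    thetaTerm x.2 * (((x.1.sign - (x.1 - t * x.2).sign : ℤ) : ℚ⟦X⟧) * f x.2 x.1) :=
  decay_thetaTerm.mul_slices (h := fun x : ℤ × ℤ =>
    ((x.1.sign - (x.1 - t * x.2).sign : ℤ) : ℚ⟦X⟧) * f x.2 x.1) fun i =>
    decay_sign_sub_sign (t * i) (f i)

theorem decay_thetaTerm_mul_comp_sub (t : ℕ) {c : ℤ → ℚ⟦X⟧} (hc : Decay c) :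
    Decay fun x : ℤ × ℤ => thetaTerm x.2 * c (x.1 - t * x.2) :=
  ((hc.prod decay_thetaTerm).comp (shear t).injective).mono fun x => by rw [mul_comm]; rfl

theorem tsum_mul_tsum_thetaTerm_mul (t : ℕ) {c : ℤ → ℚ⟦X⟧} (hc : Decay c) :
    ∑' k : ℤ, (k : ℚ⟦X⟧) * ∑' i, thetaTerm i * c (k - t * i) =
      thetaSeries * moment (fun k => k) c := by
  have hd := decay_thetaTerm_mul_comp_sub t hc
  have hu (u v : ℤ → ℤ) : Decay fun x : ℤ × ℤ =>
      ((u x.1 * v x.2 : ℤ) : ℚ⟦X⟧) * (c x.1 * thetaTerm x.2) :=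
    (hc.prod decay_thetaTerm).mul_left _
  calc ∑' k : ℤ, (k : ℚ⟦X⟧) * ∑' i, thetaTerm i * c (k - t * i)
      = ∑' x : ℤ × ℤ, (x.1 : ℚ⟦X⟧) * (thetaTerm x.2 * c (x.1 - t * x.2)) := by
        rw [(hd.mul_left _).tsum_prod]
        exact tsum_congr fun k => ((hd.slice k).tsum_mul_left _).symm
    _ = ∑' x : ℤ × ℤ, (((x.1 * x.2 ^ 0 : ℤ) : ℚ⟦X⟧) * (c x.1 * thetaTerm x.2)
          + t * (((1 * x.2 ^ 1 : ℤ) : ℚ⟦X⟧) * (c x.1 * thetaTerm x.2))) := by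
        rw [← (shear t).symm.tsum_eq]
        refine tsum_congr fun x => ?_
        simp only [shear, Equiv.coe_fn_symm_mk, add_sub_cancel_right]
        push_cast; ring
    _ = moment (fun k => k) c * moment (fun k => k ^ 0) thetaTerm
          + t * (moment (fun _ => 1) c * moment (fun k => k ^ 1) thetaTerm) := by
        rw [moment_mul_moment hc decay_thetaTerm, moment_mul_moment hc decay_thetaTerm,
          ← (hu (fun _ => 1) fun k => k ^ 1).tsum_mul_left,
          ← (hu (fun k => k) fun k => k ^ 0).tsum_add ((hu (fun _ => 1) fun k => k ^ 1).mul_left _)]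
    _ = thetaSeries * moment (fun k => k) c := by
        rw [moment_thetaTerm_zero, moment_thetaTerm_odd odd_one]; ring

theorem six_mul_tsum_tsum_sign_mul_thetaWeight {s t : ℕ} (hst : s * t = 2) :
    6 * ∑' k : ℤ, ∑' i : ℤ, thetaTerm i *
        (((k.sign - (k - t * i).sign : ℤ) : ℚ⟦X⟧) * (k * thetaWeight (s * (k - t * i)))) =
      4 * (t : ℚ⟦X⟧) ^ 2 * eulerOp ℚ (eulerOp ℚ thetaSeries)
        - (4 + 24 * (t : ℚ⟦X⟧) ^ 2 * thetaLogDeriv) * eulerOp ℚ thetaSeries := by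
  have hst' : (s : ℚ⟦X⟧) * t = 2 := by exact_mod_cast hst
  have hd := decay_thetaTerm_mul_sign t fun i k => k * thetaWeight (s * (k - t * i))
  have hm (r : ℕ) := decay_thetaTerm.mul_left fun i : ℤ => ((i ^ r : ℤ) : ℚ⟦X⟧)
  have hinner (i : ℤ) : 6 * ∑' k : ℤ, thetaTerm i *
      (((k.sign - (k - t * i).sign : ℤ) : ℚ⟦X⟧) * (k * thetaWeight (s * (k - t * i)))) =
      4 * (t : ℚ⟦X⟧) ^ 2 * (((i ^ 4 : ℤ) : ℚ⟦X⟧) * thetaTerm i)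
        - (4 + 24 * (t : ℚ⟦X⟧) ^ 2 * thetaLogDeriv) * (((i ^ 2 : ℤ) : ℚ⟦X⟧) * thetaTerm i) := by
    have h := six_mul_tsum_sign_mul_thetaWeight s (t * i)
    rw [(decay_sign_sub_sign (t * i) _).tsum_mul_left]
    push_cast at h ⊢
    linear_combination thetaTerm i * h
      + thetaTerm i * ((i : ℚ⟦X⟧) ^ 4 * t ^ 2 - i ^ 2) * (s * t + 2) * hst'
  have hswap := (hd.comp (Equiv.prodComm ℤ ℤ).injective).tsum_fst
  simp only [Equiv.prodComm_apply, Prod.fst_swap, Prod.snd_swap] at hswap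
  rw [hd.tsum_comm (f := fun k i => thetaTerm i *
      (((k.sign - (k - t * i).sign : ℤ) : ℚ⟦X⟧) * ((k : ℚ⟦X⟧) * thetaWeight (s * (k - t * i))))),
    ← hswap.tsum_mul_left, ← moment_thetaTerm_two, eulerOp_moment_thetaTerm]
  refine (tsum_congr hinner).trans ?_
  rw [Decay.tsum_sub ((hm 4).mul_left _) ((hm 2).mul_left _), (hm 4).tsum_mul_left,
    (hm 2).tsum_mul_left]
  rfl

theorem mul_two_mul_tsum_thetaTerm_mul_oddPartialTheta {s t : ℕ} (hst : s * t = 2) (k : ℤ) :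
    (k : ℚ⟦X⟧) * (2 * ∑' i, thetaTerm i * oddPartialTheta (s * (k - t * i))) =
      2 * (s : ℚ⟦X⟧) ^ 2 * thetaSeries * (((k ^ 3 : ℤ) : ℚ⟦X⟧) * lambertTerm (s * k)) +
      ∑' i : ℤ, thetaTerm i *
        (((k.sign - (k - t * i).sign : ℤ) : ℚ⟦X⟧) * (k * thetaWeight (s * (k - t * i)))) := by
  have hs : 0 < s := Nat.pos_of_ne_zero (by rintro rfl; omega)
  have hst' : (s : ℤ) * t = 2 := by exact_mod_cast hst
  have hscale (i : ℤ) : (s : ℤ) * k - 2 * i = s * (k - t * i) := by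
    linear_combination i * hst'
  have hsign (x : ℤ) : Int.sign (s * x) = Int.sign x := by
    rw [Int.sign_mul, Int.sign_eq_one_of_pos (by omega), one_mul]
  have h := two_mul_tsum_thetaTerm_mul_oddPartialTheta (s * k)
  simp only [hscale, hsign] at h
  rw [h, mul_add, ← (decay_thetaTerm.mul_right _).tsum_mul_left]
  congr 1
  · push_cast; ring
  · exact tsum_congr fun i => by ring

theorem twelve_mul_moment_oddPartialTheta {s t : ℕ} (hst : s * t = 2) :
    12 * moment (fun k => k) (fun k => oddPartialTheta (s * k)) =
      12 * (s : ℚ⟦X⟧) ^ 2 * moment (fun k => k ^ 3) (fun k => lambertTerm (s * k))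
      + 4 * (t : ℚ⟦X⟧) ^ 2 * (eulerOp ℚ thetaLogDeriv + thetaLogDeriv ^ 2)
      - 4 * thetaLogDeriv - 24 * (t : ℚ⟦X⟧) ^ 2 * thetaLogDeriv ^ 2 := by
  have hs : Function.Injective fun k : ℤ => (s : ℤ) * k :=
    mul_right_injective₀ (by rintro h; simp [Nat.cast_eq_zero.1 h] at hst)
  have hl := (decay_lambertTerm.comp hs).mul_left fun k => ((k ^ 3 : ℤ) : ℚ⟦X⟧)
  have hd := decay_thetaTerm_mul_sign t fun i k => k * thetaWeight (s * (k - t * i))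
  have hleft : ∑' k : ℤ, (k : ℚ⟦X⟧) *
      (2 * ∑' i, thetaTerm i * oddPartialTheta (s * (k - t * i))) =
      2 * (thetaSeries * moment (fun k => k) fun k => oddPartialTheta (s * k)) := by
    have hc := decay_oddPartialTheta.comp hs
    rw [← tsum_mul_tsum_thetaTerm_mul t hc]
    simp only [mul_left_comm _ (2 : ℚ⟦X⟧)]
    exact ((decay_thetaTerm_mul_comp_sub t hc).tsum_fst.mul_left _).tsum_mul_left 2
  rw [tsum_congr (mul_two_mul_tsum_thetaTerm_mul_oddPartialTheta hst),
    (hl.mul_left _).tsum_add hd.tsum_fst, hl.tsum_mul_left, ← moment] at hleft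
  have hright := six_mul_tsum_tsum_sign_mul_thetaWeight hst
  rw [eulerOp_thetaSeries, eulerOp_mul, eulerOp_thetaSeries] at hright
  refine mul_left_cancel₀ thetaSeries_ne_zero ?_
  linear_combination -6 * hleft + hright

/-- The weighted sums `∑_{k ≥ 1} k ^ r ∑_{n ≥ 1} (-1) ^ n X ^ (n ^ 2 + s n k)`, in terms of which
the moments of the rank (`s = 1`) and of the `M2`-rank (`s = 2`) are expressed. -/
noncomputable def partialThetaMoment (s r : ℕ) : ℚ⟦X⟧ :=
  ∑' k : ℕ, ((k + 1 : ℕ) : ℚ⟦X⟧) ^ r * partialTheta (s * (k + 1))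

theorem decay_partialTheta {s : ℕ} (hs : s ≠ 0) :
    Decay fun k : ℕ => partialTheta (s * (k + 1)) :=
  .of_dvd (fun k => k) Set.finite_Iio fun k =>
    (pow_dvd_pow X (by nlinarith [Nat.pos_of_ne_zero hs])).trans (X_pow_dvd_partialTheta _)

theorem moment_oddPartialTheta {s : ℕ} (hs : s ≠ 0) :
    moment (fun k => k) (fun k => oddPartialTheta (s * k)) =
      2 * ((s : ℚ⟦X⟧) ^ 2 * partialThetaMoment s 3 + 4 * eulerOp ℚ (partialThetaMoment s 1)
        - 4 * thetaLogDeriv * partialThetaMoment s 1) := by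
  have hd (r : ℕ) := (decay_partialTheta hs).mul_left fun k => ((k + 1 : ℕ) : ℚ⟦X⟧) ^ r
  rw [moment, Decay.tsum_int_of_even
    ((decay_oddPartialTheta.comp (mul_right_injective₀ (Nat.cast_ne_zero.2 hs))).mul_left _)
    (fun k => by rw [mul_neg, oddPartialTheta_neg]; push_cast; ring) (by simp),
    partialThetaMoment, partialThetaMoment, (hd 1).eulerOp_tsum, ← (hd 3).tsum_mul_left,
    ← (hd 1).eulerOp.tsum_mul_left, ← (hd 1).tsum_mul_left,
    ← Decay.tsum_add ((hd 3).mul_left _) ((hd 1).eulerOp.mul_left _),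
    ← Decay.tsum_sub (((hd 3).mul_left _).add ((hd 1).eulerOp.mul_left _)) ((hd 1).mul_left _)]
  congr 1
  refine tsum_congr fun k => ?_
  have hk : (s : ℤ) * (k + 1) = ((s * (k + 1) : ℕ) : ℤ) := by push_cast; ring
  have he := eulerOp_intCast_mul (R := ℚ) ((k + 1 : ℕ) : ℤ) (partialTheta (s * (k + 1)))
  rw [Int.cast_natCast] at he
  rw [hk, oddPartialTheta, Int.sign_eq_one_of_pos (by positivity), Int.natAbs_natCast, pow_one, he,
    weightedPartialTheta, thetaWeight]
  push_cast; ring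

theorem partialThetaMoment_one_identity :
    6 * (partialThetaMoment 1 3 + 4 * eulerOp ℚ (partialThetaMoment 1 1)
        - 4 * thetaLogDeriv * partialThetaMoment 1 1) =
      6 * lambert 3 + 4 * (eulerOp ℚ thetaLogDeriv + thetaLogDeriv ^ 2) - thetaLogDeriv
        - 24 * thetaLogDeriv ^ 2 := by
  have h := twelve_mul_moment_oddPartialTheta (one_mul 2)
  rw [moment_oddPartialTheta one_ne_zero] at h
  simp only [Nat.cast_one, one_mul, moment_lambertTerm (show Odd 3 by decide)] at h
  refine mul_left_cancel₀ (a := (4 : ℚ⟦X⟧)) (by norm_num) ?_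
  push_cast at h
  linear_combination h

theorem partialThetaMoment_two_identity :
    6 * (4 * partialThetaMoment 2 3 + 4 * eulerOp ℚ (partialThetaMoment 2 1)
        - 4 * thetaLogDeriv * partialThetaMoment 2 1) =
      24 * lambertSq 3 + (eulerOp ℚ thetaLogDeriv + thetaLogDeriv ^ 2) - thetaLogDeriv
        - 6 * thetaLogDeriv ^ 2 := by
  have h := twelve_mul_moment_oddPartialTheta (mul_one 2)
  rw [moment_oddPartialTheta two_ne_zero] at h
  push_cast at h
  simp only [lambertTerm_two_mul, moment_expand two_ne_zero decay_lambertTerm,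
    moment_lambertTerm (show Odd 3 by decide), map_mul, map_ofNat] at h
  rw [lambertSq]
  refine mul_left_cancel₀ (a := (4 : ℚ⟦X⟧)) (by norm_num) ?_
  linear_combination h

/-! ### Recurrences for rank generating functions -/

section XAdicTendsto

variable {R : Type*} [CommRing R] {f g : ℕ → R⟦X⟧} {a b : R⟦X⟧}

/-- Convergence of a sequence of power series in the `X`-adic topology. Unlike convergence in
`PowerSeries.WithPiTopology`, it does not refer to a topology on the coefficients. -/
def XAdicTendsto (f : ℕ → R⟦X⟧) (a : R⟦X⟧) : Prop :=
  ∀ d : ℕ, ∀ᶠ m in Filter.atTop, X ^ d ∣ a - f m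

theorem XAdicTendsto.of_X_pow_dvd (h : ∀ m, X ^ m ∣ f m) : XAdicTendsto f 0 := fun d => by
  filter_upwards [Filter.eventually_ge_atTop d] with m hm
  rw [zero_sub]
  exact ((pow_dvd_pow X hm).trans (h m)).neg_right

theorem XAdicTendsto.add (hf : XAdicTendsto f a) (hg : XAdicTendsto g b) :
    XAdicTendsto (fun m => f m + g m) (a + b) := fun d => by
  filter_upwards [hf d, hg d] with m h1 h2
  rw [add_sub_add_comm]
  exact dvd_add h1 h2

theorem XAdicTendsto.comp_add (hf : XAdicTendsto f a) (k : ℕ) :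
    XAdicTendsto (fun m => f (m + k)) a := fun d =>
  (Filter.tendsto_add_atTop_nat k).eventually (hf d)

theorem XAdicTendsto.eq_of_const (h : XAdicTendsto (fun _ => b) a) : b = a :=
  (eq_of_forall_X_pow_dvd_sub fun d => (h d).exists.choose_spec).symm

end XAdicTendsto

section CoeffZ

variable {A : Type*} [CommRing A]

/-- The coefficient of a power series at an integer, zero at negative integers. -/
noncomputable def coeffZ (f : A⟦X⟧) (k : ℤ) : A := if 0 ≤ k then coeff k.toNat f else 0

theorem coeffZ_of_neg (f : A⟦X⟧) {k : ℤ} (h : k < 0) : coeffZ f k = 0 := if_neg (not_le.2 h)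

theorem coeffZ_natCast (f : A⟦X⟧) (k : ℕ) : coeffZ f k = coeff k f := by simp [coeffZ]

theorem coeffZ_add (f g : A⟦X⟧) (k : ℤ) : coeffZ (f + g) k = coeffZ f k + coeffZ g k := by
  rw [coeffZ, coeffZ, coeffZ]; split_ifs <;> simp

theorem coeffZ_sub (f g : A⟦X⟧) (k : ℤ) : coeffZ (f - g) k = coeffZ f k - coeffZ g k := by
  rw [coeffZ, coeffZ, coeffZ]; split_ifs <;> simp

theorem coeffZ_C_mul (a : A) (f : A⟦X⟧) (k : ℤ) : coeffZ (C a * f) k = a * coeffZ f k := by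
  rw [coeffZ, coeffZ]; split_ifs <;> simp

theorem coeffZ_X_mul (f : A⟦X⟧) (k : ℤ) : coeffZ (X * f) k = coeffZ f (k - 1) := by
  rcases lt_trichotomy k 0 with h | rfl | h
  · rw [coeffZ_of_neg _ h, coeffZ_of_neg _ (by omega)]
  · rw [coeffZ_of_neg _ (k := 0 - 1) (by omega), coeffZ]; simp
  · obtain ⟨j, rfl⟩ : ∃ j : ℕ, k = (j + 1 : ℕ) := ⟨(k - 1).toNat, by omega⟩
    rw [coeffZ_natCast, coeff_succ_X_mul, Nat.cast_succ, add_sub_cancel_right, coeffZ_natCast]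

theorem coeffZ_rescale (a : A) (f : A⟦X⟧) (k : ℤ) :
    coeffZ (rescale a f) k = a ^ k.toNat * coeffZ f k := by
  rw [coeffZ, coeffZ]; split_ifs <;> simp

theorem coeffZ_C (a : A) (k : ℤ) : coeffZ (C a) k = if k = 0 then a else 0 := by
  rcases lt_or_ge k 0 with h | h
  · rw [coeffZ_of_neg _ h, if_neg h.ne]
  · obtain ⟨j, rfl⟩ : ∃ j : ℕ, k = j := ⟨k.toNat, by omega⟩
    rw [coeffZ_natCast, coeff_C]; simp

theorem pow_mul_pow_toNat_mul_coeffZ (Q : A) (f : A⟦X⟧) {j : ℤ} {c d : ℕ} (h : (c : ℤ) + j = d) :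
    Q ^ c * (Q ^ j.toNat * coeffZ f j) = Q ^ d * coeffZ f j := by
  rcases lt_or_ge j 0 with h0 | h0
  · rw [coeffZ_of_neg _ h0, mul_zero, mul_zero, mul_zero]
  · rw [← mul_assoc, ← pow_add]; congr 2; omega

theorem rescale_C (a b : A) : rescale a (C b) = C b := by
  ext n
  rw [coeff_rescale, coeff_C]
  split_ifs with h <;> simp [h]

theorem one_sub_C_mul_X_ne_zero [Nontrivial A] (a : A) : (1 - C a * X : A⟦X⟧) ≠ 0 := fun h => by
  simpa using congrArg constantCoeff h

end CoeffZ

section RankSystem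

variable {R : Type*} [CommRing R] {Q s : R⟦X⟧} {ψ : ℕ → R⟦X⟧⟦X⟧}

/-- The terms of `diagSum`. -/
noncomputable def diagTerm (Q : R⟦X⟧) (f : ℕ → R⟦X⟧⟦X⟧) (m : ℤ) (κ : ℕ) : R⟦X⟧ :=
  Q ^ κ * coeffZ (f κ) (κ - m)

theorem decay_diagTerm (hQ : X ∣ Q) (f : ℕ → R⟦X⟧⟦X⟧) (m : ℤ) : Decay (diagTerm Q f m) :=
  Decay.mul_right
    (.of_dvd (fun κ => κ) (fun d => Set.finite_Iio d) fun κ => pow_dvd_pow_of_dvd hQ κ) _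

/-- The family `ψ` satisfies the recurrence, in the variable counting the weight, of the
generating functions of overpartitions of level at most `κ`, divided by `1 - s Q ^ (κ + 1)`.
The rank is the level minus the weight for `Q = X`, `s = 0`, and the M2-rank is so for
`Q = X ^ 2`, `s = X`. -/
structure RankSystem (Q s : R⟦X⟧) (ψ : ℕ → R⟦X⟧⟦X⟧) : Prop where
  dvd : X ∣ Q
  zero : ∃ a, ψ 0 = C a
  succ : ∀ κ, (1 - C (Q ^ (κ + 1)) * X) * C (1 - s * Q ^ (κ + 2)) * ψ (κ + 1) =
    (1 + C (s * Q ^ κ) * X) * (1 + C (Q ^ (κ + 1)) * X) * ψ κ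

/-- The generating function, in the variable counting the weight, of level at most `κ`. -/
noncomputable def levelGf (Q s : R⟦X⟧) (ψ : ℕ → R⟦X⟧⟦X⟧) (κ : ℕ) : R⟦X⟧⟦X⟧ :=
  C (1 - s * Q ^ (κ + 1)) * ψ κ

/-- The product of `ψ κ` with `(1 + w) / (1 - w)`, where `w` is the outer variable. Rescaled by
`Q`, it gives the next `levelGf` back up to the factor `1 + s w`. -/
noncomputable def cumulGf (ψ : ℕ → R⟦X⟧⟦X⟧) (κ : ℕ) : R⟦X⟧⟦X⟧ := ψ κ * (1 + X) * mk 1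

theorem one_sub_X_mul_cumulGf (ψ : ℕ → R⟦X⟧⟦X⟧) (κ : ℕ) :
    (1 - X) * cumulGf ψ κ = (1 + X) * ψ κ := by
  have h := mk_one_mul_one_sub_eq_one R⟦X⟧
  rw [cumulGf]
  linear_combination (1 + X) * ψ κ * h

theorem coeffZ_cumulGf_sub (ψ : ℕ → R⟦X⟧⟦X⟧) (κ : ℕ) (k : ℤ) :
    coeffZ (cumulGf ψ κ) k - coeffZ (cumulGf ψ κ) (k - 1) =
      coeffZ (ψ κ) k + coeffZ (ψ κ) (k - 1) := by
  have h := congrArg (fun f => coeffZ f k) (one_sub_X_mul_cumulGf ψ κ)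
  simpa only [sub_mul, add_mul, one_mul, coeffZ_sub, coeffZ_add, coeffZ_X_mul] using h

namespace RankSystem

theorem one_sub_ne_zero [Nontrivial R] (h : RankSystem Q s ψ) (κ : ℕ) :
    1 - s * Q ^ (κ + 1) ≠ 0 := fun h0 => by
  obtain ⟨g, rfl⟩ := h.dvd
  simpa [mul_pow] using congrArg constantCoeff h0

theorem one_sub_mul_levelGf_succ [IsDomain R] (h : RankSystem Q s ψ) (κ : ℕ) :
    (1 - C Q * X) * levelGf Q s ψ (κ + 1) =
      (1 + C s * X) * (1 + C Q * X) * rescale Q (ψ κ) := by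
  induction κ with
  | zero =>
    obtain ⟨a, ha⟩ := h.zero
    have := h.succ 0
    rw [ha] at this ⊢
    rw [rescale_C, levelGf]
    simpa [mul_assoc] using this
  | succ κ ih =>
    have h1 := h.succ (κ + 1)
    have h2 := congrArg (rescale Q) (h.succ κ)
    simp only [map_mul, map_sub, map_add, map_one, rescale_C, rescale_X, map_pow] at h2
    simp only [levelGf, map_mul, map_sub, map_one, map_pow] at h1 ih ⊢
    have hw : (1 - C Q ^ (κ + 2) * X : R⟦X⟧⟦X⟧) ≠ 0 := by
      rw [← map_pow]
      exact one_sub_C_mul_X_ne_zero _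
    have hs : (1 - C s * C Q ^ (κ + 2) : R⟦X⟧⟦X⟧) ≠ 0 := by
      rw [← map_pow, ← map_mul, ← map_one (C (R := R⟦X⟧)), ← map_sub]
      exact (map_ne_zero_iff _ C_injective).2 (h.one_sub_ne_zero (κ + 1))
    apply mul_left_cancel₀ hw
    apply mul_left_cancel₀ hs
    linear_combination (1 - C s * C Q ^ (κ + 2)) * (1 - C Q * X) * h1 +
      (1 + C s * C Q ^ (κ + 1) * X) * (1 + C Q ^ (κ + 2) * X) * ih -
      (1 + C s * X) * (1 + C Q * X) * h2

theorem levelGf_succ [IsDomain R] (h : RankSystem Q s ψ) (κ : ℕ) :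
    levelGf Q s ψ (κ + 1) = (1 + C s * X) * rescale Q (cumulGf ψ κ) := by
  have h1 := congrArg (rescale Q) (one_sub_X_mul_cumulGf ψ κ)
  simp only [map_mul, map_sub, map_add, map_one, rescale_X] at h1
  apply mul_left_cancel₀ (one_sub_C_mul_X_ne_zero Q)
  linear_combination h.one_sub_mul_levelGf_succ κ - (1 + C s * X) * h1

theorem coeffZ_levelGf_succ [IsDomain R] (h : RankSystem Q s ψ) (κ : ℕ) (k : ℤ) :
    coeffZ (levelGf Q s ψ (κ + 1)) k = Q ^ k.toNat * coeffZ (cumulGf ψ κ) k +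
      s * (Q ^ (k - 1).toNat * coeffZ (cumulGf ψ κ) (k - 1)) := by
  rw [h.levelGf_succ, add_mul, one_mul, mul_assoc, coeffZ_add, coeffZ_C_mul, coeffZ_X_mul,
    coeffZ_rescale, coeffZ_rescale]

theorem coeffZ_levelGf_zero (h : RankSystem Q s ψ) {k : ℤ} (hk : k ≠ 0) :
    coeffZ (levelGf Q s ψ 0) k = 0 := by
  obtain ⟨a, ha⟩ := h.zero
  rw [levelGf, ha, coeffZ_C_mul, coeffZ_C, if_neg hk, mul_zero]

theorem levelGf_succ_sub_levelGf (h : RankSystem Q s ψ) (κ : ℕ) :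
    levelGf Q s ψ (κ + 1) - levelGf Q s ψ κ =
      C (s * Q) * (C (Q ^ κ) * ψ κ) + C (s + Q) * (X * (C (Q ^ κ) * ψ κ)) +
      C (s * Q) * (X * (X * (C ((Q ^ 2) ^ κ) * ψ κ))) +
      (X * (C (Q ^ (κ + 1)) * ψ (κ + 1))) -
      C (s * Q) * (X * (C ((Q ^ 2) ^ (κ + 1)) * ψ (κ + 1))) := by
  have h1 := h.succ κ
  simp only [levelGf, map_mul, map_sub, map_add, map_one, map_pow] at h1 ⊢
  linear_combination h1

/-- Only telescoping terms involve `Q ^ 2`. -/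
theorem coeffZ_levelGf_succ_sub (h : RankSystem Q s ψ) (m : ℤ) (κ : ℕ) :
    coeffZ (levelGf Q s ψ (κ + 1)) ((κ + 1 : ℕ) - m) -
        coeffZ (levelGf Q s ψ κ) (κ - (m - 1)) =
      s * Q * diagTerm Q ψ (m - 1) κ + (s + Q) * diagTerm Q ψ m κ +
      diagTerm Q ψ (m + 1) (κ + 1) -
      s * Q * (diagTerm (Q ^ 2) ψ (m + 1) (κ + 1) - diagTerm (Q ^ 2) ψ (m + 1) κ) := by
  rw [show ((κ + 1 : ℕ) - m : ℤ) = κ - (m - 1) by push_cast; ring, ← coeffZ_sub,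
    h.levelGf_succ_sub_levelGf]
  simp only [coeffZ_sub, coeffZ_add, coeffZ_C_mul, coeffZ_X_mul, diagTerm]
  rw [show (κ - (m - 1) - 1 : ℤ) = κ - m by ring, show (κ - m - 1 : ℤ) = κ - (m + 1) by ring,
    show ((κ + 1 : ℕ) - (m + 1) : ℤ) = κ - m by push_cast; ring]
  ring

theorem decay_coeffZ_levelGf [IsDomain R] (h : RankSystem Q s ψ) (m : ℤ) :
    Decay fun κ : ℕ => coeffZ (levelGf Q s ψ κ) (κ - m) := by
  refine .of_dvd (fun κ : ℕ => (κ - m - 1).toNat)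
    (fun d => (Set.finite_Iio (d + m + 1).toNat).subset fun κ hκ => ?_) fun κ => ?_
  · simp only [Set.mem_ofPred_eq] at hκ
    simp only [Set.mem_Iio]
    omega
  · cases κ with
    | zero =>
      rcases eq_or_ne m 0 with rfl | hm
      · simp
      · rw [h.coeffZ_levelGf_zero (by simpa using hm)]
        exact dvd_zero _
    | succ κ =>
      rw [h.coeffZ_levelGf_succ]
      refine dvd_add (Dvd.dvd.mul_right ?_ _) (Dvd.dvd.mul_left (Dvd.dvd.mul_right ?_ _) _)
      · exact (pow_dvd_pow X (by omega)).trans (pow_dvd_pow_of_dvd h.dvd _)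
      · exact pow_dvd_pow_of_dvd h.dvd _

end RankSystem

variable [TopologicalSpace R]

/-- The diagonal sums `∑ κ, Q ^ κ [w ^ (κ - m)] f κ`, where `w` is the outer variable. -/
noncomputable def diagSum (Q : R⟦X⟧) (f : ℕ → R⟦X⟧⟦X⟧) (m : ℤ) : R⟦X⟧ :=
  ∑' κ : ℕ, diagTerm Q f m κ

/-- The generating function of the overpartitions with level equal to the weight plus at
most `m`; the inequality comes from `levelGf κ` counting levels at most `κ`. -/
noncomputable def rankLe (Q s : R⟦X⟧) (ψ : ℕ → R⟦X⟧⟦X⟧) (m : ℤ) : R⟦X⟧ :=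
  ∑' κ : ℕ, coeffZ (levelGf Q s ψ κ) (κ - m)

/-- What `rankLe m + rankLe (m - 1)` lacks to twice the full generating function, up to the
overpartitions of level `0`. -/
noncomputable def tailSum (Q s : R⟦X⟧) (ψ : ℕ → R⟦X⟧⟦X⟧) (m : ℤ) : R⟦X⟧ :=
  diagSum Q (cumulGf ψ) (m + 1) + (s + Q) * diagSum Q (cumulGf ψ) m +
    s * Q * diagSum Q (cumulGf ψ) (m - 1)

theorem pow_dvd_diagSum [T2Space R] (hQ : X ∣ Q) (f : ℕ → R⟦X⟧⟦X⟧) (m : ℕ) :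
    X ^ m ∣ diagSum Q f m := by
  refine (decay_diagTerm hQ f m).dvd_tsum fun κ => ?_
  rcases lt_or_ge κ m with h | h
  · rw [diagTerm, coeffZ_of_neg _ (by omega)]; simp
  · exact ((pow_dvd_pow X h).trans (pow_dvd_pow_of_dvd hQ κ)).mul_right _

theorem xAdicTendsto_tailSum [T2Space R] (hQ : X ∣ Q) (s : R⟦X⟧) (ψ : ℕ → R⟦X⟧⟦X⟧) :
    XAdicTendsto (fun m : ℕ => tailSum Q s ψ (m + 1)) 0 := .of_X_pow_dvd fun m => by
  have h0 := pow_dvd_diagSum hQ (cumulGf ψ) m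
  have h1 := pow_dvd_diagSum hQ (cumulGf ψ) (m + 1)
  have h2 := pow_dvd_diagSum hQ (cumulGf ψ) (m + 2)
  rw [tailSum, add_sub_cancel_right]
  push_cast at h1 h2
  refine dvd_add (dvd_add ?_ ?_) (h0.mul_left _)
  · rw [add_assoc]; exact (pow_dvd_pow X (by omega)).trans h2
  · exact ((pow_dvd_pow X (by omega)).trans h1).mul_left _

variable [IsTopologicalRing R] [T2Space R]

theorem diagSum_cumulGf_sub (hQ : X ∣ Q) (ψ : ℕ → R⟦X⟧⟦X⟧) (m : ℤ) :
    diagSum Q (cumulGf ψ) m - diagSum Q (cumulGf ψ) (m + 1) =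
      diagSum Q ψ m + diagSum Q ψ (m + 1) := by
  simp only [diagSum]
  rw [← (decay_diagTerm hQ _ _).tsum_sub (decay_diagTerm hQ _ _),
    ← (decay_diagTerm hQ _ _).tsum_add (decay_diagTerm hQ _ _)]
  refine tsum_congr fun κ => ?_
  have := coeffZ_cumulGf_sub ψ κ (κ - m)
  simp only [diagTerm, ← sub_sub]
  linear_combination Q ^ κ * this

namespace RankSystem

variable [IsDomain R]

theorem pow_mul_rankLe (h : RankSystem Q s ψ) {m : ℤ} {a b : ℕ} (hab : (a : ℤ) = b + m) :
    Q ^ (a + 1) * (rankLe Q s ψ (m + 1) - coeffZ (levelGf Q s ψ 0) (-m - 1)) =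
      Q ^ b * (Q * diagSum Q (cumulGf ψ) m + s * diagSum Q (cumulGf ψ) (m + 1)) := by
  have hlevel : HasSum (fun κ : ℕ => coeffZ (levelGf Q s ψ (κ + 1)) ((κ + 1 : ℕ) - (m + 1)))
      (rankLe Q s ψ (m + 1) - coeffZ (levelGf Q s ψ 0) (-m - 1)) := by
    have := (hasSum_nat_add_iff' 1).2 (h.decay_coeffZ_levelGf (m + 1)).summable.hasSum
    simpa only [Finset.sum_range_one, Nat.cast_zero, zero_sub, neg_add', rankLe] using this
  have hdiag (n : ℤ) : HasSum (diagTerm Q (cumulGf ψ) n) (diagSum Q (cumulGf ψ) n) :=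
    (decay_diagTerm h.dvd _ n).summable.hasSum
  refine (hlevel.mul_left (Q ^ (a + 1))).unique ?_
  convert (((hdiag m).mul_left Q).add ((hdiag (m + 1)).mul_left s)).mul_left (Q ^ b) using 1
  ext1 κ
  rw [show ((κ + 1 : ℕ) - (m + 1) : ℤ) = κ - m by push_cast; ring, h.coeffZ_levelGf_succ]
  have e1 := pow_mul_pow_toNat_mul_coeffZ Q (cumulGf ψ κ) (j := κ - m) (c := a + 1)
    (d := b + κ + 1) (by push_cast; omega)
  have e2 := pow_mul_pow_toNat_mul_coeffZ Q (cumulGf ψ κ) (j := κ - m - 1) (c := a + 1)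
    (d := b + κ) (by push_cast; omega)
  simp only [diagTerm, ← sub_sub]
  linear_combination e1 + s * e2

theorem rankLe_sub (h : RankSystem Q s ψ) (m : ℤ) :
    rankLe Q s ψ m - rankLe Q s ψ (m - 1) =
      diagSum Q ψ (m + 1) + (s + Q) * diagSum Q ψ m + s * Q * diagSum Q ψ (m - 1) +
      coeffZ (levelGf Q s ψ 0) (-m) - coeffZ (levelGf Q s ψ 0) (-m - 1) := by
  have hQ2 : X ∣ Q ^ 2 := h.dvd.trans (dvd_pow_self Q two_ne_zero)
  have hlevel (n : ℤ) := (h.decay_coeffZ_levelGf n).summable.hasSum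
  have hdiag (n : ℤ) := (decay_diagTerm h.dvd ψ n).summable.hasSum
  have hdiag2 := (decay_diagTerm hQ2 ψ (m + 1)).summable.hasSum
  have hsum := ((((hdiag (m - 1)).mul_left (s * Q)).add ((hdiag m).mul_left (s + Q))).add
    ((hasSum_nat_add_iff' 1).2 (hdiag (m + 1)))).sub
    ((((hasSum_nat_add_iff' 1).2 hdiag2).sub hdiag2).mul_left (s * Q))
  have key := (((hasSum_nat_add_iff' 1).2 (hlevel m)).sub (hlevel (m - 1))).unique
    (by simpa only [h.coeffZ_levelGf_succ_sub m] using hsum)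
  have hzero : coeffZ (levelGf Q s ψ 0) (-m - 1) = (1 - s * Q) * coeffZ (ψ 0) (-(m + 1)) := by
    rw [levelGf, coeffZ_C_mul, neg_add', zero_add, pow_one]
  simp only [Finset.sum_range_one, diagTerm, pow_zero, one_mul, Nat.cast_zero, zero_sub] at key
  simp only [rankLe, diagSum, diagTerm]
  linear_combination key + hzero

variable {P : R⟦X⟧}

theorem rankLe_add_rankLe_add_tailSum (h : RankSystem Q s ψ)
    (hP : XAdicTendsto (fun m : ℕ => rankLe Q s ψ m) P) (m : ℤ) :
    rankLe Q s ψ m + rankLe Q s ψ (m - 1) + tailSum Q s ψ m +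
      coeffZ (levelGf Q s ψ 0) (-m) + coeffZ (levelGf Q s ψ 0) (-m - 1) = 2 * P := by
  set T : ℤ → R⟦X⟧ := fun m => rankLe Q s ψ m + rankLe Q s ψ (m - 1) + tailSum Q s ψ m +
    coeffZ (levelGf Q s ψ 0) (-m) + coeffZ (levelGf Q s ψ 0) (-m - 1) with hT
  have hperiodic : Function.Periodic T 1 := fun m => by
    have h1 := h.rankLe_sub m
    have h2 := h.rankLe_sub (m + 1)
    have b0 := diagSum_cumulGf_sub h.dvd ψ (m - 1)
    have b1 := diagSum_cumulGf_sub h.dvd ψ m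
    have b2 := diagSum_cumulGf_sub h.dvd ψ (m + 1)
    rw [sub_add_cancel] at b0
    rw [add_sub_cancel_right] at h2
    simp only [hT, tailSum, neg_add', add_sub_cancel_right] at h2 ⊢
    linear_combination h1 + h2 - b2 - (s + Q) * b1 - s * Q * b0
  have hconst (m : ℤ) : T m = T 0 := by simpa using hperiodic.int_mul_eq m
  have hlim : XAdicTendsto (fun _ => T m) (2 * P) := by
    rw [two_mul, ← add_zero (P + P)]
    convert ((hP.comp_add 1).add hP).add (xAdicTendsto_tailSum h.dvd s ψ) using 2 with j
    rw [hconst, ← hconst (j + 1)]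
    simp only [hT]
    rw [h.coeffZ_levelGf_zero (by omega), h.coeffZ_levelGf_zero (by omega)]
    simp
  exact hlim.eq_of_const

theorem rankLe_add_rankLe_add_tailSum_of_ne (h : RankSystem Q s ψ)
    (hP : XAdicTendsto (fun m : ℕ => rankLe Q s ψ m) P) {m : ℤ} (h0 : m ≠ 0) (h1 : m ≠ -1) :
    rankLe Q s ψ m + rankLe Q s ψ (m - 1) + tailSum Q s ψ m = 2 * P := by
  simpa [h.coeffZ_levelGf_zero (k := -m) (by omega),
    h.coeffZ_levelGf_zero (k := -m - 1) (by omega)] using h.rankLe_add_rankLe_add_tailSum hP m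

theorem pow_mul_rankLe_of_ne (h : RankSystem Q s ψ) {m : ℤ} {a b : ℕ} (hab : (a : ℤ) = b + m)
    (hm : m ≠ -1) :
    Q ^ (a + 1) * rankLe Q s ψ (m + 1) =
      Q ^ b * (Q * diagSum Q (cumulGf ψ) m + s * diagSum Q (cumulGf ψ) (m + 1)) := by
  rw [← h.pow_mul_rankLe hab, h.coeffZ_levelGf_zero (by omega), sub_zero]

end RankSystem

end RankSystem

theorem eq_neg_mul_partialTheta {s r : ℕ} (hsr : s * r = 2) {P : ℚ⟦X⟧} {f : ℕ → ℚ⟦X⟧}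
    (hf : ∀ m, f m = X ^ (s * (m + 1) + 1) * (P - f (m + r))) (m : ℕ) :
    f m = -(P * partialTheta (s * (m + 1))) := by
  have hg (m : ℕ) : -(P * partialTheta (s * (m + 1))) = X ^ (s * (m + 1) + 1) *
      (P + P * partialTheta (s * (m + r + 1))) := by
    rw [partialTheta_eq, show s * (m + r + 1) = s * (m + 1) + s * r by ring, hsr]
    ring
  refine eq_of_forall_X_pow_dvd_sub fun d => ?_
  induction d generalizing m with
  | zero => simp
  | succ d ih =>
    obtain ⟨a, ha⟩ := ih (m + r)
    exact ⟨-(X ^ (s * (m + 1)) * a), by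
      rw [hf, hg]; linear_combination -X ^ (s * (m + 1) + 1) * ha⟩

namespace RankSystem

variable {P : ℚ⟦X⟧} {ψ : ℕ → ℚ⟦X⟧⟦X⟧}

theorem two_mul_sub_rankLe_X (h : RankSystem X 0 ψ)
    (hP : XAdicTendsto (fun m : ℕ => rankLe X 0 ψ m) P) (m : ℕ) :
    2 * P - (rankLe X 0 ψ (m + 1) + rankLe X 0 ψ m) =
      -(2 * P * partialTheta (1 * (m + 1))) := by
  refine eq_neg_mul_partialTheta (r := 2) rfl
    (f := fun m => 2 * P - (rankLe X 0 ψ (m + 1) + rankLe X 0 ψ m)) (fun m => ?_) m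
  have h1 := h.rankLe_add_rankLe_add_tailSum_of_ne hP (m := m + 1) (by omega) (by omega)
  have h2 := h.pow_mul_rankLe_of_ne (m := m + 1) (a := m + 1) (b := 0) (by omega) (by omega)
  have h3 := h.pow_mul_rankLe_of_ne (m := m + 2) (a := m + 2) (b := 0) (by omega) (by omega)
  rw [tailSum] at h1
  push_cast
  simp only [add_assoc] at h1 h2 h3 ⊢
  norm_num at h1 h2 h3 ⊢
  apply mul_left_cancel₀ (X_ne_zero (R := ℚ))
  linear_combination -X * h1 - h3 - X * h2

theorem rankLe_X_neg (h : RankSystem X 0 ψ)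
    (hP : XAdicTendsto (fun m : ℕ => rankLe X 0 ψ m) P) (m : ℕ) :
    rankLe X 0 ψ (-m - 1) + rankLe X 0 ψ (-m - 2) =
      -(2 * P * partialTheta (1 * (m + 1))) := by
  refine eq_neg_mul_partialTheta (r := 2) rfl
    (f := fun m => rankLe X 0 ψ (-m - 1) + rankLe X 0 ψ (-m - 2)) (fun m => ?_) m
  have h1 := h.rankLe_add_rankLe_add_tailSum_of_ne hP (m := -m - 3) (by omega) (by omega)
  have h2 := h.pow_mul_rankLe_of_ne (m := -m - 2) (a := 0) (b := m + 2) (by omega) (by omega)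
  have h3 := h.pow_mul_rankLe_of_ne (m := -m - 3) (a := 0) (b := m + 3) (by omega) (by omega)
  rw [tailSum] at h1
  apply mul_left_cancel₀ (X_ne_zero (R := ℚ))
  push_cast
  ring_nf at h1 h2 h3 ⊢
  linear_combination h2 + h3 + X ^ (m + 3) * h1

theorem two_mul_sub_rankLe_X_sq (h : RankSystem (X ^ 2) X ψ)
    (hP : XAdicTendsto (fun m : ℕ => rankLe (X ^ 2) X ψ m) P) (m : ℕ) :
    2 * P - (rankLe (X ^ 2) X ψ (m + 1) + rankLe (X ^ 2) X ψ m) =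
      -(2 * P * partialTheta (2 * (m + 1))) := by
  refine eq_neg_mul_partialTheta (r := 1) rfl
    (f := fun m => 2 * P - (rankLe (X ^ 2) X ψ (m + 1) + rankLe (X ^ 2) X ψ m))
    (fun m => ?_) m
  have h1 := h.rankLe_add_rankLe_add_tailSum_of_ne hP (m := m + 1) (by omega) (by omega)
  have h2 := h.pow_mul_rankLe_of_ne (m := m) (a := m) (b := 0) (by omega) (by omega)
  have h3 := h.pow_mul_rankLe_of_ne (m := m + 1) (a := m + 1) (b := 0) (by omega) (by omega)
  rw [tailSum] at h1
  push_cast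
  simp only [add_assoc] at h1 h2 h3 ⊢
  norm_num at h1 h2 h3 ⊢
  apply mul_left_cancel₀ (X_ne_zero (R := ℚ))
  rw [← pow_mul] at h2 h3
  linear_combination -X * h1 - h3 - X ^ 2 * h2

theorem rankLe_X_sq_neg (h : RankSystem (X ^ 2) X ψ)
    (hP : XAdicTendsto (fun m : ℕ => rankLe (X ^ 2) X ψ m) P) (m : ℕ) :
    rankLe (X ^ 2) X ψ (-m - 1) + rankLe (X ^ 2) X ψ (-m - 2) =
      -(2 * P * partialTheta (2 * (m + 1))) := by
  refine eq_neg_mul_partialTheta (r := 1) rfl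
    (f := fun m => rankLe (X ^ 2) X ψ (-m - 1) + rankLe (X ^ 2) X ψ (-m - 2)) (fun m => ?_) m
  have h1 := h.rankLe_add_rankLe_add_tailSum_of_ne hP (m := -m - 2) (by omega) (by omega)
  have h2 := h.pow_mul_rankLe_of_ne (m := -m - 2) (a := 0) (b := m + 2) (by omega) (by omega)
  have h3 := h.pow_mul_rankLe_of_ne (m := -m - 3) (a := 0) (b := m + 3) (by omega) (by omega)
  rw [tailSum] at h1
  apply mul_left_cancel₀ (pow_ne_zero 2 (X_ne_zero (R := ℚ)))
  push_cast
  ring_nf at h1 h2 h3 ⊢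
  linear_combination h2 + h3 + X ^ (2 * m + 5) * h1

theorem rankLe_zero_add_rankLe_neg_one (h : RankSystem X 0 ψ)
    (hP : XAdicTendsto (fun m : ℕ => rankLe X 0 ψ m) P)
    (hN : XAdicTendsto (fun m : ℕ => rankLe X 0 ψ (-m - 1)) 0) :
    rankLe X 0 ψ 0 + rankLe X 0 ψ (-1) = P := by
  have hsymm (m : ℕ) : P - (rankLe X 0 ψ 0 + rankLe X 0 ψ (-1)) =
      (-1) ^ m * (P - (rankLe X 0 ψ m + rankLe X 0 ψ (-m - 1))) := by
    induction m with
    | zero => simp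
    | succ m ih =>
      have h1 := h.two_mul_sub_rankLe_X hP m
      have h2 := h.rankLe_X_neg hP m
      rw [ih, show (-(m + 1 : ℕ) - 1 : ℤ) = -m - 2 by push_cast; ring]
      push_cast
      linear_combination (-1) ^ m * h1 - (-1) ^ m * h2
  refine XAdicTendsto.eq_of_const fun d => (hP.add hN d).mono fun m hm => ?_
  rw [hsymm m]
  exact (by simpa using hm : X ^ d ∣ _).mul_left _

theorem mul_thetaSeries_eq_one (h : RankSystem X 0 ψ) (h0 : ψ 0 = 1)
    (hP : XAdicTendsto (fun m : ℕ => rankLe X 0 ψ m) P)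
    (hN : XAdicTendsto (fun m : ℕ => rankLe X 0 ψ (-m - 1)) 0) :
    P * thetaSeries = 1 := by
  have h1 := h.rankLe_add_rankLe_add_tailSum hP 0
  have h2 := h.pow_mul_rankLe_of_ne (m := 0) (a := 0) (b := 0) rfl (by omega)
  have h3 := h.pow_mul_rankLe_of_ne (m := 1) (a := 1) (b := 0) rfl (by omega)
  have h4 := h.two_mul_sub_rankLe_X hP 1
  have h5 : coeffZ (levelGf X 0 ψ 0) 0 = 1 := by
    rw [levelGf, h0, mul_one, coeffZ_C]; simp
  have h6 := partialTheta_eq 0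
  have h7 := h.rankLe_zero_add_rankLe_neg_one hP hN
  rw [tailSum, neg_zero, h5, h.coeffZ_levelGf_zero (k := 0 - 1) (by omega)] at h1
  norm_num at h1 h2 h3 h4 h6
  rw [thetaSeries_eq_one_add_two_mul]
  apply mul_left_cancel₀ (X_ne_zero (R := ℚ))
  linear_combination 2 * P * X * h6 - X ^ 2 * h4 - h3 - X ^ 2 * h2 - X * h1 + X * h7

end RankSystem

/-! ### Generating functions of overpartitions by level and weight -/

section SwapVars

variable {R : Type*} [CommRing R]

/-- Exchange of the two variables of an iterated power series. -/
noncomputable def swapVars : R⟦X⟧⟦X⟧ →+* R⟦X⟧⟦X⟧ where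
  toFun f := mk fun k => mk fun n => coeff k (coeff n f)
  map_one' := by
    ext k n
    simp only [coeff_mk, coeff_one]
    split_ifs with h1 h2 h2 <;> simp [h1, h2, coeff_one]
  map_zero' := by ext k n; simp
  map_add' f g := by ext k n; simp
  map_mul' f g := by
    ext k n
    simp only [coeff_mk, coeff_mul, map_sum]
    exact Finset.sum_comm

theorem coeff_coeff_swapVars (f : R⟦X⟧⟦X⟧) (k n : ℕ) :
    coeff n (coeff k (swapVars f)) = coeff k (coeff n f) := by
  simp [swapVars]

theorem swapVars_X : swapVars (X : R⟦X⟧⟦X⟧) = C X := by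
  ext k n
  rw [coeff_coeff_swapVars, coeff_X, coeff_C]
  split_ifs with h1 h2 h2 <;> simp [h1, h2, coeff_X, coeff_one]

theorem swapVars_C_X : swapVars (C X : R⟦X⟧⟦X⟧) = X := by
  ext k n
  rw [coeff_coeff_swapVars, coeff_X, coeff_C]
  split_ifs with h1 h2 h2 <;> simp [h1, h2, coeff_X, coeff_one]

end SwapVars

section GenFun

variable {R : Type*} [CommRing R]

theorem one_sub_mul_one_add_tsum_geom [TopologicalSpace R] [T2Space R] [IsTopologicalRing R]
    (a b : R) (i : ℕ) :
    (1 - C a * X ^ (i + 1)) *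
        (1 + ∑' j : ℕ, (b * a ^ (j + 1)) • (X : R⟦X⟧) ^ ((i + 1) * (j + 1))) =
      1 + (C b - 1) * (C a * X ^ (i + 1)) := by
  have h0 : constantCoeff (C a * X ^ (i + 1) : R⟦X⟧) = 0 := by simp
  have hterm (j : ℕ) : (b * a ^ (j + 1)) • (X : R⟦X⟧) ^ ((i + 1) * (j + 1)) =
      C b * (C a * X ^ (i + 1)) * (C a * X ^ (i + 1)) ^ j := by
    rw [smul_eq_C_mul, map_mul, map_pow, mul_pow, ← pow_mul]; ring
  simp only [hterm]
  rw [(WithPiTopology.summable_pow_of_constantCoeff_eq_zero h0).tsum_mul_left]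
  linear_combination (C b * (C a * X ^ (i + 1))) *
    WithPiTopology.one_sub_mul_tsum_pow_of_constantCoeff_eq_zero h0

theorem genFun_mul_prod (a b : ℕ → R) (N : ℕ) (hb : ∀ i, N ≤ i → b (i + 1) = 0) :
    Nat.Partition.genFun (fun i c => b i * a i ^ c) *
      ∏ i ∈ Finset.range N, (1 - C (a (i + 1)) * X ^ (i + 1)) =
      ∏ i ∈ Finset.range N, (1 + (C (b (i + 1)) - 1) * (C (a (i + 1)) * X ^ (i + 1))) := by
  let _ : TopologicalSpace R := ⊥
  have : DiscreteTopology R := ⟨rfl⟩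
  have hprod := hasProd_prod_of_ne_finset_one (L := .unconditional _) (s := Finset.range N)
    (f := fun i =>
      (1 : R⟦X⟧) + ∑' j, (b (i + 1) * a (i + 1) ^ (j + 1)) • X ^ ((i + 1) * (j + 1)))
    fun i hi => by simp [hb i (by simpa using hi)]
  rw [(Nat.Partition.hasProd_genFun fun i c => b i * a i ^ c).unique hprod,
    ← Finset.prod_mul_distrib]
  refine Finset.prod_congr rfl fun i _ => ?_
  rw [mul_comm, one_sub_mul_one_add_tsum_geom]

theorem one_sub_C_mul_X_pow_ne_zero [Nontrivial R] (a : R) (i : ℕ) :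
    (1 - C a * X ^ (i + 1) : R⟦X⟧) ≠ 0 := fun h => by
  simpa using congrArg constantCoeff h

end GenFun

namespace Overpartition

variable {n : ℕ}

theorem overlined_add_nonOverlined (l : Overpartition n) :
    l.overlined.val + l.nonOverlined = l.parts :=
  add_tsub_cancel_of_le ((Multiset.le_iff_subset l.overlined.nodup).2 fun _ hx =>
    Multiset.mem_toFinset.1 (l.overlined_subset hx))

theorem mem_parts_of_mem_overlined (l : Overpartition n) {i : ℕ} (h : i ∈ l.overlined) :
    i ∈ l.parts :=
  Multiset.mem_toFinset.1 (l.overlined_subset h)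

theorem forall_mem_parts (l : Overpartition n) (p : ℕ → Prop) :
    (∀ i ∈ l.parts, p i) ↔
      (∀ i ∈ l.overlined, p i) ∧ ∀ i ∈ l.parts.toFinset \ l.overlined, p i := by
  have hparts : l.overlined ∪ l.parts.toFinset \ l.overlined = l.parts.toFinset :=
    Finset.union_sdiff_of_subset l.overlined_subset
  simp_rw [← Multiset.mem_toFinset (s := l.parts), ← Finset.forall_mem_union, hparts]

theorem sum_overlined_add_sum {M : Type*} [AddCommMonoid M] (l : Overpartition n) (f : ℕ → M) :
    ∑ i ∈ l.overlined, f i + ∑ i ∈ l.parts.toFinset \ l.overlined, f i =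
      ∑ i ∈ l.parts.toFinset, f i := by
  rw [add_comm]
  exact Finset.sum_sdiff l.overlined_subset

theorem le_largestPart (l : Overpartition n) {i : ℕ} (h : i ∈ l.parts) : i ≤ l.largestPart :=
  Multiset.le_sup h

theorem largestPart_le_iff (l : Overpartition n) {κ : ℕ} :
    l.largestPart ≤ κ ↔ ∀ i ∈ l.parts, i ≤ κ := Multiset.sup_le

theorem largestPart_le (l : Overpartition n) : l.largestPart ≤ n :=
  l.largestPart_le_iff.2 fun _ hi =>
    (Multiset.single_le_sum (fun _ _ => Nat.zero_le _) _ hi).trans l.toPartition.parts_sum.le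

theorem card_parts_le (l : Overpartition n) : l.parts.card ≤ n := by
  have := Multiset.card_nsmul_le_sum (s := l.parts) (a := 1) fun i hi => l.toPartition.parts_pos hi
  rw [smul_eq_mul, mul_one] at this
  exact this.trans l.toPartition.parts_sum.le

/-- An overpartition is a choice, for each part size `i`, of whether it is overlined. -/
theorem coeff_genFun_add {R : Type*} [CommRing R] (n : ℕ) (g h : ℕ → ℕ → R) :
    coeff n (Nat.Partition.genFun fun i c => g i c + h i c) =
      ∑ l : Overpartition n, (∏ i ∈ l.overlined, g i (l.parts.count i)) *
        ∏ i ∈ l.parts.toFinset \ l.overlined, h i (l.parts.count i) := by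
  rw [Nat.Partition.coeff_genFun, eq_comm]
  refine (Fintype.sum_equiv (equivSigma n) _ (fun x => (∏ i ∈ x.2.1, g i (x.1.parts.count i)) *
      ∏ i ∈ x.1.parts.toFinset \ x.2.1, h i (x.1.parts.count i)) fun l => rfl).trans ?_
  rw [Fintype.sum_sigma]
  refine Finset.sum_congr rfl fun p _ => ?_
  simp only [Finsupp.prod, Multiset.toFinsupp_support, Multiset.toFinsupp_apply, Finset.prod_add]
  exact Finset.sum_coe_sort p.parts.toFinset.powerset (fun s => (∏ i ∈ s, g i (p.parts.count i)) *
      ∏ i ∈ p.parts.toFinset \ s, h i (p.parts.count i))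

theorem coeff_coeff_genFun_ite {R : Type*} [CommRing R] (k n : ℕ) (po pn : ℕ → Prop)
    [DecidablePred po] [DecidablePred pn] (eo en : ℕ → ℕ → ℕ) :
    coeff k (coeff n (Nat.Partition.genFun fun i c =>
      (if po i then (X : R⟦X⟧) ^ eo i c else 0) + (if pn i then X ^ en i c else 0))) =
    ((Finset.univ.filter fun l : Overpartition n =>
      ((∀ i ∈ l.overlined, po i) ∧ ∀ i ∈ l.parts.toFinset \ l.overlined, pn i) ∧
      ∑ i ∈ l.overlined, eo i (l.parts.count i) +
        ∑ i ∈ l.parts.toFinset \ l.overlined, en i (l.parts.count i) = k).card : R) := by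
  rw [coeff_genFun_add, map_sum, Finset.card_filter, Nat.cast_sum]
  refine Finset.sum_congr rfl fun l _ => ?_
  rw [Finset.prod_ite_zero, Finset.prod_ite_zero, Finset.prod_pow_eq_pow_sum,
    Finset.prod_pow_eq_pow_sum, ite_zero_mul_ite_zero, ← pow_add, apply_ite (coeff k), map_zero,
    coeff_X_pow, ← ite_and]
  simp only [eq_comm (a := k), Nat.cast_ite, Nat.cast_one, Nat.cast_zero]

end Overpartition

/-- The generating function of overpartitions with parts at most `κ`, by number of parts. -/
noncomputable def rankGf (κ : ℕ) : ℚ⟦X⟧⟦X⟧ :=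
  Nat.Partition.genFun fun i c => (if i ≤ κ then 2 else 0) * (X : ℚ⟦X⟧) ^ c

theorem coeff_coeff_rankGf (κ k n : ℕ) : coeff k (coeff n (rankGf κ)) =
    ((Finset.univ.filter fun l : Overpartition n =>
      l.largestPart ≤ κ ∧ l.parts.card = k).card : ℚ) := by
  have hweight : rankGf κ = Nat.Partition.genFun fun i c =>
      (if i ≤ κ then (X : ℚ⟦X⟧) ^ c else 0) + (if i ≤ κ then X ^ c else 0) := by
    rw [rankGf]
    congr 1
    ext1 i; ext1 c
    split_ifs <;> ring
  rw [hweight, Overpartition.coeff_coeff_genFun_ite]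
  simp only [Overpartition.sum_overlined_add_sum, Multiset.toFinset_sum_count_eq,
    Overpartition.largestPart_le_iff, Overpartition.forall_mem_parts]

theorem rankGf_mul_prod (κ : ℕ) :
    rankGf κ * ∏ i ∈ Finset.range κ, (1 - C X * X ^ (i + 1)) =
      ∏ i ∈ Finset.range κ, (1 + C X * X ^ (i + 1)) := by
  rw [rankGf, genFun_mul_prod (fun _ => X) (fun i => if i ≤ κ then 2 else 0) κ
    fun i hi => if_neg (by omega)]
  refine Finset.prod_congr rfl fun i hi => ?_
  rw [if_pos (Nat.succ_le_of_lt (Finset.mem_range.1 hi)), map_ofNat]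
  ring

theorem one_sub_mul_rankGf_succ (κ : ℕ) : (1 - C X * X ^ (κ + 1)) * rankGf (κ + 1) =
    (1 + C X * X ^ (κ + 1)) * rankGf κ := by
  have h1 := rankGf_mul_prod κ
  have h2 := rankGf_mul_prod (κ + 1)
  rw [Finset.prod_range_succ, Finset.prod_range_succ, ← h1] at h2
  have h3 : ∏ i ∈ Finset.range κ, (1 - C X * X ^ (i + 1) : ℚ⟦X⟧⟦X⟧) ≠ 0 :=
    Finset.prod_ne_zero_iff.2 fun i _ => one_sub_C_mul_X_pow_ne_zero _ _
  apply mul_left_cancel₀ h3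
  linear_combination h2

theorem rankGf_zero : rankGf 0 = 1 := by simpa using rankGf_mul_prod 0

theorem rankSystem_rankGf : RankSystem X 0 fun κ => swapVars (rankGf κ) where
  dvd := dvd_rfl
  zero := ⟨1, by simp [rankGf_zero]⟩
  succ κ := by
    have h := congrArg swapVars (one_sub_mul_rankGf_succ κ)
    simp only [map_mul, map_sub, map_add, map_one, map_pow, swapVars_X, swapVars_C_X] at h
    simp only [zero_mul, sub_zero, map_one, map_zero, map_pow]
    linear_combination h

namespace Overpartition

variable {n : ℕ}

/-- The part `⌈ℓ(λ)/2⌉ - χ(λ)` of the `M2`-rank. There is no truncation in the subtraction: the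
largest part is positive if `χ(λ) = 1`. -/
def m2Level (l : Overpartition n) : ℕ :=
  (l.largestPart + 1) / 2 - if Odd l.largestPart ∧ l.largestPart ∉ l.overlined then 1 else 0

/-- The number `n(λ) - n(λ_o)` of parts that are even or overlined. -/
def m2Weight (l : Overpartition n) : ℕ :=
  ∑ i ∈ l.overlined, (if Even i then l.parts.count i else 1) +
    ∑ i ∈ l.parts.toFinset \ l.overlined, if Even i then l.parts.count i else 0

theorem card_filter_odd_nonOverlined (l : Overpartition n) :
    (l.nonOverlined.filter fun x => Odd x).card =
      ∑ i ∈ l.parts.toFinset, if Odd i then l.nonOverlined.count i else 0 := by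
  rw [← Multiset.sum_count_eq_card (s := l.parts.toFinset)]
  · exact Finset.sum_congr rfl fun i _ => Multiset.count_filter
  · intro i hi
    exact Multiset.mem_toFinset.2
      (Multiset.mem_of_le (Multiset.sub_le_self _ _) (Multiset.mem_filter.1 hi).1)

theorem ite_mem_overlined_add_count_nonOverlined (l : Overpartition n) (i : ℕ) :
    (if i ∈ l.overlined then 1 else 0) + l.nonOverlined.count i = l.parts.count i := by
  rw [← l.overlined_add_nonOverlined, Multiset.count_add,
    Multiset.count_eq_of_nodup l.overlined.nodup]
  rfl

theorem m2Weight_add_card (l : Overpartition n) :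
    l.m2Weight + (l.nonOverlined.filter fun x => Odd x).card = l.parts.card := by
  rw [card_filter_odd_nonOverlined, ← Multiset.toFinset_sum_count_eq l.parts,
    ← sum_overlined_add_sum, ← sum_overlined_add_sum, m2Weight, add_add_add_comm,
    ← Finset.sum_add_distrib, ← Finset.sum_add_distrib]
  congr 1 <;> refine Finset.sum_congr rfl fun i hi => ?_
  · have hcount := l.ite_mem_overlined_add_count_nonOverlined i
    rw [if_pos hi] at hcount
    by_cases he : Even i
    · rw [if_pos he, if_neg (Nat.not_odd_iff_even.2 he), add_zero]
    · rw [if_neg he, if_pos (Nat.not_even_iff_odd.1 he), hcount]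
  · have hcount := l.ite_mem_overlined_add_count_nonOverlined i
    rw [if_neg (Finset.mem_sdiff.1 hi).2, zero_add] at hcount
    by_cases he : Even i
    · rw [if_pos he, if_neg (Nat.not_odd_iff_even.2 he), add_zero]
    · rw [if_neg he, if_pos (Nat.not_even_iff_odd.1 he), zero_add, hcount]

theorem m2Rank_eq (l : Overpartition n) : l.m2Rank = (l.m2Level : ℤ) - l.m2Weight := by
  have hlevel : (l.m2Level : ℤ) = ((l.largestPart + 1) / 2 : ℕ) - l.chi := by
    rw [m2Level, chi]
    split_ifs with hx
    · obtain ⟨j, hj⟩ := hx.1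
      rw [Nat.cast_sub (by omega)]; simp
    · simp
  rw [m2Rank, hlevel, ← l.m2Weight_add_card]
  push_cast
  ring

theorem m2Level_le_iff (l : Overpartition n) (κ : ℕ) : l.m2Level ≤ κ ↔
    (∀ i ∈ l.overlined, i ≤ 2 * κ) ∧ ∀ i ∈ l.parts.toFinset \ l.overlined, i ≤ 2 * κ + 1 := by
  constructor
  · intro h
    rw [m2Level] at h
    have hparts : ∀ i ∈ l.parts, i ≤ 2 * κ + 1 := fun i hi => by
      have := l.le_largestPart hi
      split_ifs at h with hx
      · obtain ⟨j, hj⟩ := hx.1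
        omega
      · omega
    refine ⟨fun i hi => ?_, ((l.forall_mem_parts _).1 hparts).2⟩
    have h1 := l.le_largestPart (l.mem_parts_of_mem_overlined hi)
    split_ifs at h with hx
    · have h2 : i ≠ l.largestPart := fun e => hx.2 (e ▸ hi)
      obtain ⟨j, hj⟩ := hx.1
      omega
    · omega
  · rintro ⟨ho, hn⟩
    have h3 : l.largestPart ≤ 2 * κ + 1 := l.largestPart_le_iff.2 <|
      (l.forall_mem_parts _).2 ⟨fun i hi => (ho i hi).trans (Nat.le_succ _), hn⟩
    rw [m2Level]
    split_ifs with hx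
    · omega
    · rcases Nat.lt_or_ge (2 * κ) l.largestPart with h4 | h4
      · refine absurd ⟨⟨κ, by omega⟩, fun hmem => ?_⟩ hx
        have := ho _ hmem
        omega
      · omega

theorem m2Level_le (l : Overpartition n) : l.m2Level ≤ n := by
  have := l.largestPart_le
  rw [m2Level]
  omega

theorem m2Weight_le (l : Overpartition n) : l.m2Weight ≤ n := by
  have := l.m2Weight_add_card
  have := l.card_parts_le
  omega

end Overpartition

/-- The variable marking the occurrences of the part `i` in `m2RankGf`: only even parts are
counted with multiplicity by `Overpartition.m2Weight`. -/
noncomputable def m2Base (i : ℕ) : ℚ⟦X⟧ := if Even i then X else 1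

/-- The weight of the choice of overlining the part `i` in `m2RankGf`. -/
noncomputable def m2Coeff (κ i : ℕ) : ℚ⟦X⟧ :=
  if i ≤ 2 * κ then (if Even i then 2 else 1 + X) else if i = 2 * κ + 1 then 1 else 0

/-- The generating function of overpartitions of `Overpartition.m2Level` at most `κ`, by
`Overpartition.m2Weight`. -/
noncomputable def m2RankGf (κ : ℕ) : ℚ⟦X⟧⟦X⟧ :=
  Nat.Partition.genFun fun i c => m2Coeff κ i * m2Base i ^ c

theorem m2Base_odd (i : ℕ) : m2Base (2 * i + 1) = 1 := if_neg (by simp)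

theorem m2Base_even (i : ℕ) : m2Base (2 * i + 1 + 1) = X := if_pos (by simp [parity_simps])

theorem m2Coeff_odd {κ i : ℕ} (h : i < κ) : m2Coeff κ (2 * i + 1) = 1 + X := by
  rw [m2Coeff, if_pos (by omega), if_neg (by simp)]

theorem m2Coeff_even {κ i : ℕ} (h : i < κ) : m2Coeff κ (2 * i + 1 + 1) = 2 := by
  rw [m2Coeff, if_pos (by omega), if_pos (by simp [parity_simps])]

theorem m2Coeff_self (κ : ℕ) : m2Coeff κ (2 * κ + 1) = 1 := by
  rw [m2Coeff, if_neg (by omega), if_pos rfl]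

theorem m2Coeff_of_lt {κ i : ℕ} (h : 2 * κ + 1 < i) : m2Coeff κ i = 0 := by
  rw [m2Coeff, if_neg (by omega), if_neg (by omega)]

theorem m2Coeff_mul_m2Base_pow (κ i c : ℕ) : m2Coeff κ i * m2Base i ^ c =
    (if i ≤ 2 * κ then X ^ (if Even i then c else 1) else 0) +
      (if i ≤ 2 * κ + 1 then X ^ (if Even i then c else 0) else 0) := by
  rcases lt_trichotomy i (2 * κ + 1) with h | rfl | h
  · have hi : i ≤ 2 * κ := Nat.lt_succ_iff.1 h
    rw [m2Coeff, m2Base, if_pos hi, if_pos hi, if_pos h.le]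
    split_ifs <;> ring
  · rw [m2Coeff_self, m2Base_odd, if_neg (by omega), if_pos le_rfl, if_neg (by simp)]
    simp
  · rw [m2Coeff_of_lt h, if_neg (by omega), if_neg (by omega)]
    simp

theorem coeff_coeff_m2RankGf (κ k n : ℕ) : coeff k (coeff n (m2RankGf κ)) =
    ((Finset.univ.filter fun l : Overpartition n =>
      l.m2Level ≤ κ ∧ l.m2Weight = k).card : ℚ) := by
  simp only [m2RankGf, m2Coeff_mul_m2Base_pow, Overpartition.m2Level_le_iff]
  exact Overpartition.coeff_coeff_genFun_ite k n (fun i => i ≤ 2 * κ) (fun i => i ≤ 2 * κ + 1)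
    (fun i c => if Even i then c else 1) fun i c => if Even i then c else 0

theorem prod_range_two_mul {M : Type*} [CommMonoid M] (f : ℕ → M) (N : ℕ) :
    ∏ i ∈ Finset.range (2 * N), f i = ∏ i ∈ Finset.range N, f (2 * i) * f (2 * i + 1) := by
  induction N with
  | zero => simp
  | succ N ih =>
    rw [mul_add, mul_one, Finset.prod_range_succ, Finset.prod_range_succ, ih,
      Finset.prod_range_succ, mul_assoc]

theorem m2RankGf_mul_prod (κ : ℕ) :
    m2RankGf κ * (∏ i ∈ Finset.range κ, (1 - X ^ (2 * i + 1)) * (1 - C X * X ^ (2 * i + 2))) *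
      (1 - X ^ (2 * κ + 1)) =
      ∏ i ∈ Finset.range κ, (1 + C X * X ^ (2 * i + 1)) * (1 + C X * X ^ (2 * i + 2)) := by
  have hprod := genFun_mul_prod m2Base (m2Coeff κ) (2 * κ + 1) fun i hi =>
    m2Coeff_of_lt (Nat.lt_succ_of_le hi)
  rw [Finset.prod_range_succ, Finset.prod_range_succ, prod_range_two_mul, prod_range_two_mul,
    m2Coeff_self] at hprod
  simp only [m2Base_odd, m2Base_even, map_one, one_mul, sub_self, zero_mul, add_zero,
    mul_one] at hprod
  rw [mul_assoc]
  refine hprod.trans (Finset.prod_congr rfl fun i hi => ?_)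
  rw [m2Coeff_odd (Finset.mem_range.1 hi), m2Coeff_even (Finset.mem_range.1 hi), map_add, map_one,
    map_ofNat]
  ring

theorem mul_m2RankGf_succ (κ : ℕ) :
    (1 - C X * X ^ (2 * κ + 2)) * (1 - X ^ (2 * κ + 3)) * m2RankGf (κ + 1) =
      (1 + C X * X ^ (2 * κ + 1)) * (1 + C X * X ^ (2 * κ + 2)) * m2RankGf κ := by
  have h1 := m2RankGf_mul_prod κ
  have h2 := m2RankGf_mul_prod (κ + 1)
  rw [Finset.prod_range_succ, Finset.prod_range_succ, ← h1,
    show 2 * (κ + 1) + 1 = 2 * κ + 3 by ring] at h2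
  have hodd (i : ℕ) : (1 - X ^ (i + 1) : ℚ⟦X⟧⟦X⟧) ≠ 0 := by
    simpa using one_sub_C_mul_X_pow_ne_zero (1 : ℚ⟦X⟧) i
  have hprod : ∏ i ∈ Finset.range κ,
      ((1 - X ^ (2 * i + 1)) * (1 - C X * X ^ (2 * i + 2)) : ℚ⟦X⟧⟦X⟧) ≠ 0 :=
    Finset.prod_ne_zero_iff.2 fun i _ => mul_ne_zero (hodd _) (one_sub_C_mul_X_pow_ne_zero _ _)
  apply mul_left_cancel₀ hprod
  apply mul_left_cancel₀ (hodd (2 * κ))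
  linear_combination h2

theorem m2RankGf_zero : m2RankGf 0 * (1 - X) = 1 := by simpa using m2RankGf_mul_prod 0

/-- The generating functions `m2RankGf`, normalized to satisfy `RankSystem`. -/
noncomputable def m2System (κ : ℕ) : ℚ⟦X⟧⟦X⟧ :=
  C ((1 - X * (X ^ 2) ^ (κ + 1))⁻¹) * swapVars (m2RankGf κ)

theorem levelGf_m2System (κ : ℕ) :
    levelGf (X ^ 2) X m2System κ = swapVars (m2RankGf κ) := by
  rw [levelGf, m2System, ← mul_assoc, ← map_mul, PowerSeries.mul_inv_cancel _ (by simp), map_one,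
    one_mul]

theorem swapVars_m2RankGf_zero : swapVars (m2RankGf 0) = C (1 - X)⁻¹ := by
  have h := congrArg swapVars m2RankGf_zero
  rw [map_mul, map_sub, map_one, swapVars_X] at h
  have hinv : (1 - C X : ℚ⟦X⟧⟦X⟧) * C (1 - X)⁻¹ = 1 := by
    rw [← map_one C, ← map_sub, ← map_mul, PowerSeries.mul_inv_cancel _ (by simp)]
  linear_combination C (1 - X : ℚ⟦X⟧)⁻¹ * h - swapVars (m2RankGf 0) * hinv

theorem rankSystem_m2System : RankSystem (X ^ 2) X m2System where
  dvd := dvd_pow_self X two_ne_zero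
  zero := ⟨_, by rw [m2System, swapVars_m2RankGf_zero, ← map_mul]⟩
  succ κ := by
    have h0 := levelGf_m2System κ
    have h1 := levelGf_m2System (κ + 1)
    rw [levelGf] at h0 h1
    have h := congrArg swapVars (mul_m2RankGf_succ κ)
    simp only [map_mul, map_sub, map_add, map_one, map_pow, swapVars_X, swapVars_C_X] at h
    have hne : (C (1 - X * (X ^ 2) ^ (κ + 1)) : ℚ⟦X⟧⟦X⟧) ≠ 0 :=
      (map_ne_zero_iff _ C_injective).2 fun h0 => by simpa using congrArg constantCoeff h0
    rw [mul_assoc, h1]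
    apply mul_left_cancel₀ hne
    simp only [map_mul, map_sub, map_one, map_pow, ← pow_mul] at h0 ⊢
    linear_combination h - (1 + C X * C X ^ (2 * κ) * X) * (1 + C X ^ (2 * (κ + 1)) * X) * h0

/-! ### Rank moments -/

/-- The generating function of overpartitions. -/
noncomputable def overGf : ℚ⟦X⟧ := mk fun n => (Fintype.card (Overpartition n) : ℚ)

/-- The generating function of the power sums of a statistic on overpartitions. -/
noncomputable def statMoment (r : ∀ n, Overpartition n → ℤ) (e : ℕ) : ℚ⟦X⟧ :=
  mk fun n => ∑ l : Overpartition n, (r n l : ℚ) ^ e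

theorem RankSystem.coeff_rankLe {Q s : ℚ⟦X⟧} {ψ : ℕ → ℚ⟦X⟧⟦X⟧} (h : RankSystem Q s ψ)
    {level weight : ∀ n, Overpartition n → ℕ}
    (hcount : ∀ κ k n, coeff n (coeff k (levelGf Q s ψ κ)) =
      ((Finset.univ.filter fun l : Overpartition n =>
        level n l ≤ κ ∧ weight n l = k).card : ℚ))
    (m : ℤ) (n : ℕ) : coeff n (rankLe Q s ψ m) =
      ∑ l : Overpartition n, if (level n l : ℤ) - weight n l ≤ m then (1 : ℚ) else 0 := by
  have hcoeff (κ : ℕ) : coeff n (coeffZ (levelGf Q s ψ κ) (κ - m)) =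
      ∑ l : Overpartition n,
        if level n l ≤ κ ∧ (weight n l : ℤ) = κ - m then (1 : ℚ) else 0 := by
    rcases lt_or_ge ((κ : ℤ) - m) 0 with h0 | h0
    · rw [coeffZ_of_neg _ h0, map_zero, eq_comm]
      exact Finset.sum_eq_zero fun l _ => if_neg fun hl => by omega
    · obtain ⟨j, hj⟩ := Int.eq_ofNat_of_zero_le h0
      rw [hj, coeffZ_natCast, hcount, Finset.card_filter, Nat.cast_sum]
      simp
  rw [rankLe, (h.decay_coeffZ_levelGf m).coeff_tsum]
  simp only [hcoeff]
  rw [finsum_sum_comm]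
  · refine Finset.sum_congr rfl fun l _ => ?_
    rw [finsum_eq_single _ ((weight n l : ℤ) + m).toNat fun κ hκ => if_neg fun hl => hκ (by omega)]
    refine if_congr ?_ rfl rfl
    omega
  · intro l _
    refine (Set.finite_singleton ((weight n l : ℤ) + m).toNat).subset fun κ hκ => ?_
    by_contra h'
    exact hκ (if_neg fun hl => h' (by simp only [Set.mem_singleton_iff]; omega))

theorem sum_range_mul_ite_add_ite {A : Type*} [Semiring A] (w : ℕ → A) {a N : ℕ} (h : a ≤ N) :
    ∑ k ∈ Finset.range N, w k * ((if k + 1 < a then 1 else 0) + if k < a then 1 else 0) =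
      ∑ k ∈ Finset.range (a - 1), w k + ∑ k ∈ Finset.range a, w k := by
  simp only [mul_add, mul_ite, mul_one, mul_zero, Finset.sum_add_distrib, ← Finset.sum_filter]
  congr 2 <;> ext k <;> simp <;> omega

theorem sum_range_pred_add_sum_range_two (a : ℕ) :
    ∑ k ∈ Finset.range (a - 1), ((k + 1 : ℕ) : ℚ) + ∑ k ∈ Finset.range a, ((k + 1 : ℕ) : ℚ) =
      (a : ℚ) ^ 2 := by
  cases a with
  | zero => simp
  | succ b =>
    induction b with
    | zero => simp
    | succ b ih =>
      simp only [Nat.add_sub_cancel] at ih ⊢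
      rw [Finset.sum_range_succ, Finset.sum_range_succ _ (b + 1)]
      push_cast at ih ⊢
      linear_combination ih

theorem sum_range_pred_add_sum_range_four (a : ℕ) :
    ∑ k ∈ Finset.range (a - 1), (2 * ((k + 1 : ℕ) : ℚ) ^ 3 - ((k + 1 : ℕ) : ℚ)) +
        ∑ k ∈ Finset.range a, (2 * ((k + 1 : ℕ) : ℚ) ^ 3 - ((k + 1 : ℕ) : ℚ)) =
      (a : ℚ) ^ 4 := by
  cases a with
  | zero => simp
  | succ b =>
    induction b with
    | zero => norm_num
    | succ b ih =>
      simp only [Nat.add_sub_cancel] at ih ⊢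
      rw [Finset.sum_range_succ, Finset.sum_range_succ _ (b + 1)]
      push_cast at ih ⊢
      linear_combination ih

/-- `L m` is the generating function of the overpartitions for which the statistic `r`, bounded
in absolute value by the size, is at most `m`. -/
structure StatCounts (r : ∀ n, Overpartition n → ℤ) (L : ℤ → ℚ⟦X⟧) : Prop where
  coeff_eq : ∀ m n, coeff n (L m) = ∑ l : Overpartition n, if r n l ≤ m then (1 : ℚ) else 0
  le : ∀ n (l : Overpartition n), r n l ≤ n
  neg_le : ∀ n (l : Overpartition n), -(n : ℤ) ≤ r n l

namespace StatCounts

variable {r : ∀ n, Overpartition n → ℤ} {L : ℤ → ℚ⟦X⟧}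

theorem natAbs_le (h : StatCounts r L) {n : ℕ} (l : Overpartition n) : (r n l).natAbs ≤ n := by
  have := h.le n l
  have := h.neg_le n l
  omega

theorem xAdicTendsto_overGf (h : StatCounts r L) :
    XAdicTendsto (fun m : ℕ => L m) overGf := fun d => by
  filter_upwards [Filter.eventually_ge_atTop d] with m hm
  refine X_pow_dvd_iff.2 fun n hn => ?_
  rw [map_sub, h.coeff_eq, overGf, coeff_mk, sub_eq_zero, Finset.sum_congr rfl fun l _ =>
    if_pos (show r n l ≤ m by have := h.le n l; omega)]
  simp

theorem xAdicTendsto_zero (h : StatCounts r L) :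
    XAdicTendsto (fun m : ℕ => L (-m - 1)) 0 :=
  .of_X_pow_dvd fun m => X_pow_dvd_iff.2 fun n hn => by
    rw [h.coeff_eq]
    exact Finset.sum_eq_zero fun l _ => if_neg (by have := h.neg_le n l; omega)

theorem coeff_two_sided_tail (h : StatCounts r L) (k n : ℕ) :
    coeff n (2 * overGf - (L (k + 1) + L k) + (L (-k - 1) + L (-k - 2))) =
      ∑ l : Overpartition n,
        ((if k + 1 < (r n l).natAbs then 1 else 0) + if k < (r n l).natAbs then 1 else 0) := by
  have hcard : coeff n (2 * overGf) = ∑ _l : Overpartition n, (2 : ℚ) := by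
    rw [← map_ofNat C, coeff_C_mul, overGf, coeff_mk]; simp [mul_comm]
  simp only [map_add, map_sub, hcard, h.coeff_eq]
  simp only [← Finset.sum_add_distrib, ← Finset.sum_sub_distrib]
  refine Finset.sum_congr rfl fun l _ => ?_
  split_ifs <;> first | (exfalso; omega) | norm_num

theorem finsum_coeff_C_mul_two_sided_tail (h : StatCounts r L) {e : ℕ} (he : Even e) {w : ℕ → ℚ}
    (hw : ∀ a : ℕ, ∑ k ∈ Finset.range (a - 1), w k + ∑ k ∈ Finset.range a, w k = (a : ℚ) ^ e)
    (n : ℕ) :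
    ∑ᶠ k : ℕ, coeff n (C (w k) * (2 * overGf - (L (k + 1) + L k) + (L (-k - 1) + L (-k - 2)))) =
      ∑ l : Overpartition n, (r n l : ℚ) ^ e := by
  simp only [coeff_C_mul, h.coeff_two_sided_tail, Finset.mul_sum]
  rw [finsum_eq_sum_of_support_subset (s := Finset.range n), Finset.sum_comm]
  · refine Finset.sum_congr rfl fun l _ => ?_
    rw [sum_range_mul_ite_add_ite w (h.natAbs_le l), hw, ← he.pow_abs (r n l : ℚ), ← Int.cast_abs,
      Int.abs_eq_natAbs, Int.cast_natCast]
  · intro k hk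
    by_contra h'
    have hnk : n ≤ k := by simpa using h'
    refine hk (Finset.sum_eq_zero fun l _ => ?_)
    have := h.natAbs_le l
    rw [if_neg (by omega), if_neg (by omega), add_zero, mul_zero]

variable {s : ℕ}

/-- Abel summation: `a ^ e` is a sum of the weights `w k` over the `k` below `a`, that is, over the
two-sided tails of the statistic containing an overpartition with statistic `± a`. -/
theorem statMoment_eq (h : StatCounts r L) (hs : s ≠ 0)
    (htail : ∀ k : ℕ, 2 * overGf - (L (k + 1) + L k) + (L (-k - 1) + L (-k - 2)) =
      -(4 * overGf * partialTheta (s * (k + 1))))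
    {e : ℕ} (he : Even e) {w : ℕ → ℚ}
    (hw : ∀ a : ℕ, ∑ k ∈ Finset.range (a - 1), w k + ∑ k ∈ Finset.range a, w k = (a : ℚ) ^ e) :
    statMoment r e = -(4 * overGf * ∑' k : ℕ, C (w k) * partialTheta (s * (k + 1))) := by
  have hdecay : Decay fun k : ℕ => C (w k) * partialTheta (s * (k + 1)) :=
    (decay_partialTheta hs).mul_left _
  rw [neg_mul_eq_neg_mul, ← hdecay.tsum_mul_left]
  ext n
  rw [Decay.coeff_tsum (hdecay.mul_left _), statMoment, coeff_mk,
    ← h.finsum_coeff_C_mul_two_sided_tail he hw]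
  refine finsum_congr fun k => ?_
  rw [htail]
  congr 1
  ring

theorem statMoment_two (h : StatCounts r L) (hs : s ≠ 0)
    (htail : ∀ k : ℕ, 2 * overGf - (L (k + 1) + L k) + (L (-k - 1) + L (-k - 2)) =
      -(4 * overGf * partialTheta (s * (k + 1)))) :
    statMoment r 2 = -(4 * overGf * partialThetaMoment s 1) := by
  rw [h.statMoment_eq hs htail even_two sum_range_pred_add_sum_range_two, partialThetaMoment]
  simp

theorem statMoment_four (h : StatCounts r L) (hs : s ≠ 0)
    (htail : ∀ k : ℕ, 2 * overGf - (L (k + 1) + L k) + (L (-k - 1) + L (-k - 2)) =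
      -(4 * overGf * partialTheta (s * (k + 1)))) :
    statMoment r 4 = -(4 * overGf * (2 * partialThetaMoment s 3 - partialThetaMoment s 1)) := by
  have hdecay (i : ℕ) := (decay_partialTheta hs).mul_left fun k => ((k + 1 : ℕ) : ℚ⟦X⟧) ^ i
  have hweight : 2 * partialThetaMoment s 3 - partialThetaMoment s 1 = ∑' k : ℕ,
      C (2 * ((k + 1 : ℕ) : ℚ) ^ 3 - ((k + 1 : ℕ) : ℚ)) * partialTheta (s * (k + 1)) := by
    rw [partialThetaMoment, partialThetaMoment, ← (hdecay 3).tsum_mul_left,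
      ← ((hdecay 3).mul_left fun _ => 2).tsum_sub (hdecay 1)]
    refine tsum_congr fun k => ?_
    simp only [map_sub, map_mul, map_pow, map_natCast, map_ofNat]
    ring
  rw [h.statMoment_eq hs htail (by decide) sum_range_pred_add_sum_range_four, hweight]

end StatCounts

theorem statCounts_rank :
    StatCounts (fun _ l => l.rank) (rankLe X 0 fun κ => swapVars (rankGf κ)) where
  coeff_eq := rankSystem_rankGf.coeff_rankLe (level := fun _ l => l.largestPart)
    (weight := fun _ l => l.parts.card) fun κ k n => by
      rw [levelGf, zero_mul, sub_zero, map_one, one_mul, coeff_coeff_swapVars,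
        coeff_coeff_rankGf]
  le n l := by have := l.largestPart_le; rw [Overpartition.rank]; omega
  neg_le n l := by have := l.card_parts_le; rw [Overpartition.rank]; omega

theorem statCounts_m2Rank :
    StatCounts (fun _ l => l.m2Rank) (rankLe (X ^ 2) X m2System) where
  coeff_eq := by
    simp only [Overpartition.m2Rank_eq]
    exact rankSystem_m2System.coeff_rankLe (level := fun _ l => l.m2Level)
      (weight := fun _ l => l.m2Weight) fun κ k n => by
        rw [levelGf_m2System, coeff_coeff_swapVars, coeff_coeff_m2RankGf]
  le n l := by have := l.m2Level_le; rw [Overpartition.m2Rank_eq]; omega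
  neg_le n l := by have := l.m2Weight_le; rw [Overpartition.m2Rank_eq]; omega

theorem overGf_mul_thetaSeries : overGf * thetaSeries = 1 :=
  rankSystem_rankGf.mul_thetaSeries_eq_one (by rw [rankGf_zero, map_one])
    statCounts_rank.xAdicTendsto_overGf statCounts_rank.xAdicTendsto_zero

theorem rankLe_rankGf_tail (k : ℕ) :
    2 * overGf - (rankLe X 0 (fun κ => swapVars (rankGf κ)) (k + 1) +
        rankLe X 0 (fun κ => swapVars (rankGf κ)) k) +
      (rankLe X 0 (fun κ => swapVars (rankGf κ)) (-k - 1) +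
        rankLe X 0 (fun κ => swapVars (rankGf κ)) (-k - 2)) =
      -(4 * overGf * partialTheta (1 * (k + 1))) := by
  linear_combination rankSystem_rankGf.two_mul_sub_rankLe_X statCounts_rank.xAdicTendsto_overGf k +
    rankSystem_rankGf.rankLe_X_neg statCounts_rank.xAdicTendsto_overGf k

theorem rankLe_m2System_tail (k : ℕ) :
    2 * overGf - (rankLe (X ^ 2) X m2System (k + 1) + rankLe (X ^ 2) X m2System k) +
      (rankLe (X ^ 2) X m2System (-k - 1) + rankLe (X ^ 2) X m2System (-k - 2)) =
      -(4 * overGf * partialTheta (2 * (k + 1))) := by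
  linear_combination
    rankSystem_m2System.two_mul_sub_rankLe_X_sq statCounts_m2Rank.xAdicTendsto_overGf k +
      rankSystem_m2System.rankLe_X_sq_neg statCounts_m2Rank.xAdicTendsto_overGf k

theorem statMoment_rank_two :
    statMoment (fun _ l => l.rank) 2 = -(4 * overGf * partialThetaMoment 1 1) :=
  statCounts_rank.statMoment_two one_ne_zero rankLe_rankGf_tail

theorem statMoment_rank_four : statMoment (fun _ l => l.rank) 4 =
    -(4 * overGf * (2 * partialThetaMoment 1 3 - partialThetaMoment 1 1)) :=
  statCounts_rank.statMoment_four one_ne_zero rankLe_rankGf_tail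

theorem statMoment_m2Rank_two :
    statMoment (fun _ l => l.m2Rank) 2 = -(4 * overGf * partialThetaMoment 2 1) :=
  statCounts_m2Rank.statMoment_two two_ne_zero rankLe_m2System_tail

theorem statMoment_m2Rank_four : statMoment (fun _ l => l.m2Rank) 4 =
    -(4 * overGf * (2 * partialThetaMoment 2 3 - partialThetaMoment 2 1)) :=
  statCounts_m2Rank.statMoment_four two_ne_zero rankLe_m2System_tail

/-! ### The crank generating function of partitions -/

/-- The reciprocal of `(1 - q) ⋯ (1 - q^k)`, the generating function of the partitions into parts
at most `k`. -/
noncomputable def invPoch (k : ℕ) : ℚ⟦X⟧ := ∏ i ∈ Finset.range k, (1 - X ^ (i + 1))⁻¹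

theorem invPoch_zero : invPoch 0 = 1 := by simp [invPoch]

theorem one_sub_mul_invPoch_succ (k : ℕ) : (1 - X ^ (k + 1)) * invPoch (k + 1) = invPoch k := by
  rw [invPoch, Finset.prod_range_succ, ← invPoch, mul_left_comm,
    one_sub_X_pow_mul_inv k.succ_ne_zero, mul_one]

theorem one_sub_mul_invPoch_one : (1 - X) * invPoch 1 = 1 := by
  simpa [invPoch_zero] using one_sub_mul_invPoch_succ 0

/-- The sum `∑ q^(j (j + m + r)) / ((q)_j (q)_(j + m))`. For `r = 0` it runs over the Durfee
rectangles of side difference `m`, so that it is the generating function of all partitions; the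
parameter `r` records the shifts which occur for partitions with a bounded crank. -/
noncomputable def durfee (r m : ℕ) : ℚ⟦X⟧ :=
  ∑' j : ℕ, X ^ (j * (j + m + r)) * (invPoch j * invPoch (j + m))

theorem decay_durfee_term (r m : ℕ) (f : ℕ → ℚ⟦X⟧) :
    Decay fun j : ℕ => X ^ (j * (j + m + r)) * f j :=
  Decay.mul_right (Decay.of_dvd (fun j => j) (fun d => Set.finite_Iio d) fun j =>
    pow_dvd_pow X ((Nat.le_mul_self j).trans (Nat.mul_le_mul_left j (by omega)))) f

theorem durfee_sub (r m : ℕ) :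
    durfee r m - durfee (r + 1) m = X ^ (m + r + 1) * durfee (r + 1) (m + 1) := by
  rw [durfee, durfee, durfee, ← (decay_durfee_term r m _).tsum_sub (decay_durfee_term (r + 1) m _),
    ← (decay_durfee_term _ _ _).tsum_mul_left,
    ((decay_durfee_term r m _).sub (decay_durfee_term (r + 1) m _)).summable.tsum_eq_zero_add]
  simp only [zero_mul, pow_zero, sub_self, zero_add]
  refine tsum_congr fun j => ?_
  rw [show j + 1 + m = j + (m + 1) by ring, ← one_sub_mul_invPoch_succ j]
  ring

theorem durfee_succ (r m : ℕ) :
    durfee (r + 1) m = durfee r (m + 1) - X ^ (m + 1) * durfee (r + 1) (m + 1) := by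
  rw [durfee, durfee, durfee, ← (decay_durfee_term _ _ _).tsum_mul_left,
    ← (decay_durfee_term r (m + 1) _).tsum_sub ((decay_durfee_term (r + 1) (m + 1) _).mul_left _)]
  refine tsum_congr fun j => ?_
  rw [← one_sub_mul_invPoch_succ (j + m), show j + (m + 1) = j + m + 1 by ring]
  ring

theorem durfee_zero (m : ℕ) : durfee 0 m = durfee 0 0 := by
  induction m with
  | zero => rfl
  | succ m ih => rw [← ih]; linear_combination -durfee_sub 0 m - durfee_succ 0 m

theorem one_sub_mul_durfee_two (m : ℕ) :
    (1 - X) * durfee 2 m = durfee 1 m - X * durfee 1 (m + 1) := by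
  linear_combination -durfee_sub 1 m - X * durfee_succ 1 m

/-- The generating function of the partitions with crank at least `m`. For `m < 0` it is the
complement of the one of the partitions with crank at least `1 - m`, by symmetry of the crank. -/
noncomputable def crankTail (m : ℤ) : ℚ⟦X⟧ :=
  if 0 ≤ m then X ^ m.toNat * durfee 1 m.toNat
  else durfee 0 0 - X ^ (1 - m).toNat * durfee 1 (1 - m).toNat

theorem crankTail_natCast (m : ℕ) : crankTail m = X ^ m * durfee 1 m := by simp [crankTail]

theorem crankTail_eq (m : ℕ) : crankTail m = X ^ m * (durfee 0 0 - crankTail (m + 1)) := by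
  rw [← Nat.cast_add_one, crankTail_natCast, crankTail_natCast]
  have h := durfee_sub 0 m
  rw [durfee_zero] at h
  linear_combination -X ^ m * h

theorem crankTail_neg (m : ℕ) : crankTail (-m) = durfee 0 0 - crankTail (m + 1) := by
  cases m with
  | zero => simpa using crankTail_eq 0
  | succ m =>
    rw [crankTail, if_neg (by omega), ← Nat.cast_add_one, crankTail_natCast,
      show (1 - (-(m + 1 : ℕ)) : ℤ).toNat = m + 1 + 1 by omega]

/-- The generating function of the partitions with crank `m`, the partition `1` being counted with
weight `-1` for `m = 0` and weight `1` for `m = ±1`. -/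
noncomputable def crankGf (m : ℤ) : ℚ⟦X⟧ := (1 - X) * (X ^ m.natAbs * durfee 2 m.natAbs)

theorem crankGf_neg (m : ℤ) : crankGf (-m) = crankGf m := by simp [crankGf]

theorem decay_crankGf : Decay crankGf :=
  Decay.of_natAbs fun _ => (dvd_mul_right _ _).mul_left _

theorem crankGf_natCast (m : ℕ) : crankGf m = crankTail m - crankTail (m + 1) := by
  rw [← Nat.cast_add_one, crankTail_natCast, crankTail_natCast, crankGf, Int.natAbs_natCast]
  linear_combination X ^ m * one_sub_mul_durfee_two m

theorem crankGf_eq (m : ℤ) : crankGf m = crankTail m - crankTail (m + 1) := by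
  rcases lt_or_ge m 0 with h | h
  · obtain ⟨k, rfl⟩ : ∃ k : ℕ, m = -(k + 1 : ℕ) := ⟨(-m - 1).toNat, by omega⟩
    rw [crankGf_neg, crankGf_natCast, crankTail_neg,
      show (-(k + 1 : ℕ) + 1 : ℤ) = -k by push_cast; ring, crankTail_neg]
    push_cast
    ring
  · obtain ⟨k, rfl⟩ := Int.eq_ofNat_of_zero_le h
    exact crankGf_natCast k

theorem X_pow_mul_jacobiTerm_mul_crankTail {m : ℤ} {a b : ℕ} (h : (a : ℤ) = b + m - 1) (j : ℤ) :
    X ^ b * (jacobiTerm (m - j) * crankTail j) =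
      -(X ^ a * (durfee 0 0 * jacobiTerm (m - 1 - j) -
        jacobiTerm (m - (j + 1)) * crankTail (j + 1))) := by
  rw [show m - (j + 1) = m - 1 - j by ring]
  rcases lt_or_ge j 0 with hj | hj
  · obtain ⟨k, rfl⟩ : ∃ k : ℕ, j = -(k + 1 : ℕ) := ⟨(-j - 1).toNat, by omega⟩
    have htail := crankTail_eq (k + 1)
    have hjac := xpow_mul_jacobiTerm (n := (a + (k + 1) : ℕ)) (k := b) (m := m - 1 - -(k + 1 : ℕ))
      (by omega) (by omega) (by push_cast; omega)
    rw [xpow_natCast, xpow_natCast,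
      show m - 1 - -(k + 1 : ℕ) + 1 = m - -(k + 1 : ℕ) by ring] at hjac
    rw [show (-(k + 1 : ℕ) + 1 : ℤ) = -k by push_cast; ring, crankTail_neg k, crankTail_neg (k + 1)]
    push_cast at htail hjac ⊢
    rw [htail]
    linear_combination (durfee 0 0 - crankTail (k + 1 + 1)) * hjac
  · obtain ⟨k, rfl⟩ := Int.eq_ofNat_of_zero_le hj
    have hjac := xpow_mul_jacobiTerm (n := a) (k := (b + k : ℕ)) (m := m - 1 - k) (by omega)
      (by omega) (by push_cast; omega)
    rw [xpow_natCast, xpow_natCast, show m - 1 - k + 1 = m - k by ring] at hjac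
    rw [crankTail_eq k]
    linear_combination (durfee 0 0 - crankTail (k + 1)) * hjac

theorem conv_comp_add_one {R : Type*} [CommRing R] [TopologicalSpace R] (c o : ℤ → R⟦X⟧) (m : ℤ) :
    ∑' j, c (m - (j + 1)) * o (j + 1) = conv c o m :=
  (Equiv.addRight (1 : ℤ)).tsum_eq fun j => c (m - j) * o j

theorem Decay.conv_term_comp_add_one {R : Type*} [CommRing R] {c : ℤ → R⟦X⟧} (hc : Decay c)
    (o : ℤ → R⟦X⟧) (m : ℤ) : Decay fun j => c (m - (j + 1)) * o (j + 1) :=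
  (hc.conv_term m (o := o)).comp (e := fun j => j + 1) (add_left_injective 1)

theorem X_pow_mul_conv_jacobi_crankTail {m : ℤ} {a b : ℕ} (h : (a : ℤ) = b + m - 1) :
    X ^ b * conv jacobiTerm crankTail m = X ^ a * conv jacobiTerm crankTail m := by
  have hjac := decay_jacobiTerm.comp_sub_left (m - 1)
  have hconv := decay_jacobiTerm.conv_term_comp_add_one crankTail m
  calc X ^ b * conv jacobiTerm crankTail m
      = ∑' j, X ^ b * (jacobiTerm (m - j) * crankTail j) :=
        ((decay_jacobiTerm.conv_term m).tsum_mul_left _).symm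
    _ = ∑' j, -(X ^ a * (durfee 0 0 * jacobiTerm (m - 1 - j) -
          jacobiTerm (m - (j + 1)) * crankTail (j + 1))) :=
        tsum_congr (X_pow_mul_jacobiTerm_mul_crankTail h)
    _ = -(X ^ a * (durfee 0 0 * ∑' j, jacobiTerm (m - 1 - j) -
          conv jacobiTerm crankTail m)) := by
        rw [tsum_neg, ((hjac.mul_left _).sub hconv).tsum_mul_left, (hjac.mul_left _).tsum_sub hconv,
          conv_comp_add_one, hjac.tsum_mul_left]
    _ = X ^ a * conv jacobiTerm crankTail m := by rw [tsum_jacobiTerm_sub]; ring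

theorem conv_jacobi_crankTail {m : ℤ} (hm : m ≠ 1) : conv jacobiTerm crankTail m = 0 := by
  by_contra h0
  have hpow := mul_right_cancel₀ h0 (X_pow_mul_conv_jacobi_crankTail (m := m)
    (a := (m - 1).toNat) (b := (1 - m).toNat) (by omega))
  have hcoeff := congrArg (coeff (m - 1).toNat) hpow
  rw [coeff_X_pow, coeff_X_pow, if_pos rfl, if_neg (by omega)] at hcoeff
  exact zero_ne_one hcoeff

theorem conv_jacobi_crankGf_eq_sub (m : ℤ) : conv jacobiTerm crankGf m =
    conv jacobiTerm crankTail m - conv jacobiTerm crankTail (m + 1) := by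
  rw [← conv_comp_add_one _ _ (m + 1), conv, conv, ← (decay_jacobiTerm.conv_term m).tsum_sub
    (decay_jacobiTerm.conv_term_comp_add_one _ (m + 1))]
  refine tsum_congr fun j => ?_
  rw [crankGf_eq, show m + 1 - (j + 1) = m - j by ring]
  ring

theorem conv_jacobi_crankGf (m : ℤ) : conv jacobiTerm crankGf m =
    (if m = 1 then conv jacobiTerm crankTail 1 else 0) -
      if m = 0 then conv jacobiTerm crankTail 1 else 0 := by
  rw [conv_jacobi_crankGf_eq_sub]
  by_cases h1 : m = 1
  · rw [if_pos h1, if_neg (by omega), conv_jacobi_crankTail (m := m + 1) (by omega), h1]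
  · rw [if_neg h1, conv_jacobi_crankTail h1]
    by_cases h0 : m = 0
    · rw [if_pos h0, h0, zero_add]
    · rw [if_neg h0, conv_jacobi_crankTail (by omega)]

/-- The generating function of the `r`th crank moments of partitions. -/
noncomputable def crankGfMoment (r : ℕ) : ℚ⟦X⟧ := moment (fun n => n ^ r) crankGf

theorem crankGfMoment_odd {r : ℕ} (hr : Odd r) : crankGfMoment r = 0 :=
  moment_eq_zero_of_odd fun n => by rw [crankGf_neg, hr.neg_pow]; push_cast; ring

theorem moment_two_mul_crankGf (r : ℕ) :
    moment (fun n => (2 * n) ^ r) crankGf = 2 ^ r * crankGfMoment r := by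
  rw [moment_congr fun n => mul_pow 2 n r, moment_weight_const_mul decay_crankGf, crankGfMoment]
  push_cast; rfl

theorem moment_conv_jacobi_crankGf {r : ℕ} (hr : Odd r) :
    moment (fun n => (2 * n - 1) ^ r) (conv jacobiTerm crankGf) =
      2 * conv jacobiTerm crankTail 1 := by
  rw [moment, tsum_eq_sum (s := {0, 1}) fun n hn => ?_, Finset.sum_pair zero_ne_one,
    conv_jacobi_crankGf, conv_jacobi_crankGf]
  · simp [hr.neg_one_pow]; ring
  · simp only [Finset.mem_insert, Finset.mem_singleton, not_or] at hn
    rw [conv_jacobi_crankGf, if_neg hn.1, if_neg hn.2, sub_zero, mul_zero]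

theorem sum_choose_mul_jacobiMoment_mul_crankGfMoment {r : ℕ} (hr : Odd r) :
    ∑ i ∈ Finset.range (r + 1), (r.choose i : ℚ⟦X⟧) *
      (jacobiMoment i * (2 ^ (r - i) * crankGfMoment (r - i))) =
        2 * conv jacobiTerm crankTail 1 := by
  rw [← moment_conv_jacobi_crankGf hr, moment_conv decay_jacobiTerm decay_crankGf r
    (u := fun n => 2 * n - 1) (v := fun n => 2 * n) fun m j => by ring]
  simp only [moment_two_mul_crankGf, jacobiMoment]

theorem crankGfMoment_two : crankGfMoment 2 = 2 * lambert 1 * crankGfMoment 0 := by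
  have h1 := sum_choose_mul_jacobiMoment_mul_crankGfMoment odd_one
  have h3 := sum_choose_mul_jacobiMoment_mul_crankGfMoment (r := 3) (by decide)
  simp only [Finset.sum_range_succ, Finset.sum_range_zero, Nat.choose, Nat.reduceSub,
    Nat.reduceAdd, crankGfMoment_odd odd_one, crankGfMoment_odd (r := 3) (by decide), mul_zero]
    at h1 h3
  push_cast at h1 h3
  refine mul_left_cancel₀ jacobiMoment_one_ne_zero
    (mul_left_cancel₀ (a := (12 : ℚ⟦X⟧)) (by norm_num) ?_)
  linear_combination h3 - h1 - crankGfMoment 0 * jacobiMoment_three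

theorem crankGfMoment_four :
    crankGfMoment 4 = (2 * lambert 3 + 12 * lambert 1 ^ 2) * crankGfMoment 0 := by
  have h1 := sum_choose_mul_jacobiMoment_mul_crankGfMoment odd_one
  have h5 := sum_choose_mul_jacobiMoment_mul_crankGfMoment (r := 5) (by decide)
  simp only [Finset.sum_range_succ, Finset.sum_range_zero, Nat.choose, Nat.reduceSub,
    Nat.reduceAdd, crankGfMoment_odd odd_one, crankGfMoment_odd (r := 3) (by decide),
    crankGfMoment_odd (r := 5) (by decide), mul_zero] at h1 h5
  push_cast at h1 h5
  refine mul_left_cancel₀ jacobiMoment_one_ne_zero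
    (mul_left_cancel₀ (a := (80 : ℚ⟦X⟧)) (by norm_num) ?_)
  linear_combination h5 - h1 - crankGfMoment 0 * jacobiMoment_five -
    40 * jacobiMoment 3 * crankGfMoment_two -
    (40 * lambert 1) * crankGfMoment 0 * jacobiMoment_three

/-! ### Sums over multisets of parts -/

theorem Decay.fiber {R ι κ : Type*} [CommRing R] [DecidableEq κ] {f : ι → R⟦X⟧} (hf : Decay f)
    (t : ι → κ) : Decay (Function.uncurry fun i k => if t i = k then f i else 0) := fun d =>
  ((hf d).image fun i => (i, t i)).subset fun x hx => by
    by_cases h : t x.1 = x.2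
    · refine ⟨x.1, fun h' => hx ?_, Prod.ext rfl h⟩
      change X ^ d ∣ if t x.1 = x.2 then f x.1 else 0
      rwa [if_pos h]
    · refine absurd ?_ hx
      change X ^ d ∣ if t x.1 = x.2 then f x.1 else 0
      rw [if_neg h]
      exact dvd_zero _

theorem Decay.tsum_fiber {R ι κ : Type*} [CommRing R] [TopologicalSpace R] [T2Space R]
    [IsTopologicalRing R] [DecidableEq κ] {f : ι → R⟦X⟧} (hf : Decay f) (t : ι → κ) :
    ∑' i, f i = ∑' k, ∑' i, if t i = k then f i else 0 := by
  rw [← (hf.fiber t).tsum_comm]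
  refine tsum_congr fun i => ?_
  rw [tsum_eq_single (t i) fun k hk => if_neg hk.symm, if_pos rfl]

theorem finite_card_le_sum_lt (k d : ℕ) :
    {μ : Multiset ℕ | μ.card ≤ k ∧ μ.sum < d}.Finite := by
  refine (Set.finite_Iic (k • Multiset.range d)).subset fun μ hμ => ?_
  rw [Set.mem_Iic, Multiset.le_iff_count]
  intro a
  rw [Multiset.count_nsmul]
  by_cases ha : a ∈ μ
  · have hle : a ≤ μ.sum := Multiset.single_le_sum (fun _ _ => Nat.zero_le _) _ ha
    rw [Multiset.count_eq_one_of_mem (Multiset.nodup_range d)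
      (Multiset.mem_range.2 (hle.trans_lt hμ.2)), mul_one]
    exact (Multiset.count_le_card _ _).trans hμ.1
  · rw [Multiset.count_eq_zero_of_notMem ha]
    exact Nat.zero_le _

/-- The multisets of parts satisfying `p`, i.e. the partitions with such parts when `p 0` fails. -/
abbrev Parts (p : ℕ → Prop) := {μ : Multiset ℕ // ∀ x ∈ μ, p x}

theorem filter_add_eq_left {α : Type*} {p q : α → Prop} [DecidablePred p] (h : ∀ x, p x → ¬ q x)
    {μ ν : Multiset α} (hμ : ∀ x ∈ μ, p x) (hν : ∀ x ∈ ν, q x) : (μ + ν).filter p = μ := by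
  rw [Multiset.filter_add, Multiset.filter_eq_self.2 hμ,
    Multiset.filter_eq_nil.2 fun x hx hpx => h x hpx (hν x hx), add_zero]

open Classical in
/-- A multiset whose parts are of two disjoint kinds is a pair of multisets. -/
noncomputable def partsOrEquiv {p q s : ℕ → Prop} (h : ∀ x, p x → ¬ q x)
    (hs : ∀ x, s x ↔ p x ∨ q x) : Parts p × Parts q ≃ Parts s where
  toFun x :=
    ⟨x.1.1 + x.2.1, fun y hy => (hs y).2 <| (Multiset.mem_add.1 hy).imp (x.1.2 y) (x.2.2 y)⟩
  invFun μ := ⟨⟨μ.1.filter p, fun _ hx => (Multiset.mem_filter.1 hx).2⟩,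
    ⟨μ.1.filter q, fun _ hx => (Multiset.mem_filter.1 hx).2⟩⟩
  left_inv x := by
    refine Prod.ext (Subtype.ext (filter_add_eq_left h x.1.2 x.2.2)) (Subtype.ext ?_)
    change (x.1.1 + x.2.1).filter q = x.2.1
    rw [add_comm]
    exact filter_add_eq_left (fun y hq hp => h y hp hq) x.2.2 x.1.2
  right_inv μ := by
    refine Subtype.ext ?_
    change μ.1.filter p + μ.1.filter q = μ.1
    rw [Multiset.filter_congr (q := fun x => ¬ p x) fun x hx =>
      ⟨fun hq hp => h x hp hq, fun hp => ((hs x).1 (μ.2 x hx)).resolve_left hp⟩]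
    exact Multiset.filter_add_not _ _

/-- A multiset whose only part is `i` is determined by its cardinality. -/
def partsEqEquiv (i : ℕ) : ℕ ≃ Parts (fun x => x = i) where
  toFun c := ⟨Multiset.replicate c i, fun _ hx => Multiset.eq_of_mem_replicate hx⟩
  invFun μ := μ.1.card
  left_inv c := Multiset.card_replicate c i
  right_inv μ := Subtype.ext (Multiset.eq_replicate_card.2 μ.2).symm

section PartsSums

variable {R : Type*} [CommRing R] {p q s : ℕ → Prop}

theorem decay_parts (hp : ¬ p 0) : Decay fun μ : Parts p => (X : R⟦X⟧) ^ μ.1.sum := by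
  refine Decay.of_dvd (fun μ => μ.1.sum) (fun d => ?_) fun μ => dvd_rfl
  refine ((finite_card_le_sum_lt d d).preimage (f := fun μ : Parts p => μ.1)
    Subtype.val_injective.injOn).subset fun μ hμ => ⟨le_trans ?_ (le_of_lt hμ), hμ⟩
  simpa using Multiset.card_nsmul_le_sum (s := μ.1) (a := 1) fun x hx =>
    Nat.one_le_iff_ne_zero.2 fun h0 => hp (h0 ▸ μ.2 x hx)

variable [TopologicalSpace R]

theorem tsum_parts_or (h : ∀ x, p x → ¬ q x) (hs : ∀ x, s x ↔ p x ∨ q x)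
    (f : Multiset ℕ → R⟦X⟧) :
    ∑' μ : Parts s, f μ.1 = ∑' x : Parts p × Parts q, f (x.1.1 + x.2.1) :=
  ((partsOrEquiv h hs).tsum_eq fun μ => f μ.1).symm

theorem tsum_parts_or_mul [T2Space R] [IsTopologicalRing R] (hp : ¬ p 0) (hq : ¬ q 0)
    (h : ∀ x, p x → ¬ q x) (hs : ∀ x, s x ↔ p x ∨ q x) (f g g' : Multiset ℕ → R⟦X⟧)
    (hf : ∀ μ ν : Multiset ℕ, (∀ x ∈ μ, p x) → (∀ x ∈ ν, q x) → f (μ + ν) = g μ * g' ν) :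
    ∑' μ : Parts s, f μ.1 * X ^ μ.1.sum =
      (∑' μ : Parts p, g μ.1 * X ^ μ.1.sum) * ∑' μ : Parts q, g' μ.1 * X ^ μ.1.sum := by
  rw [tsum_parts_or h hs fun μ => f μ * X ^ μ.sum,
    ((decay_parts hp).mul_left fun μ => g μ.1).tsum_mul_tsum
      ((decay_parts hq).mul_left fun μ => g' μ.1)]
  refine tsum_congr fun x => ?_
  rw [hf _ _ x.1.2 x.2.2, Multiset.sum_add, pow_add]
  ring

end PartsSums

/-- The generating function of the multisets of parts satisfying `p`. -/
noncomputable def partsGf (p : ℕ → Prop) : ℚ⟦X⟧ := ∑' μ : Parts p, X ^ μ.1.sum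

theorem partsGf_or {p q s : ℕ → Prop} (hp : ¬ p 0) (hq : ¬ q 0) (h : ∀ x, p x → ¬ q x)
    (hs : ∀ x, s x ↔ p x ∨ q x) : partsGf s = partsGf p * partsGf q := by
  simpa [partsGf] using tsum_parts_or_mul (R := ℚ) hp hq h hs (fun _ => 1) (fun _ => 1)
    (fun _ => 1) fun _ _ _ _ => (one_mul 1).symm

theorem one_sub_mul_partsGf_eq (i : ℕ) : (1 - X ^ (i + 1)) * partsGf (fun x => x = i + 1) = 1 := by
  have hgeom : partsGf (fun x => x = i + 1) = ∑' c : ℕ, ((X : ℚ⟦X⟧) ^ (i + 1)) ^ c := by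
    rw [partsGf, ← (partsEqEquiv (i + 1)).tsum_eq]
    refine tsum_congr fun c => ?_
    rw [← pow_mul, mul_comm]
    simp [partsEqEquiv]
  rw [hgeom]
  exact WithPiTopology.one_sub_mul_tsum_pow_of_constantCoeff_eq_zero (by simp)

theorem partsGf_of_forall_not {p : ℕ → Prop} (h : ∀ x, ¬ p x) : partsGf p = 1 := by
  have hzero (μ : Parts p) : μ.1 = 0 :=
    Multiset.eq_zero_of_forall_notMem fun x hx => h x (μ.2 x hx)
  have : Unique (Parts p) := ⟨⟨⟨0, by simp⟩⟩, fun μ => Subtype.ext (hzero μ)⟩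
  simp [partsGf, hzero]

theorem partsGf_two_le (j : ℕ) :
    partsGf (fun x => 2 ≤ x ∧ x ≤ j + 1) = (1 - X) * invPoch (j + 1) := by
  induction j with
  | zero => rw [partsGf_of_forall_not fun x => by omega, zero_add, one_sub_mul_invPoch_one]
  | succ j ih =>
    rw [partsGf_or (p := fun x => 2 ≤ x ∧ x ≤ j + 1) (q := fun x => x = j + 1 + 1) (by omega)
      (by omega) (fun x hx => by omega) (fun x => by omega), ih, ← one_sub_mul_invPoch_succ (j + 1)]
    linear_combination (1 - X) * invPoch (j + 1 + 1) * one_sub_mul_partsGf_eq (j + 1)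

theorem sum_map_add_const (μ : Multiset ℕ) (c : ℕ) :
    (μ.map (· + c)).sum = μ.sum + μ.card * c := by
  rw [Multiset.sum_map_add]; simp

theorem map_add_map_sub_cancel {μ : Multiset ℕ} {c : ℕ} (h : ∀ x ∈ μ, c ≤ x) :
    (μ.map (· - c)).map (· + c) = μ := by
  rw [Multiset.map_map]
  exact (Multiset.map_congr rfl fun x hx => Nat.sub_add_cancel (h x hx)).trans (Multiset.map_id' μ)

/-- Subtracting `j + 1` from all parts turns multisets of integers greater than `j` into multisets
of natural numbers. -/
def shiftEquiv (j : ℕ) : Multiset ℕ ≃ Parts (fun x => j < x) where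
  toFun μ := ⟨μ.map (· + (j + 1)), fun x hx => by
    obtain ⟨y, _, rfl⟩ := Multiset.mem_map.1 hx
    omega⟩
  invFun μ := μ.1.map (· - (j + 1))
  left_inv μ := by simp [Multiset.map_map]
  right_inv μ := Subtype.ext (map_add_map_sub_cancel μ.2)

/-- The generating function of the multisets of `k` natural numbers, the number `0` being
allowed: partitions with at most `k` parts. -/
noncomputable def cardGf (k : ℕ) : ℚ⟦X⟧ :=
  ∑' μ : Multiset ℕ, if μ.card = k then X ^ μ.sum else 0

theorem decay_cardGf_term (k : ℕ) :
    Decay fun μ : Multiset ℕ => if μ.card = k then (X : ℚ⟦X⟧) ^ μ.sum else 0 := fun d =>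
  (finite_card_le_sum_lt k d).subset fun μ hμ => by
    change ¬ X ^ d ∣ if μ.card = k then X ^ μ.sum else 0 at hμ
    split_ifs at hμ with h
    · exact ⟨h.le, not_le.1 fun h' => hμ (pow_dvd_pow X h')⟩
    · exact absurd (dvd_zero _) hμ

theorem cardGf_zero : cardGf 0 = 1 := by
  rw [cardGf, tsum_eq_single 0 fun μ hμ => if_neg fun h => hμ (Multiset.card_eq_zero.1 h)]
  simp

theorem cardGf_eq_tsum_zero_mem (k : ℕ) : cardGf k = ∑' μ : Multiset ℕ,
    if 0 ∈ μ then (if μ.card = k + 1 then (X : ℚ⟦X⟧) ^ μ.sum else 0) else 0 := by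
  rw [← (show Function.Injective fun μ : Multiset ℕ => 0 ::ₘ μ from
    fun _ _ h => (Multiset.cons_inj_right 0).1 h).tsum_eq, cardGf]
  · exact tsum_congr fun μ => by simp
  · intro μ hμ
    by_cases h0 : 0 ∈ μ
    · exact ⟨μ.erase 0, Multiset.cons_erase h0⟩
    · exact absurd (if_neg h0) hμ

theorem X_pow_mul_cardGf_eq_tsum_zero_notMem (k : ℕ) : X ^ k * cardGf k = ∑' μ : Multiset ℕ,
    if 0 ∉ μ then (if μ.card = k then (X : ℚ⟦X⟧) ^ μ.sum else 0) else 0 := by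
  rw [← (Multiset.map_injective (add_left_injective 1)).tsum_eq]
  · rw [cardGf, ← (decay_cardGf_term k).tsum_mul_left]
    refine tsum_congr fun μ => ?_
    have h0 : 0 ∉ μ.map (· + 1) := by simp
    rw [if_pos h0, Multiset.card_map, sum_map_add_const]
    split_ifs with h
    · rw [h, mul_one, ← pow_add, add_comm]
    · rw [mul_zero]
  · intro μ hμ
    by_cases h0 : 0 ∈ μ
    · exact absurd (if_neg (not_not.2 h0)) hμ
    · exact ⟨μ.map (· - 1), map_add_map_sub_cancel fun x hx =>
        Nat.one_le_iff_ne_zero.2 fun h => h0 (h ▸ hx)⟩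

theorem cardGf_succ (k : ℕ) : cardGf (k + 1) = cardGf k + X ^ (k + 1) * cardGf (k + 1) := by
  have hd := decay_cardGf_term (k + 1)
  rw [X_pow_mul_cardGf_eq_tsum_zero_notMem, cardGf_eq_tsum_zero_mem k,
    ← (hd.ite _).tsum_add (hd.ite _), cardGf]
  exact tsum_congr fun μ => by by_cases h0 : 0 ∈ μ <;> simp [h0]

theorem cardGf_eq (k : ℕ) : cardGf k = invPoch k := by
  induction k with
  | zero => rw [cardGf_zero, invPoch_zero]
  | succ k ih =>
    refine mul_left_cancel₀ (one_sub_X_pow_ne_zero (k := k + 1) (by omega)) ?_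
    rw [one_sub_mul_invPoch_succ, ← ih]
    linear_combination cardGf_succ k

theorem tsum_parts_card (j : ℕ) (f : ℕ → ℚ⟦X⟧) :
    ∑' μ : Parts (fun x => j < x), f μ.1.card * X ^ μ.1.sum =
      ∑' k : ℕ, f k * (X ^ (k * (j + 1)) * invPoch k) := by
  have hd : Decay fun μ : Parts (fun x => j < x) => f μ.1.card * X ^ μ.1.sum :=
    (decay_parts (Nat.not_lt_zero j)).mul_left _
  rw [hd.tsum_fiber fun μ => μ.1.card]
  refine tsum_congr fun k => ?_
  rw [← (shiftEquiv j).tsum_eq, ← cardGf_eq, cardGf, ← (decay_cardGf_term k).tsum_mul_left,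
    ← ((decay_cardGf_term k).mul_left _).tsum_mul_left]
  refine tsum_congr fun μ => ?_
  change (if (μ.map (· + (j + 1))).card = k then
    f (μ.map (· + (j + 1))).card * X ^ (μ.map (· + (j + 1))).sum else 0) = _
  rw [Multiset.card_map, sum_map_add_const]
  split_ifs with h
  · rw [h, pow_add]; ring
  · simp

theorem tsum_filter_card (j : ℕ) (f : ℕ → ℚ⟦X⟧) :
    ∑' μ : Parts (fun x => 2 ≤ x), f (μ.1.filter (fun x => j + 1 < x)).card * X ^ μ.1.sum =
      (1 - X) * invPoch (j + 1) * ∑' k : ℕ, f k * (X ^ (k * (j + 1 + 1)) * invPoch k) := by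
  rw [← tsum_parts_card, ← partsGf_two_le]
  have h := tsum_parts_or_mul (s := fun x => 2 ≤ x) (p := fun x => 2 ≤ x ∧ x ≤ j + 1)
    (q := fun x => j + 1 < x) (by omega) (by omega) (fun x hx => by omega) (fun x => by omega)
    (fun μ => f (μ.filter (fun x => j + 1 < x)).card) (fun _ => 1) (fun ν => f ν.card)
    fun μ ν hμ hν => by
      rw [add_comm μ ν, filter_add_eq_left (q := fun x => 2 ≤ x ∧ x ≤ j + 1)
        (fun x hx => by omega) hν hμ, one_mul]
  simpa only [one_mul, partsGf] using h

theorem tsum_parts_sup_le (k : ℕ) :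
    ∑' μ : Parts (fun x => 2 ≤ x), (if μ.1.sup ≤ k then (X : ℚ⟦X⟧) ^ μ.1.sum else 0) =
      partsGf (fun x => 2 ≤ x ∧ x ≤ k) := by
  have hinj : Function.Injective fun μ : Parts (fun x => 2 ≤ x ∧ x ≤ k) =>
      (⟨μ.1, fun x hx => (μ.2 x hx).1⟩ : Parts (fun x => 2 ≤ x)) :=
    fun _ _ h => Subtype.ext (congrArg (fun x : Parts (fun x => 2 ≤ x) => x.1) h)
  rw [partsGf, ← hinj.tsum_eq]
  · exact tsum_congr fun μ => if_pos (Multiset.sup_le.2 fun x hx => (μ.2 x hx).2)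
  · intro μ hμ
    by_cases h : μ.1.sup ≤ k
    · exact ⟨⟨μ.1, fun x hx => ⟨μ.2 x hx, Multiset.sup_le.1 h x hx⟩⟩, rfl⟩
    · exact absurd (if_neg h) hμ

theorem tsum_parts_sup_eq_succ (k : ℕ) :
    ∑' μ : Parts (fun x => 2 ≤ x), (if μ.1.sup = k + 1 then (X : ℚ⟦X⟧) ^ μ.1.sum else 0) =
      partsGf (fun x => 2 ≤ x ∧ x ≤ k + 1) - partsGf (fun x => 2 ≤ x ∧ x ≤ k) := by
  have hd : Decay fun μ : Parts (fun x => 2 ≤ x) => (X : ℚ⟦X⟧) ^ μ.1.sum := decay_parts (by omega)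
  rw [← tsum_parts_sup_le, ← tsum_parts_sup_le, ← (hd.ite _).tsum_sub (hd.ite _)]
  refine tsum_congr fun μ => ?_
  rcases lt_trichotomy μ.1.sup (k + 1) with h | h | h
  · rw [if_neg (by omega), if_pos (by omega), if_pos (by omega), sub_self]
  · rw [if_pos (by omega), if_pos (by omega), if_neg (by omega), sub_zero]
  · rw [if_neg (by omega), if_neg (by omega), if_neg (by omega), sub_zero]

/-! ### Crank moments of partitions -/

/-- The contribution `∑ m ^ r` of a partition to the `r`th crank moment, with the modified weights
of the partition `1`. -/
noncomputable def crankWeight (r : ℕ) (μ : Multiset ℕ) : ℤ :=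
  ∑ᶠ m : ℤ, m ^ r * crankContribution μ m

theorem finite_support_crankContribution (r : ℕ) (μ : Multiset ℕ) :
    (Function.support fun m : ℤ => m ^ r * crankContribution μ m).Finite := by
  refine (Set.toFinite {-1, 0, 1, partitionCrank μ}).subset fun m hm => ?_
  by_contra h
  simp only [Set.mem_insert_iff, Set.mem_singleton_iff, not_or] at h
  refine hm ?_
  simp only [crankContribution]
  rw [if_neg h.2.1, if_neg (not_or.2 ⟨h.2.2.1, h.1⟩), if_neg (Ne.symm h.2.2.2)]
  simp

theorem crankWeight_of_ne (r : ℕ) {μ : Multiset ℕ} (h : μ ≠ {1}) :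
    crankWeight r μ = partitionCrank μ ^ r := by
  rw [crankWeight, finsum_eq_single _ (partitionCrank μ) fun m hm => ?_]
  · rw [crankContribution, if_neg h, if_pos rfl, mul_one]
  · rw [crankContribution, if_neg h, if_neg hm.symm, mul_zero]

theorem crankWeight_one {r : ℕ} (hr : Even r) : crankWeight r {1} = 2 - 0 ^ r := by
  rw [crankWeight, finsum_eq_sum_of_support_subset (s := {0, 1, -1})]
  · rw [Finset.sum_insert (by decide), Finset.sum_insert (by decide), Finset.sum_singleton]
    simp [crankContribution, hr.neg_one_pow]
    ring
  · intro m hm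
    by_contra h
    simp only [Finset.coe_insert, Finset.coe_singleton, Set.mem_insert_iff,
      Set.mem_singleton_iff, not_or] at h
    refine hm ?_
    change m ^ r * crankContribution {1} m = 0
    rw [crankContribution, if_pos rfl, if_neg h.1, if_neg (not_or.2 h.2), mul_zero]

theorem partitionCrank_replicate_add {j : ℕ} {μ : Multiset ℕ} (h : ∀ x ∈ μ, 2 ≤ x) :
    partitionCrank (Multiset.replicate (j + 1) 1 + μ) =
      ((μ.filter (fun x => j + 1 < x)).card : ℤ) - (j + 1 : ℕ) := by
  have hone : 1 ∉ μ := fun h' => by have := h 1 h'; omega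
  have hcount : (Multiset.replicate (j + 1) 1 + μ).count 1 = j + 1 := by
    rw [Multiset.count_add, Multiset.count_replicate_self, Multiset.count_eq_zero_of_notMem hone]
  rw [partitionCrank, if_pos (by simp), hcount, Multiset.filter_add, Multiset.filter_eq_nil.2,
    zero_add]
  intro x hx
  rw [Multiset.eq_of_mem_replicate hx]
  omega

theorem crankWeight_replicate_add {r : ℕ} (hr : Even r) {j : ℕ} {μ : Multiset ℕ}
    (h : ∀ x ∈ μ, 2 ≤ x) : crankWeight r (Multiset.replicate (j + 1) 1 + μ) =
      (((μ.filter (fun x => j + 1 < x)).card : ℤ) - (j + 1 : ℕ)) ^ r +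
        if μ = 0 then (if j = 0 then 1 - 0 ^ r else 0) else 0 := by
  by_cases hbase : μ = 0 ∧ j = 0
  · rw [hbase.1, hbase.2, if_pos rfl, if_pos rfl]
    simp only [zero_add, Multiset.replicate_one, add_zero, crankWeight_one hr]
    simp [hr.neg_one_pow]
    ring
  · rw [crankWeight_of_ne, partitionCrank_replicate_add h]
    · split_ifs with hμ hj
      · exact absurd ⟨hμ, hj⟩ hbase
      · rw [add_zero]
      · rw [add_zero]
    · intro hsingle
      apply hbase
      have hcard := congrArg Multiset.card hsingle
      rw [Multiset.card_add, Multiset.card_replicate, Multiset.card_singleton] at hcard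
      exact ⟨Multiset.card_eq_zero.1 (by omega), by omega⟩

/-- The generating function of the partitions with `j` ones and `k` parts greater than `j`, where
for `j = 0` the number `k` is the largest part. In these cells the crank is `k - j`, and the factor
`1 - q` spreads the partition `1` over the cells `(0, 0)`, `(0, 1)`, `(1, 0)` with the weights
`-1`, `1`, `1`. -/
noncomputable def onesGf (j k : ℕ) : ℚ⟦X⟧ :=
  (1 - X) * (X ^ (j + k * (j + 1)) * (invPoch j * invPoch k))

theorem decay_onesGf : Decay fun x : ℕ × ℕ => onesGf x.1 x.2 := by
  refine Decay.of_dvd (fun x => x.1 + x.2) (fun d => ?_) fun x => ?_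
  · refine ((Set.finite_Iio d).prod (Set.finite_Iio d)).subset fun x hx => ?_
    simp only [Set.mem_ofPred_eq] at hx
    exact ⟨by simp only [Set.mem_Iio]; omega, by simp only [Set.mem_Iio]; omega⟩
  · exact ((pow_dvd_pow X (by nlinarith)).mul_right _).mul_left _

theorem decay_pow_mul_onesGf (r : ℕ) :
    Decay fun x : ℕ × ℕ => (((x.2 - x.1 : ℤ) ^ r : ℤ) : ℚ⟦X⟧) * onesGf x.1 x.2 :=
  decay_onesGf.mul_left _

/-- A pair of natural numbers is given by its difference and its minimum. -/
def diffMinEquiv : ℕ × ℕ ≃ ℤ × ℕ where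
  toFun x := (x.2 - x.1, min x.1 x.2)
  invFun y := (y.2 + (-y.1).toNat, y.2 + y.1.toNat)
  left_inv x := by ext <;> simp only <;> omega
  right_inv y := by ext <;> simp only <;> omega

theorem onesGf_diffMinEquiv_symm (m : ℤ) (i : ℕ) :
    onesGf (diffMinEquiv.symm (m, i)).1 (diffMinEquiv.symm (m, i)).2 = (1 - X) *
      (X ^ m.natAbs * (X ^ (i * (i + m.natAbs + 2)) * (invPoch i * invPoch (i + m.natAbs)))) := by
  change onesGf (i + (-m).toNat) (i + m.toNat) = _
  rw [onesGf]
  rcases le_total 0 m with h | h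
  · rw [show (-m).toNat = 0 by omega, show m.toNat = m.natAbs by omega, add_zero]
    ring
  · rw [show m.toNat = 0 by omega, show (-m).toNat = m.natAbs by omega, add_zero]
    ring

theorem tsum_pow_mul_onesGf_diffMinEquiv_symm (r : ℕ) (m : ℤ) :
    ∑' i : ℕ, ((((diffMinEquiv.symm (m, i)).2 - (diffMinEquiv.symm (m, i)).1 : ℤ) ^ r : ℤ) :
      ℚ⟦X⟧) * onesGf (diffMinEquiv.symm (m, i)).1 (diffMinEquiv.symm (m, i)).2 =
        ((m ^ r : ℤ) : ℚ⟦X⟧) * crankGf m := by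
  have hd := decay_durfee_term 2 m.natAbs fun i => invPoch i * invPoch (i + m.natAbs)
  rw [crankGf, durfee, ← hd.tsum_mul_left, ← (hd.mul_left _).tsum_mul_left,
    ← ((hd.mul_left _).mul_left _).tsum_mul_left]
  refine tsum_congr fun i => ?_
  rw [onesGf_diffMinEquiv_symm]
  congr 3
  change ((i + m.toNat : ℕ) : ℤ) - ((i + (-m).toNat : ℕ) : ℤ) = m
  omega

theorem tsum_pow_mul_onesGf (r : ℕ) :
    ∑' j : ℕ, ∑' k : ℕ, (((k - j : ℤ) ^ r : ℤ) : ℚ⟦X⟧) * onesGf j k = crankGfMoment r := by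
  have hd := (decay_pow_mul_onesGf r).comp diffMinEquiv.symm.injective
  rw [← (decay_pow_mul_onesGf r).tsum_prod, ← diffMinEquiv.symm.tsum_eq, hd.tsum_prod,
    crankGfMoment, moment]
  exact tsum_congr (tsum_pow_mul_onesGf_diffMinEquiv_symm r)

theorem tsum_parts_sup_eq (k : ℕ) :
    ∑' μ : Parts (fun x => 2 ≤ x), (if μ.1.sup = k then (X : ℚ⟦X⟧) ^ μ.1.sum else 0) =
      onesGf 0 k + (if k = 0 then X else 0) - if k = 1 then X else 0 := by
  have h0 : partsGf (fun x => 2 ≤ x ∧ x ≤ 0) = 1 := partsGf_of_forall_not fun x => by omega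
  have h1 : partsGf (fun x => 2 ≤ x ∧ x ≤ 1) = 1 := partsGf_of_forall_not fun x => by omega
  rcases k with - | - | k
  · rw [tsum_congr fun μ : Parts (fun x => 2 ≤ x) => if_congr (Nat.le_zero (i := μ.1.sup)).symm
      rfl rfl, tsum_parts_sup_le, h0, onesGf, invPoch_zero]
    simp
  · rw [tsum_parts_sup_eq_succ, zero_add, h0, h1, onesGf, invPoch_zero, if_neg one_ne_zero,
      if_pos rfl]
    linear_combination -X * one_sub_mul_invPoch_one
  · rw [tsum_parts_sup_eq_succ, if_neg (by omega), if_neg (by omega), partsGf_two_le,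
      partsGf_two_le, onesGf, invPoch_zero, ← one_sub_mul_invPoch_succ (k + 1)]
    ring

theorem crankWeight_of_two_le (r : ℕ) {μ : Multiset ℕ} (h : ∀ x ∈ μ, 2 ≤ x) :
    crankWeight r μ = (μ.sup : ℤ) ^ r := by
  have hone : 1 ∉ μ := fun h' => by have := h 1 h'; omega
  rw [crankWeight_of_ne r fun h' => hone (by rw [h']; simp), partitionCrank, if_neg hone]

theorem tsum_sup_pow_parts_sup_eq (r k : ℕ) :
    ∑' μ : Parts (fun x => 2 ≤ x),
      (if μ.1.sup = k then (((μ.1.sup : ℤ) ^ r : ℤ) : ℚ⟦X⟧) * X ^ μ.1.sum else 0) =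
        (((k : ℤ) ^ r : ℤ) : ℚ⟦X⟧) * onesGf 0 k +
          ((if k = 0 then 0 ^ r * X else 0) - if k = 1 then X else 0) := by
  have hd : Decay fun μ : Parts (fun x => 2 ≤ x) => (X : ℚ⟦X⟧) ^ μ.1.sum := decay_parts (by omega)
  rw [tsum_congr fun μ : Parts (fun x => 2 ≤ x) => show _ = (((k : ℤ) ^ r : ℤ) : ℚ⟦X⟧) *
    (if μ.1.sup = k then X ^ μ.1.sum else 0) by split_ifs with h <;> simp [h],
    (hd.ite _).tsum_mul_left, tsum_parts_sup_eq]
  rcases k with - | - | k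
  · simp; ring
  · simp; ring
  · rw [if_neg (by omega), if_neg (by omega), if_neg (by omega)]; ring

theorem tsum_crankWeight_zero (r : ℕ) :
    ∑' μ : Parts (fun x => 2 ≤ x), (crankWeight r μ.1 : ℚ⟦X⟧) * X ^ μ.1.sum =
      ∑' k : ℕ, ((k : ℤ) ^ r : ℤ) * onesGf 0 k - (1 - 0 ^ r) * X := by
  have hd : Decay fun μ : Parts (fun x => 2 ≤ x) => (X : ℚ⟦X⟧) ^ μ.1.sum := decay_parts (by omega)
  have hones : Decay fun k : ℕ => (((k : ℤ) ^ r : ℤ) : ℚ⟦X⟧) * onesGf 0 k :=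
    (decay_onesGf.comp (e := fun k => (0, k)) fun _ _ h => (Prod.ext_iff.1 h).2).mul_left _
  have hsup : ∀ μ : Parts (fun x => 2 ≤ x), (crankWeight r μ.1 : ℚ⟦X⟧) * X ^ μ.1.sum =
      (((μ.1.sup : ℤ) ^ r : ℤ) : ℚ⟦X⟧) * X ^ μ.1.sum := fun μ => by
    rw [crankWeight_of_two_le r μ.2]
  rw [tsum_congr hsup, (hd.mul_left _).tsum_fiber fun μ => μ.1.sup,
    tsum_congr (tsum_sup_pow_parts_sup_eq r),
    hones.tsum_add ((Decay.ite_eq _ _).sub (Decay.ite_eq _ _)),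
    (Decay.ite_eq _ _).tsum_sub (Decay.ite_eq _ _), tsum_ite_eq, tsum_ite_eq]
  ring

theorem tsum_crankWeight_succ {r : ℕ} (hr : Even r) (j : ℕ) :
    X ^ (j + 1) * ∑' μ : Parts (fun x => 2 ≤ x),
      (crankWeight r (Multiset.replicate (j + 1) 1 + μ.1) : ℚ⟦X⟧) * X ^ μ.1.sum =
      ∑' k : ℕ, (((k - (j + 1 : ℕ) : ℤ) ^ r : ℤ) : ℚ⟦X⟧) * onesGf (j + 1) k +
        if j = 0 then (1 - 0 ^ r) * X else 0 := by
  have hd : Decay fun μ : Parts (fun x => 2 ≤ x) => (X : ℚ⟦X⟧) ^ μ.1.sum := decay_parts (by omega)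
  have hweight : ∀ μ : Parts (fun x => 2 ≤ x),
      (crankWeight r (Multiset.replicate (j + 1) 1 + μ.1) : ℚ⟦X⟧) * X ^ μ.1.sum =
      (((((μ.1.filter (fun x => j + 1 < x)).card : ℤ) - (j + 1 : ℕ)) ^ r : ℤ) : ℚ⟦X⟧) *
        X ^ μ.1.sum +
        if μ = ⟨0, by simp⟩ then (if j = 0 then 1 - 0 ^ r else 0) else 0 := fun μ => by
    rw [crankWeight_replicate_add hr μ.2]
    by_cases h : μ = ⟨0, by simp⟩
    · rw [if_pos h, h, if_pos rfl]
      split_ifs <;> simp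
    · rw [if_neg h, if_neg fun h' => h (Subtype.ext h')]
      simp
  have hcard : Decay fun k : ℕ => X ^ (k * (j + 1 + 1)) * invPoch k :=
    (Decay.of_dvd (fun k => k) (fun d => Set.finite_Iio d) fun k =>
      pow_dvd_pow X (Nat.le_mul_of_pos_right k (by omega))).mul_right _
  rw [tsum_congr hweight, (hd.mul_left _).tsum_add (Decay.ite_eq _ _), tsum_ite_eq,
    tsum_filter_card j fun k => ((((k : ℤ) - (j + 1 : ℕ)) ^ r : ℤ) : ℚ⟦X⟧), mul_add, ← mul_assoc,
    ← (hcard.mul_left _).tsum_mul_left]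
  congr 1
  · exact tsum_congr fun k => by rw [onesGf]; ring
  · split_ifs with h
    · rw [h]; ring
    · rw [mul_zero]

/-- The generating function of the crank moments of partitions, computed directly from the
cranks. -/
noncomputable def crankSum (r : ℕ) : ℚ⟦X⟧ :=
  ∑' μ : Parts (fun x => x ≠ 0), (crankWeight r μ.1 : ℚ⟦X⟧) * X ^ μ.1.sum

theorem crankSum_eq_tsum_replicate (r : ℕ) :
    crankSum r = ∑' j : ℕ, X ^ j * ∑' μ : Parts (fun x => 2 ≤ x),
      (crankWeight r (Multiset.replicate j 1 + μ.1) : ℚ⟦X⟧) * X ^ μ.1.sum := by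
  have hpow : Decay fun j : ℕ => (X : ℚ⟦X⟧) ^ j :=
    Decay.of_dvd id (fun d => Set.finite_Iio d) fun _ => dvd_rfl
  have hparts : Decay fun μ : Parts (fun x => 2 ≤ x) => (X : ℚ⟦X⟧) ^ μ.1.sum :=
    decay_parts (by omega)
  have hd := (hpow.prod hparts).mul_left fun x =>
    (crankWeight r (Multiset.replicate x.1 1 + x.2.1) : ℚ⟦X⟧)
  calc crankSum r
      = ∑' x : ℕ × Parts (fun x => 2 ≤ x),
          (crankWeight r (Multiset.replicate x.1 1 + x.2.1) : ℚ⟦X⟧) *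
            (X ^ x.1 * X ^ x.2.1.sum) := by
        rw [crankSum, tsum_parts_or (p := fun x => x = 1) (q := fun x => 2 ≤ x)
          (fun x hx => by omega) (fun x => by omega)
          fun μ => (crankWeight r μ : ℚ⟦X⟧) * X ^ μ.sum,
          ← ((partsEqEquiv 1).prodCongr (Equiv.refl _)).tsum_eq]
        refine tsum_congr fun x => ?_
        rw [← pow_add]
        simp [partsEqEquiv]
    _ = _ := hd.tsum_prod
    _ = _ := tsum_congr fun j => by
        rw [← (hparts.mul_left _).tsum_mul_left]
        exact tsum_congr fun μ => by ring

theorem crankSum_eq {r : ℕ} (hr : Even r) : crankSum r = crankGfMoment r := by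
  have hcell : ∀ j : ℕ, X ^ j * ∑' μ : Parts (fun x => 2 ≤ x),
      (crankWeight r (Multiset.replicate j 1 + μ.1) : ℚ⟦X⟧) * X ^ μ.1.sum =
      ∑' k : ℕ, (((k - j : ℤ) ^ r : ℤ) : ℚ⟦X⟧) * onesGf j k +
      ((if j = 1 then (1 - 0 ^ r) * X else 0) - if j = 0 then (1 - 0 ^ r) * X else 0) := by
    intro j
    cases j with
    | zero =>
      simp only [Multiset.replicate_zero, zero_add, pow_zero, one_mul, tsum_crankWeight_zero r]
      simp [sub_eq_add_neg]
    | succ j =>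
      rw [tsum_crankWeight_succ hr]
      simp
  rw [crankSum_eq_tsum_replicate, tsum_congr hcell,
    (decay_pow_mul_onesGf r).tsum_fst.tsum_add ((Decay.ite_eq _ _).sub (Decay.ite_eq _ _)),
    (Decay.ite_eq _ _).tsum_sub (Decay.ite_eq _ _), tsum_ite_eq, tsum_ite_eq, sub_self, add_zero]
  exact tsum_pow_mul_onesGf r

/-! ### Residual crank moments -/

theorem decay_sigma {R : Type*} [CommRing R] {ι : ℕ → Type*} [∀ n, Finite (ι n)]
    (w : ∀ n, ι n → R) : Decay fun x : Σ n, ι n => C (w x.1 x.2) * X ^ x.1 :=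
  .of_dvd Sigma.fst
    (fun d => ((Set.finite_lt_nat d).biUnion fun n _ => Set.finite_range (Sigma.mk n)).subset
      fun x hx => Set.mem_biUnion hx ⟨x.2, rfl⟩)
    fun _ => dvd_mul_left _ _

theorem mk_sum_eq_tsum_sigma {R : Type*} [CommRing R] [TopologicalSpace R] [T2Space R]
    {ι : ℕ → Type*} [∀ n, Fintype (ι n)] (w : ∀ n, ι n → R) :
    (mk fun n => ∑ i, w n i) = ∑' x : Σ n, ι n, C (w x.1 x.2) * X ^ x.1 := by
  ext n
  rw [coeff_mk, (decay_sigma w).coeff_tsum, finsum_eq_sum_of_support_subset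
    (s := Finset.univ.map (Function.Embedding.sigmaMk n)), Finset.sum_map]
  · refine Finset.sum_congr rfl fun i _ => ?_
    rw [Function.Embedding.sigmaMk_apply, coeff_C_mul, coeff_X_pow, if_pos rfl, mul_one]
  · rintro ⟨m, i⟩ hx
    obtain rfl : n = m := by
      by_contra h
      exact hx (by simp only [coeff_C_mul, coeff_X_pow, if_neg h, mul_zero])
    simp

namespace Overpartition

variable {n : ℕ}

theorem ne_zero_of_mem_parts (l : Overpartition n) {x : ℕ} (hx : x ∈ l.parts) : x ≠ 0 :=
  Nat.ne_zero_of_lt (l.toPartition.parts_pos hx)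

/-- The overlined parts, which form a finite set, and the non-overlined parts of an
overpartition. -/
def split (x : Σ n, Overpartition n) : {s : Finset ℕ // 0 ∉ s} × Parts (fun x => x ≠ 0) :=
  (⟨x.2.overlined, fun h => x.2.ne_zero_of_mem_parts (x.2.mem_parts_of_mem_overlined h) rfl⟩,
    ⟨x.2.nonOverlined, fun _ hy => x.2.ne_zero_of_mem_parts
      (Multiset.mem_of_le (Multiset.sub_le_self _ _) hy)⟩)

theorem fst_eq_sum_split (x : Σ n, Overpartition n) :
    x.1 = (split x).1.1.val.sum + (split x).2.1.sum := by
  rw [← Multiset.sum_add]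
  exact ((congrArg Multiset.sum x.2.overlined_add_nonOverlined).trans
    x.2.toPartition.parts_sum).symm

theorem split_injective : Function.Injective split := by
  intro x y h
  have hover : x.2.overlined = y.2.overlined := congrArg (fun z => z.1.1) h
  have hnon : x.2.nonOverlined = y.2.nonOverlined := congrArg (fun z => z.2.1) h
  have hsize : x.1 = y.1 := by rw [fst_eq_sum_split x, fst_eq_sum_split y, h]
  obtain ⟨n, l⟩ := x
  obtain ⟨n', l'⟩ := y
  obtain rfl : n = n' := hsize
  have hparts : l.parts = l'.parts := by
    rw [← l.overlined_add_nonOverlined, ← l'.overlined_add_nonOverlined]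
    exact congrArg₂ (fun a b => a.val + b) hover hnon
  exact congrArg (Sigma.mk n) (Overpartition.ext (Nat.Partition.ext hparts) hover)

theorem split_surjective : Function.Surjective split := by
  rintro ⟨⟨s, hs⟩, ⟨μ, hμ⟩⟩
  refine ⟨⟨(s.val + μ).sum, ⟨⟨s.val + μ, fun {x} hx => ?_, rfl⟩, s, fun x hx => ?_⟩⟩, ?_⟩
  · rcases Multiset.mem_add.1 hx with h | h
    · exact Nat.pos_of_ne_zero fun h0 => hs (h0 ▸ h)
    · exact Nat.pos_of_ne_zero (hμ x h)
  · exact Multiset.mem_toFinset.2 (Multiset.mem_add.2 (Or.inl hx))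
  · exact Prod.ext rfl (Subtype.ext (add_tsub_cancel_left s.val μ))

theorem split_bijective : Function.Bijective split := ⟨split_injective, split_surjective⟩

end Overpartition

/-- The generating function of finite sets of positive integers. -/
noncomputable def distinctGf : ℚ⟦X⟧ := ∑' s : {s : Finset ℕ // 0 ∉ s}, X ^ s.1.val.sum

theorem decay_distinct : Decay fun s : {s : Finset ℕ // 0 ∉ s} => (X : ℚ⟦X⟧) ^ s.1.val.sum :=
  (decay_parts (p := fun x => x ≠ 0) (by simp)).comp
    (e := fun s : {s : Finset ℕ // 0 ∉ s} => ⟨s.1.val, fun _ hx h0 => s.2 (h0 ▸ hx)⟩)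
    fun _ _ h => Subtype.ext (Finset.val_injective (congrArg Subtype.val h))

theorem mk_sum_nonOverlined (f : Multiset ℕ → ℤ) :
    (mk fun n => ∑ l : Overpartition n, (f l.nonOverlined : ℚ)) =
      distinctGf * ∑' μ : Parts (fun x => x ≠ 0), (f μ.1 : ℚ⟦X⟧) * X ^ μ.1.sum := by
  rw [distinctGf, decay_distinct.tsum_mul_tsum
      ((decay_parts (by simp)).mul_left fun μ => (f μ.1 : ℚ⟦X⟧)),
    ← (Equiv.ofBijective _ Overpartition.split_bijective).tsum_eq, mk_sum_eq_tsum_sigma]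
  refine tsum_congr fun x => ?_
  rw [Equiv.ofBijective_apply, map_intCast, mul_left_comm, ← pow_add,
    ← Overpartition.fst_eq_sum_split]
  rfl

theorem crankWeight_zero (μ : Multiset ℕ) : crankWeight 0 μ = 1 := by
  by_cases h : μ = {1}
  · rw [h, crankWeight_one (by decide)]; norm_num
  · rw [crankWeight_of_ne 0 h, pow_zero]

theorem mk_sum_crankWeight (r : ℕ) :
    (mk fun n => ∑ l : Overpartition n, (crankWeight r l.nonOverlined : ℚ)) =
      distinctGf * crankSum r := mk_sum_nonOverlined _

theorem overGf_eq : overGf = distinctGf * crankSum 0 := by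
  simp [← mk_sum_crankWeight, overGf, crankWeight_zero]

/-- Doubling all parts identifies the partitions with the partitions into even parts. -/
def doubleEquiv : Parts (fun x => x ≠ 0) ≃ Parts (fun x => Even x ∧ x ≠ 0) where
  toFun μ := ⟨μ.1.map (2 * ·), fun x hx => by
    obtain ⟨y, hy, rfl⟩ := Multiset.mem_map.1 hx
    exact ⟨even_two_mul y, mul_ne_zero two_ne_zero (μ.2 y hy)⟩⟩
  invFun μ := ⟨μ.1.map (· / 2), fun x hx => by
    obtain ⟨y, hy, rfl⟩ := Multiset.mem_map.1 hx
    obtain ⟨⟨z, hz⟩, h0⟩ := μ.2 y hy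
    omega⟩
  left_inv μ := Subtype.ext <| by simp [Multiset.map_map]
  right_inv μ := Subtype.ext <| by
    refine (Multiset.map_map _ _ _).trans ((Multiset.map_congr rfl fun x hx => ?_).trans
      (Multiset.map_id μ.1))
    exact Nat.two_mul_div_two_of_even (μ.2 x hx).1

theorem tsum_crankWeight_map_half (r : ℕ) :
    ∑' μ : Parts (fun x => Even x ∧ x ≠ 0), (crankWeight r (μ.1.map (· / 2)) : ℚ⟦X⟧) *
      X ^ μ.1.sum = expand 2 two_ne_zero (crankSum r) := by
  rw [crankSum, ((decay_parts (by simp)).mul_left _).expand_tsum, ← doubleEquiv.tsum_eq]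
  refine tsum_congr fun μ => ?_
  have hhalf : (doubleEquiv μ).1.map (· / 2) = μ.1 :=
    congrArg Subtype.val (doubleEquiv.left_inv μ)
  have hsum : (doubleEquiv μ).1.sum = 2 * μ.1.sum :=
    Multiset.sum_map_mul_left.trans (by rw [Multiset.map_id'])
  rw [hhalf, hsum, map_mul, map_intCast, map_pow, expand_X, pow_mul]

theorem ne_zero_iff_even_or_odd (x : ℕ) : x ≠ 0 ↔ (Even x ∧ x ≠ 0) ∨ Odd x := by
  grind [Nat.not_even_iff_odd, Nat.even_or_odd]

theorem mk_sum_crankWeight_even (r : ℕ) :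
    (mk fun n => ∑ l : Overpartition n,
      (crankWeight r ((l.nonOverlined.filter (fun x => Even x)).map (fun x => x / 2)) : ℚ)) =
      distinctGf * (expand 2 two_ne_zero (crankSum r) * partsGf fun x => Odd x) := by
  have hodd (x : ℕ) (hx : Even x) : ¬ Odd x := Nat.not_odd_iff_even.2 hx
  have hsplit := tsum_parts_or_mul (R := ℚ) (s := fun x => x ≠ 0)
    (p := fun x => Even x ∧ x ≠ 0) (q := fun x => Odd x) (by simp) (by simp)
    (fun x hx => hodd x hx.1) ne_zero_iff_even_or_odd
    (fun μ => (crankWeight r ((μ.filter (fun x => Even x)).map (fun x => x / 2)) : ℚ⟦X⟧))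
    (fun μ => (crankWeight r (μ.map (· / 2)) : ℚ⟦X⟧)) (fun _ => 1) fun μ ν hμ hν => by
      rw [mul_one, filter_add_eq_left hodd (fun x hx => (hμ x hx).1) hν]
  rw [mk_sum_nonOverlined fun μ =>
    crankWeight r ((μ.filter (fun x => Even x)).map (fun x => x / 2)), hsplit,
    tsum_crankWeight_map_half, partsGf]
  simp only [one_mul]

theorem overGf_eq_even :
    overGf = distinctGf * (expand 2 two_ne_zero (crankSum 0) * partsGf fun x => Odd x) := by
  simp [← mk_sum_crankWeight_even, overGf, crankWeight_zero]

theorem finsum_mul_card_filter_eq {ι : Type*} [Fintype ι] (f : ι → ℤ) (w : ℤ → ℤ) :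
    ∑ᶠ m : ℤ, w m * ((Finset.univ.filter fun i => f i = m).card : ℤ) = ∑ i, w (f i) := by
  simp only [Finset.card_filter, Nat.cast_sum, Nat.cast_ite, Nat.cast_one, Nat.cast_zero,
    Finset.mul_sum, mul_ite, mul_one, mul_zero]
  rw [finsum_sum_comm _ _ fun i _ => (Set.finite_singleton (f i)).subset fun m hm => by
    by_contra h
    exact hm (if_neg (Ne.symm h))]
  refine Finset.sum_congr rfl fun i _ => ?_
  rw [finsum_eq_single _ (f i) fun m hm => if_neg hm.symm, if_pos rfl]

theorem coeff_statMoment_rank (k n : ℕ) :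
    coeff n (statMoment (fun _ l => l.rank) k) = (rankMoment k n : ℚ) := by
  simp only [statMoment, coeff_mk, rankMoment, rankCount,
    finsum_mul_card_filter_eq _ fun m => m ^ k, Int.cast_sum, Int.cast_pow]

theorem coeff_statMoment_m2Rank (k n : ℕ) :
    coeff n (statMoment (fun _ l => l.m2Rank) k) = (m2RankMoment k n : ℚ) := by
  simp only [statMoment, coeff_mk, m2RankMoment, m2RankCount,
    finsum_mul_card_filter_eq _ fun m => m ^ k, Int.cast_sum, Int.cast_pow]

theorem finsum_pow_mul_sum_crankContribution {ι : Type*} [Fintype ι] (f : ι → Multiset ℕ)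
    (k : ℕ) : ∑ᶠ m : ℤ, m ^ k * ∑ i, crankContribution (f i) m = ∑ i, crankWeight k (f i) := by
  simp only [Finset.mul_sum]
  exact finsum_sum_comm _ _ fun i _ => finite_support_crankContribution k (f i)

theorem crankMoment_eq (k n : ℕ) :
    crankMoment k n = ∑ l : Overpartition n, crankWeight k l.nonOverlined :=
  finsum_pow_mul_sum_crankContribution _ k

theorem crank2Moment_eq (k n : ℕ) : crank2Moment k n = ∑ l : Overpartition n,
    crankWeight k ((l.nonOverlined.filter (fun x => Even x)).map (fun x => x / 2)) :=
  finsum_pow_mul_sum_crankContribution _ k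

/-- The generating function of the first residual crank moments. -/
noncomputable def crankMomentGf (k : ℕ) : ℚ⟦X⟧ := mk fun n => (crankMoment k n : ℚ)

/-- The generating function of the second residual crank moments. -/
noncomputable def crank2MomentGf (k : ℕ) : ℚ⟦X⟧ := mk fun n => (crank2Moment k n : ℚ)

theorem coeff_crankMomentGf (k n : ℕ) : coeff n (crankMomentGf k) = (crankMoment k n : ℚ) :=
  coeff_mk _ _

theorem coeff_crank2MomentGf (k n : ℕ) : coeff n (crank2MomentGf k) = (crank2Moment k n : ℚ) :=
  coeff_mk _ _

theorem crankMomentGf_eq (k : ℕ) : crankMomentGf k = distinctGf * crankSum k := by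
  simp only [← mk_sum_crankWeight, crankMomentGf, crankMoment_eq, Int.cast_sum]

theorem crank2MomentGf_eq (k : ℕ) : crank2MomentGf k =
    distinctGf * (expand 2 two_ne_zero (crankSum k) * partsGf fun x => Odd x) := by
  simp only [← mk_sum_crankWeight_even, crank2MomentGf, crank2Moment_eq, Int.cast_sum]

theorem crankMomentGf_two : crankMomentGf 2 = 2 * lambert 1 * overGf := by
  rw [crankMomentGf_eq, overGf_eq, crankSum_eq (by decide), crankSum_eq (by decide),
    crankGfMoment_two]
  ring

theorem crankMomentGf_four :
    crankMomentGf 4 = (2 * lambert 3 + 12 * lambert 1 ^ 2) * overGf := by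
  rw [crankMomentGf_eq, overGf_eq, crankSum_eq (by decide), crankSum_eq (by decide),
    crankGfMoment_four]
  ring

theorem crank2MomentGf_two : crank2MomentGf 2 = 2 * lambertSq 1 * overGf := by
  rw [crank2MomentGf_eq, overGf_eq_even, crankSum_eq (by decide), crankSum_eq (by decide),
    crankGfMoment_two, map_mul, map_mul, map_ofNat, lambertSq]
  ring

theorem crank2MomentGf_four :
    crank2MomentGf 4 = (2 * lambertSq 3 + 12 * lambertSq 1 ^ 2) * overGf := by
  rw [crank2MomentGf_eq, overGf_eq_even, crankSum_eq (by decide), crankSum_eq (by decide),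
    crankGfMoment_four]
  simp only [map_mul, map_add, map_pow, map_ofNat, lambertSq]
  ring

/-! ### The moment identities -/

theorem eulerOp_overGf : eulerOp ℚ overGf = -(thetaLogDeriv * overGf) := by
  have h := congrArg (eulerOp ℚ) overGf_mul_thetaSeries
  rw [eulerOp_mul, eulerOp_thetaSeries, Derivation.map_one_eq_zero] at h
  refine mul_left_cancel₀ thetaSeries_ne_zero ?_
  linear_combination h

theorem three_mul_eulerOp_lambertSq :
    3 * eulerOp ℚ (lambertSq 1) = lambertSq 1 - 12 * lambertSq 1 ^ 2 + 5 * lambertSq 3 := by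
  have h := congrArg (expand 2 two_ne_zero) six_mul_eulerOp_lambert
  simp only [map_mul, map_add, map_sub, map_pow, map_ofNat] at h
  rw [lambertSq, lambertSq, eulerOp_expand]
  linear_combination h

theorem eulerOp_thetaLogDeriv :
    eulerOp ℚ thetaLogDeriv = 2 * (eulerOp ℚ (lambertSq 1) - eulerOp ℚ (lambert 1)) := by
  rw [thetaLogDeriv, eulerOp_ofNat_mul, map_sub]

theorem rank_identity :
    C 77 * statMoment (fun _ l => l.rank) 4 =
      -(C 616 * eulerOp ℚ (statMoment (fun _ l => l.rank) 2)) -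
        C 77 * statMoment (fun _ l => l.rank) 2 - C 216 * crankMomentGf 2 +
        C 24 * eulerOp ℚ (crankMomentGf 2) + C 192 * crankMomentGf 4 + C 260 * crank2MomentGf 2 +
        C 184 * eulerOp ℚ (crank2MomentGf 2) - C 280 * crank2MomentGf 4 := by
  have h1 := partialThetaMoment_one_identity
  have h2 := thetaLogDeriv_sq
  have h3 := six_mul_eulerOp_lambert
  have h4 := three_mul_eulerOp_lambertSq
  rw [eulerOp_thetaLogDeriv, thetaLogDeriv] at h1 h2
  rw [statMoment_rank_two, statMoment_rank_four, crankMomentGf_two, crankMomentGf_four,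
    crank2MomentGf_two, crank2MomentGf_four, map_neg]
  simp only [map_ofNat, mul_assoc]
  rw [eulerOp_ofNat_mul, eulerOp_ofNat_mul, eulerOp_ofNat_mul]
  simp only [eulerOp_mul, eulerOp_overGf, thetaLogDeriv]
  refine mul_left_cancel₀ (a := (3 : ℚ⟦X⟧)) (by norm_num) ?_
  linear_combination overGf * (-308 * h1 + 3200 * h2 - 680 * h3 + 944 * h4)

theorem m2Rank_identity :
    C 77 * statMoment (fun _ l => l.m2Rank) 4 =
      -(C 154 * eulerOp ℚ (statMoment (fun _ l => l.m2Rank) 2)) -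
        C 77 * statMoment (fun _ l => l.m2Rank) 2 - C 27 * crankMomentGf 2 +
        C 3 * eulerOp ℚ (crankMomentGf 2) + C 24 * crankMomentGf 4 + C 71 * crank2MomentGf 2 -
        C 131 * eulerOp ℚ (crank2MomentGf 2) - C 112 * crank2MomentGf 4 := by
  have h1 := partialThetaMoment_two_identity
  have h2 := thetaLogDeriv_sq
  have h3 := six_mul_eulerOp_lambert
  have h4 := three_mul_eulerOp_lambertSq
  rw [eulerOp_thetaLogDeriv, thetaLogDeriv] at h1 h2
  rw [statMoment_m2Rank_two, statMoment_m2Rank_four, crankMomentGf_two, crankMomentGf_four,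
    crank2MomentGf_two, crank2MomentGf_four, map_neg]
  simp only [map_ofNat, mul_assoc]
  rw [eulerOp_ofNat_mul, eulerOp_ofNat_mul, eulerOp_ofNat_mul]
  simp only [eulerOp_mul, eulerOp_overGf, thetaLogDeriv]
  refine mul_left_cancel₀ (a := (3 : ℚ⟦X⟧)) (by norm_num) ?_
  linear_combination overGf * (-77 * h1 + 92 * h2 - 8 * h3 + 272 * h4)

theorem corollary3p1 (n : ℕ) :
    (rankMoment 4 n : ℚ) =
        (-8 * (n : ℚ) - 1) * (rankMoment 2 n : ℚ)
          + (-216 + 24 * (n : ℚ)) / 77 * (crankMoment 2 n : ℚ)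
          + 192 / 77 * (crankMoment 4 n : ℚ)
          + (260 + 184 * (n : ℚ)) / 77 * (crank2Moment 2 n : ℚ)
          - 40 / 11 * (crank2Moment 4 n : ℚ) ∧
    (m2RankMoment 4 n : ℚ) =
        (-2 * (n : ℚ) - 1) * (m2RankMoment 2 n : ℚ)
          + (-27 + 3 * (n : ℚ)) / 77 * (crankMoment 2 n : ℚ)
          + 24 / 77 * (crankMoment 4 n : ℚ)
          + (71 - 131 * (n : ℚ)) / 77 * (crank2Moment 2 n : ℚ)
          - 16 / 11 * (crank2Moment 4 n : ℚ) := by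
  have hrank := congrArg (coeff n) rank_identity
  have hm2Rank := congrArg (coeff n) m2Rank_identity
  simp only [map_add, map_sub, map_neg, coeff_C_mul, coeff_eulerOp, coeff_statMoment_rank,
    coeff_statMoment_m2Rank, coeff_crankMomentGf, coeff_crank2MomentGf] at hrank hm2Rank
  constructor
  · linear_combination hrank / 77
  · linear_combination hm2Rank / 77
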